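/- Let $\mathbb K$ be a field of characteristic zero. **Lie idempotent series.** Let $T(X)=\bigoplus_n T_n(X)$ be the tensor algebra over a countably infinite set $X$, with its usual cocommutative bialgebra structure in which the elements of $X$ are primitive. For endomorphisms write $f\star g=\pi\circ(f\otimes g)\circ\Delta$ (convolution product). Let $p_n$ be the projection of $T(X)$ onto $T_n(X)$, let the descent algebra $\mathcal D$ be the convolution subalgebra of $\mathrm{End}(T(X))$ generated by the $p_n$, and let $\mathcal D_n$ be the span of the products $p_{i_1}\star\cdots\star p_{i_k}$ with $i_1+\cdots+i_k=n$. Let $Lie(X)\subset T(X)$ be the free Lie algebra, i.e. the Lie subalgebra generated by $X$, and $Lie_n(X)=Lie(X)\cap T_n(X)$. A Lie idempotent series is a sequence $\gamma=(\gamma_n)_{n\ge0}$ with $\gamma_n\in\mathcal D_n$ such that $\gamma_n$ is a projector from $T_n(X)$ onto $Lie_n(X)$. **Hopf algebras.** Let $H=\bigoplus_{n\in\mathbb N}H_n$ be a graded connected ($H_0=\mathbb K\cdot1$) cocommutative Hopf algebra over $\mathbb K$, and let $\hat H=\prod_n H_n$, with product $(gh)_n=\sum_{i+j=n}g_ih_j$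 and coproduct $\hat H\to\prod_{i,j}H_i\otimes H_j$. Let $G(H)$ be the set of $g\in\hat H$ with $\Delta g=g\otimes g$, $\varepsilon(g)=1$, and $Prim(H)$ the set of $h\in\hat H$ with $\Delta h=h\otimes1+1\otimes h$. **Theorem.** 1. $G(H)$ is a group under the product of $\hat H$, and is pro-unipotent: for every $N$ its truncation in degrees $\le N$ is a nilpotent group of unipotent elements, and $G(H)$ is the inverse limit of these truncations. $Prim(H)$ is a Lie subalgebra of $\hat H$, and is pro-nilpotent: its truncations in degrees $\le N$ are nilpotent, and it is the inverse limit of these. 2. There is a unique morphism of unital algebras from $\mathcal D$ to $\mathrm{End}(H)$ with the convolution product that sends, for all $n$, $p_n$ to the projection of $H$ onto $H_n$. Through it a sequence $\gamma_n\in\mathcal D_n$ acts on $\hat H$ by $\gamma(\sum_n h_n)=\sum_n\gamma_n(h_n)$. 3. Every Lie idempotent series $\gamma$ induces in this way a bijection $\gamma:G(H)\to Prim(H)$. This bijection is an isomorphism of inverse systems of sets: for all $N$ and $g,g'\in G(H)$, the elements $\gamma(g)$ and $\gamma(g')$ agree in degrees $\le N$ if and only if $g$ and $g'$ do. 4. The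 components $e_n$ of degree $n$ of the convolution logarithm $\sum_{k\ge1}\frac{(-1)^{k-1}}{k}(\mathrm{Id}-\varepsilon)^{\star k}$ of the identity of $T(X)$ (here $\varepsilon$ denotes the unit of $\star$) form a Lie idempotent series, the Eulerian series. On $G(H)$ it acts as $\log g=\sum_{k\ge1}\frac{(-1)^{k-1}}{k}(g-1)^k$, and the inverse bijection $Prim(H)\to G(H)$ is $\exp h=\sum_{k\ge0}h^k/k!$. 5. Let $D$ be the Dynkin operator on $T(X)$, $D(y_1\cdots y_n)=[\dots[[y_1,y_2],y_3]\dots,y_n]$ for $n\ge1$ and $y_i\in X$, $D(1)=0$, where $[x,y]=xy-yx$; let $D_n$ be its component of degree $n$. Then $D_n\in\mathcal D_n$, and the sequence with terms $D_n/n$ for $n\ge1$ and $0$ for $n=0$ is a Lie idempotent series. The Dynkin series $D=\sum_nD_n$ also induces a bijection $G(H)\to Prim(H)$, and its inverse is the map $\Gamma:Prim(H)\to G(H)$ given by $$\Gamma(h)=\sum_{n\ge0}\ \sum_{\substack{i_1+\cdots+i_k=n\\ i_j>0}}\frac{h_{i_1}\cdots h_{i_k}}{i_1(i_1+i_2)\cdots(i_1+\cdots+i_k)}\qquad\text{for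 } h=\sum_{n\ge 0}h_n.$$ Equivalently, the inverse of the bijection induced by the Dynkin idempotent series $(D_n/n)$ is $h\mapsto\Gamma\bigl(\sum_n n\,h_n\bigr)$. -/

import Mathlib

open scoped TensorProduct PowerSeries
open PowerSeries WithConv

attribute [local instance 100] LieRing.ofAssociativeRing

noncomputable section

namespace LieIdem

universe u v

/-! ## The tensor algebra on a countable set as a bialgebra -/

section TensorBialgebra

variable (R : Type u) [CommSemiring R] (M : Type v) [AddCommMonoid M] [Module R M]

/-- The usual cocommutative bialgebra structure on `TensorAlgebra R M`: the elements of `M` are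
primitive, `Δ (ι x) = ι x ⊗ 1 + 1 ⊗ ι x` and `ε (ι x) = 0`. -/
instance tensorBialgebra : Bialgebra R (TensorAlgebra R M) :=
  .ofAlgHom
    (TensorAlgebra.lift R <|
      (TensorProduct.mk R _ _).flip 1 ∘ₗ TensorAlgebra.ι R +
        TensorProduct.mk R _ _ 1 ∘ₗ TensorAlgebra.ι R)
    TensorAlgebra.algebraMapInv
    (by
      ext x
      simp [Algebra.TensorProduct.one_def, TensorProduct.add_tmul, TensorProduct.tmul_add]
      abel)
    (by ext x; simp [TensorAlgebra.algebraMapInv])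
    (by ext x; simp [TensorAlgebra.algebraMapInv])

theorem tensor_comul_ι (x : M) :
    Coalgebra.comul (R := R) (TensorAlgebra.ι R x) =
      TensorAlgebra.ι R x ⊗ₜ[R] 1 + 1 ⊗ₜ[R] TensorAlgebra.ι R x :=
  TensorAlgebra.lift_ι_apply _ x

theorem tensor_counit_ι (x : M) :
    Coalgebra.counit (R := R) (TensorAlgebra.ι R x) = 0 := by
  change TensorAlgebra.algebraMapInv (TensorAlgebra.ι R x) = 0
  simp [TensorAlgebra.algebraMapInv]

end TensorBialgebra

section Tensor

variable (K : Type u) [Field K]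

/-- `T(X)`, the tensor algebra over the countable set `X = ℕ`. -/
abbrev T : Type u := TensorAlgebra K (ℕ →₀ K)

/-- `T_n(X)`, the span of the words of length `n`. -/
abbrev tensorDeg (n : ℕ) : Submodule K (T K) :=
  LinearMap.range (TensorAlgebra.ι K : (ℕ →₀ K) →ₗ[K] T K) ^ n

/-- The letter `i ∈ X`, seen in `T(X)`. -/
def letter (i : ℕ) : T K := TensorAlgebra.ι K (Finsupp.single i 1)

/-- `Lie(X)`, the free Lie algebra over `X`: the Lie subalgebra of `T(X)` (with the bracket
`[x, y] = x y - y x`) that is generated by `X`. -/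
def freeLie : LieSubalgebra K (T K) :=
  LieSubalgebra.lieSpan K (T K) (Set.range (letter K))

/-- `Lie_n(X)`, the component of degree `n` of `Lie(X)`. -/
def freeLieDeg (n : ℕ) : Submodule K (T K) :=
  (freeLie K).toSubmodule ⊓ tensorDeg K n

end Tensor

/-! ## Graded projections, the descent algebra and Lie idempotent series -/

section Projections

variable {K : Type u} [Field K] {H : Type v} [Ring H] [Algebra K H]

/-- The graded projection `p_n : H → H_n`, as an element of `End(H)` with the convolution
product (this is the product carried by the type synonym `WithConv`). -/
def gradedProj (𝒜 : ℕ → Submodule K H) [GradedAlgebra 𝒜] (n : ℕ) : WithConv (H →ₗ[K] H) :=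
  toConv (GradedAlgebra.proj 𝒜 n)

end Projections

section Descent

variable (K : Type u) [Field K]

/-- The graded projection `p_n : T(X) → T_n(X)`. -/
def tensorProj (n : ℕ) : WithConv (T K →ₗ[K] T K) :=
  gradedProj (tensorDeg K) n

/-- The descent algebra `𝒟`: the convolution subalgebra of `End(T(X))` generated by the
graded projections. -/
def descentAlgebra : Subalgebra K (WithConv (T K →ₗ[K] T K)) :=
  Algebra.adjoin K (Set.range (tensorProj K))

/-- The generator `p_n` of the descent algebra. -/
def descentGen (n : ℕ) : descentAlgebra K :=
  ⟨tensorProj K n, Algebra.subset_adjoin ⟨n, rfl⟩⟩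

/-- The component `𝒟_n` of the descent algebra: the span of the convolution products
`p_{i₁} ⋆ ⋯ ⋆ p_{i_k}` with `i₁ + ⋯ + i_k = n`. -/
def descentDeg (n : ℕ) : Submodule K (descentAlgebra K) :=
  Submodule.span K {f | ∃ l : List ℕ, l.sum = n ∧ f = (l.map (descentGen K)).prod}

variable {K}

/-- A Lie idempotent series: for every `n`, an element `γ_n` of `𝒟_n` that is a projector from
`T_n(X)` onto `Lie_n(X)`. -/
structure IsLieIdempotentSeries (γ : ℕ → descentAlgebra K) : Prop where
  mem_descentDeg : ∀ n, γ n ∈ descentDeg K n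
  map_mem : ∀ n, ∀ x ∈ tensorDeg K n, (γ n).1.ofConv x ∈ freeLieDeg K n
  map_eq : ∀ n, ∀ x ∈ freeLieDeg K n, (γ n).1.ofConv x = x

variable (K)

/-- The Eulerian idempotents: the component of degree `n` of the convolution logarithm
`∑_{k ≥ 1} (-1)^(k-1) / k • (Id - ε)^{⋆ k}` of the identity of `T(X)`, where `ε` is the unit of
the convolution product. The powers with `k > n` vanish on `T_n(X)`. -/
def eulerian (n : ℕ) : T K →ₗ[K] T K :=
  (∑ k ∈ Finset.Icc 1 n, ((-1 : K) ^ (k - 1) / (k : K)) •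
    (toConv (LinearMap.id : T K →ₗ[K] T K) - 1) ^ k).ofConv ∘ₗ GradedAlgebra.proj (tensorDeg K) n

/-- The left-to-right iterated bracket `[…[[y₁, y₂], y₃]…, y_n]` of a word,
where `[x, y] = x y - y x`. -/
def iteratedBracket : List ℕ → T K
  | [] => 0
  | y :: ys => ys.foldl (fun a i => a * letter K i - letter K i * a) (letter K y)

/-- The Dynkin operator `D`: the linear map on `T(X)` that sends every word to its left-to-right
iterated bracket (and the empty word to `0`). It is defined on the basis of words. -/
def dynkin : T K →ₗ[K] T K :=
  ((Finsupp.basisSingleOne (R := K) (ι := ℕ)).tensorAlgebra).constr K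
    fun w : FreeMonoid ℕ => iteratedBracket K w.toList

/-- `D_n`, the action of `D` on the component `T_n(X)`. -/
def dynkinDeg (n : ℕ) : T K →ₗ[K] T K :=
  dynkin K ∘ₗ GradedAlgebra.proj (tensorDeg K) n

theorem basis_word (l : List ℕ) :
    (Finsupp.basisSingleOne (R := K) (ι := ℕ)).tensorAlgebra (FreeMonoid.ofList l) =
      (l.map (letter K)).prod := by
  have h (l : List ℕ) : FreeAlgebra.basisFreeMonoid K ℕ (FreeMonoid.ofList l) =
      (l.map (FreeAlgebra.ι K)).prod := by
    simp only [FreeAlgebra.basisFreeMonoid, Module.Basis.map_apply, Finsupp.coe_basisSingleOne]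
    induction l with
    | nil => exact map_one (FreeAlgebra.equivMonoidAlgebraFreeMonoid (R := K) (X := ℕ)).symm
    | cons a l ih =>
      rw [List.map_cons, List.prod_cons, ← ih]
      apply (FreeAlgebra.equivMonoidAlgebraFreeMonoid (R := K) (X := ℕ)).injective
      simp [FreeAlgebra.equivMonoidAlgebraFreeMonoid]
  simp only [Module.Basis.tensorAlgebra, Module.Basis.map_apply, h]
  simp only [AlgEquiv.toLinearEquiv_apply, map_list_prod, List.map_map]
  congr 2
  funext i
  simp [letter]

/-- The Dynkin operator on words. -/
theorem dynkin_word (l : List ℕ) :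
    dynkin K ((l.map (letter K)).prod) = iteratedBracket K l := by
  rw [← basis_word, dynkin, Module.Basis.constr_basis]
  rfl

end Descent

/-! ## Graded connected Hopf algebras and their completions

The completion `Ĥ = ∏ H_n` is realised inside the power series ring `H⟦X⟧`: the family
`(h_n)_n` is the series `∑ h_n X^n`. The product of `H⟦X⟧` is the product of `Ĥ`,
`(g h)_n = ∑_{i + j = n} g_i h_j`. -/

section Hopf

variable {K : Type u} [Field K] {H : Type v} [Ring H] [HopfAlgebra K H]

/-- The grading `H = ⨁ H_n` of the algebra `H` is compatible with the coproduct and the counit,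
and is connected: `H_0 = K · 1`. (The antipode then preserves the degree.) -/
structure IsConnectedGradedHopf (𝒜 : ℕ → Submodule K H) [GradedAlgebra 𝒜] : Prop where
  comul_mem : ∀ n, ∀ x ∈ 𝒜 n, Coalgebra.comul (R := K) x ∈
    ⨆ p : {p : ℕ × ℕ // p.1 + p.2 = n},
      LinearMap.range (TensorProduct.map (𝒜 p.1.1).subtype (𝒜 p.1.2).subtype)
  counit_eq_zero : ∀ n, n ≠ 0 → ∀ x ∈ 𝒜 n, Coalgebra.counit (R := K) x = 0
  connected : 𝒜 0 = 1

/-- The completion `Ĥ = ∏ H_n`. -/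
def completion (𝒜 : ℕ → Submodule K H) : Set H⟦X⟧ := {f | ∀ n, coeff n f ∈ 𝒜 n}

variable (𝒜 : ℕ → Submodule K H) [GradedAlgebra 𝒜]

/-- The component in `H_i ⊗ H_j` of the coproduct `Ĥ → ∏_{i, j} H_i ⊗ H_j`. -/
def completedComul (f : H⟦X⟧) (i j : ℕ) : H ⊗[K] H :=
  TensorProduct.map (GradedAlgebra.proj 𝒜 i) (GradedAlgebra.proj 𝒜 j)
    (Coalgebra.comul (R := K) (coeff (i + j) f))

/-- `G(H)`: the `g ∈ Ĥ` with `Δ g = g ⊗ g` and `ε g = 1`. -/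
def groupLike : Set H⟦X⟧ :=
  {g | g ∈ completion 𝒜 ∧ Coalgebra.counit (R := K) (coeff 0 g) = 1 ∧
    ∀ i j, completedComul 𝒜 g i j = coeff i g ⊗ₜ[K] coeff j g}

/-- `Prim(H)`: the `h ∈ Ĥ` with `Δ h = h ⊗ 1 + 1 ⊗ h`. -/
def primitive : Set H⟦X⟧ :=
  {h | h ∈ completion 𝒜 ∧
    ∀ i j, completedComul 𝒜 h i j =
      coeff i h ⊗ₜ[K] coeff j (1 : H⟦X⟧) + coeff i (1 : H⟦X⟧) ⊗ₜ[K] coeff j h}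

/-- `f` and `g` have the same components in degrees `≤ N`. -/
def TruncEq (N : ℕ) (f g : H⟦X⟧) : Prop := ∀ n ≤ N, coeff n f = coeff n g

/-- `G` is a pro-unipotent group of series: its truncations in degrees `≤ N` are groups of
unipotent elements and are nilpotent, and `G` is the inverse limit of these truncations. -/
structure IsProUnipotent (G : Subgroup H⟦X⟧ˣ) : Prop where
  unipotent : ∀ N, ∀ g ∈ G, TruncEq N (((g : H⟦X⟧) - 1) ^ (N + 1)) 0
  nilpotent : ∀ N, ∀ g ∈ G.lowerCentralSeries N, TruncEq N (g : H⟦X⟧) 1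
  complete : ∀ f : H⟦X⟧, (∀ N, ∃ g ∈ G, TruncEq N f (g : H⟦X⟧)) → ∃ g ∈ G, (g : H⟦X⟧) = f

/-- `L` is a pro-nilpotent Lie algebra of series: its truncations in degrees `≤ N` are nilpotent
and `L` is the inverse limit of these truncations. -/
structure IsProNilpotent (L : LieSubalgebra K H⟦X⟧) : Prop where
  nilpotent : ∀ N, ∀ x ∈ LieModule.lowerCentralSeries K L L N, TruncEq N (x : H⟦X⟧) 0
  complete : ∀ f : H⟦X⟧, (∀ N, ∃ g ∈ L, TruncEq N f g) → f ∈ L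

/-- The map on series induced by a series `γ` of elements `γ_n ∈ 𝒟_n` and an action `ρ` of `𝒟`
on `H`: it sends `∑ h_n` to `∑ γ_n(h_n)`. -/
def seriesMap (ρ : descentAlgebra K →ₐ[K] WithConv (H →ₗ[K] H)) (γ : ℕ → descentAlgebra K)
    (f : H⟦X⟧) : H⟦X⟧ :=
  PowerSeries.mk fun n => (ρ (γ n)).ofConv (coeff n f)

/-- `log g = ∑_{k ≥ 1} (-1)^(k-1) / k (g - 1)^k`, for `g` with `g_0 = 1`; the powers with `k > n`
have no component of degree `n`. -/
def seriesLog (g : H⟦X⟧) : H⟦X⟧ :=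
  PowerSeries.mk fun n => ∑ k ∈ Finset.Icc 1 n,
    ((-1 : K) ^ (k - 1) / (k : K)) • coeff n ((g - 1) ^ k)

/-- `exp h = ∑_{k ≥ 0} h^k / k!`, for `h` with `h_0 = 0`; the powers with `k > n` have no
component of degree `n`. -/
def seriesExp (h : H⟦X⟧) : H⟦X⟧ :=
  PowerSeries.mk fun n => ∑ k ∈ Finset.range (n + 1), ((k.factorial : K)⁻¹) • coeff n (h ^ k)

/-- The grading operation: `∑ h_n` is sent to `∑ n h_n`. -/
def gradingMap (h : H⟦X⟧) : H⟦X⟧ := PowerSeries.mk fun n => n • coeff n h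

/-- `Γ(h)`, whose component of degree `n` is the sum over the compositions `i₁ + ⋯ + i_k = n` of
`h_{i₁} ⋯ h_{i_k} / (i₁ (i₁ + i₂) ⋯ (i₁ + ⋯ + i_k))`. -/
def Gam (h : H⟦X⟧) : H⟦X⟧ :=
  PowerSeries.mk fun n => ∑ c : Composition n,
    (∏ j ∈ Finset.range c.length, (c.sizeUpTo (j + 1) : K))⁻¹ •
      (c.blocks.map fun i => coeff i h).prod

end Hopf

end LieIdem

end

/-!
The completion of `H` sits inside `H⟦X⟧`, where `G(H)` and `Prim(H)` become the series with
homogeneous coefficients that satisfy `Δ g = g ⊗ g` (constant term `1`) and `Δ h = h ⊗ 1 + 1 ⊗ h`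
(constant term `0`), see `mem_groupLike_iff` and `mem_primitive_iff`. All constructions are made over
arbitrary algebras, with three algebra maps `δ, l, r` in the roles of the coproduct and of the two
inclusions into the tensor square; they are then used for `H`, for `T(X)` and for convolution
algebras.

*The series `Γ`.* Let `Y = X d/dX` be the Euler derivation. The series `g = Γ(h)` is the solution of
`Y g = g h` with constant term `1` (`eulerDer_gamSeries`), so that `Γ` is inverse to the logarithmic
derivative `g ↦ g⁻¹ (Y g)` (`gamSeries_logDer`, `logDer_gamSeries`). As `Y` is a derivation, both
maps exchange group-like and primitive series.

*The action of the descent algebra.* A relation between the convolution products of the `p_n` on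
`T(X)` has to hold on `H` as well. The series `Γ(∑ x_i X^(i+1))` over `T(X)` is generic: each series
with constant term `1` over any algebra is its image under a substitution of the letters `x_i`
(`map_specialize`). Replacing `x_i` by the Lie polynomial `[x₀, [x₀, …, [x₀, x₁]]]` of degree `i + 1`
turns it into a group-like series of `T(X)` with homogeneous components, and this substitution is
injective (`letterLift_adLetter_injective`). Evaluation at a group-like series turns the convolution
product into the product of series (`groupLikeEval`); hence a relation between the `p_n` holds
between the components of the generic series, and so between those of the series `∑ p_n X^n` over
the convolution algebra of `H` (`projEval_eq_zero`).

*Lie idempotents.* The same specialization shows that a Lie idempotent series maps `G(H)` to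
`Prim(H)` (`IsLieIdempotentSeries.apply_groupLike`). On the primitive elements of degree `n` an
element of the descent algebra acts by a scalar that does not depend on the bialgebra
(`projEval_apply_primitive`), so `γ_n` fixes them. Two group-like series that agree in degrees `< n`
differ in degree `n` by a primitive element, and multiplication by the exponential of a primitive
element of degree `n` realizes each such difference: the map is triangular with respect to the
degree, hence bijective (`IsLieIdempotentSeries.bijOn`).

*The two examples.* Over the convolution algebra of a cocommutative bialgebra the series `∑ p_n X^n`
is group-like, with composition with the coproduct as `δ`. So its logarithm, the Eulerian series,
takes primitive values, and evaluation at `g` gives `log g`. The Dynkin operator satisfies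
`Id ⋆ D = Y` (`id_conv_dynkin_apply`), that is, the `D_n` are the coefficients of the logarithmic
derivative of `∑ p_n X^n`, and evaluation at `g` gives the logarithmic derivative of `g`, whose
inverse is `Γ`. On a primitive element of degree `n` the identity reads `D x = n x`, so primitive
elements of `T(X)` are Lie polynomials (`mem_freeLieDeg_of_primitive`); this is what makes both
series Lie idempotent series.
-/

attribute [local instance 100] LieRing.ofAssociativeRing

noncomputable section

namespace LieIdem

open Finset.HasAntidiagonal (antidiagonal mem_antidiagonal)

/-! ### Substitution of a series without constant term into a scalar series -/

section Substitution

variable {K : Type*} [Field K] {A B : Type*} [Ring A] [Algebra K A] [Ring B] [Algebra K B]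

theorem coeff_pow_eq_zero {a : A⟦X⟧} (ha : coeff 0 a = 0) {n k : ℕ} (h : n < k) :
    coeff n (a ^ k) = 0 := by
  induction k generalizing n with
  | zero => omega
  | succ k ih =>
    rw [pow_succ', coeff_mul]
    refine Finset.sum_eq_zero fun p hp => ?_
    rw [mem_antidiagonal] at hp
    rcases Nat.eq_zero_or_pos p.1 with h0 | h0
    · rw [h0, ha, zero_mul]
    · rw [ih (by omega), mul_zero]

theorem coeff_pow_mul_pow_eq_zero {a b : A⟦X⟧} (ha : coeff 0 a = 0) (hb : coeff 0 b = 0)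
    {n i j : ℕ} (h : n < i + j) : coeff n (a ^ i * b ^ j) = 0 := by
  rw [coeff_mul]
  refine Finset.sum_eq_zero fun p hp => ?_
  rw [mem_antidiagonal] at hp
  rcases lt_or_ge p.1 i with h0 | h0
  · rw [coeff_pow_eq_zero ha h0, zero_mul]
  · rw [coeff_pow_eq_zero hb (by omega), mul_zero]

/-- The series `∑ u_k a^k` obtained by substituting `a` into the scalar series `u`. It is
meaningful when `a` has no constant term, so that the powers with `k > n` have no component of
degree `n`. -/
def evalSeries (a : A⟦X⟧) (u : K⟦X⟧) : A⟦X⟧ :=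
  PowerSeries.mk fun n => ∑ k ∈ Finset.range (n + 1), coeff k u • coeff n (a ^ k)

/-- Any bound beyond the degree may be used to truncate the sum `∑ u_k a^k`. -/
theorem coeff_evalSeries {a : A⟦X⟧} (ha : coeff 0 a = 0) (u : K⟦X⟧) {n N : ℕ} (h : n < N) :
    coeff n (evalSeries a u) = ∑ k ∈ Finset.range N, coeff k u • coeff n (a ^ k) := by
  rw [evalSeries, coeff_mk]
  refine Finset.sum_subset (Finset.range_mono h) fun k _ hk => ?_
  rw [coeff_pow_eq_zero ha (by simpa using hk), smul_zero]

theorem sum_range_range_eq_sum_antidiagonal {M : Type*} [AddCommMonoid M] (N : ℕ)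
    (F : ℕ → ℕ → M) (hF : ∀ i j, N ≤ i + j → F i j = 0) :
    ∑ i ∈ Finset.range N, ∑ j ∈ Finset.range N, F i j =
      ∑ k ∈ Finset.range N, ∑ p ∈ antidiagonal k, F p.1 p.2 := by
  rw [← Finset.sum_product', Finset.sum_sigma']
  symm
  refine Finset.sum_of_injOn (fun x => x.2) ?_ ?_ ?_ ?_
  · rintro ⟨k, p⟩ hp ⟨k', p'⟩ hp' h
    simp only [Finset.coe_sigma, Set.mem_sigma_iff, Finset.mem_coe,
      mem_antidiagonal] at hp hp' h
    subst h
    obtain rfl : k = k' := by omega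
    rfl
  · rintro ⟨k, p⟩ hp
    simp only [Finset.coe_sigma, Set.mem_sigma_iff, Finset.mem_coe, Finset.mem_range,
      mem_antidiagonal, Finset.coe_product, Set.mem_prod] at hp ⊢
    omega
  · rintro ⟨i, j⟩ _ h
    refine hF i j ?_
    by_contra hlt
    exact h ⟨⟨i + j, (i, j)⟩, by simpa using hlt, rfl⟩
  · intros; rfl

theorem coeff_evalSeries_mul {a b : A⟦X⟧} (ha : coeff 0 a = 0) (hb : coeff 0 b = 0)
    (u v : K⟦X⟧) (n : ℕ) :
    coeff n (evalSeries a u * evalSeries b v) = ∑ k ∈ Finset.range (n + 1),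
      ∑ p ∈ antidiagonal k, (coeff p.1 u * coeff p.2 v) • coeff n (a ^ p.1 * b ^ p.2) := by
  rw [← sum_range_range_eq_sum_antidiagonal (n + 1)
    (fun i j => (coeff i u * coeff j v) • coeff n (a ^ i * b ^ j))
    fun i j h => by rw [coeff_pow_mul_pow_eq_zero ha hb h, smul_zero]]
  have h1 : ∀ p ∈ antidiagonal n, coeff p.1 (evalSeries a u) * coeff p.2 (evalSeries b v) =
      ∑ i ∈ Finset.range (n + 1), ∑ j ∈ Finset.range (n + 1),
        (coeff i u * coeff j v) • (coeff p.1 (a ^ i) * coeff p.2 (b ^ j)) := by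
    intro p hp
    rw [mem_antidiagonal] at hp
    rw [coeff_evalSeries ha u (show p.1 < n + 1 by omega),
      coeff_evalSeries hb v (show p.2 < n + 1 by omega), Finset.sum_mul_sum]
    simp only [smul_mul_smul_comm]
  rw [coeff_mul, Finset.sum_congr rfl h1, Finset.sum_comm]
  refine Finset.sum_congr rfl fun i _ => ?_
  rw [Finset.sum_comm]
  refine Finset.sum_congr rfl fun j _ => ?_
  rw [coeff_mul, Finset.smul_sum]

theorem evalSeries_mul {a : A⟦X⟧} (ha : coeff 0 a = 0) (u v : K⟦X⟧) :
    evalSeries a (u * v) = evalSeries a u * evalSeries a v := by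
  ext n
  rw [coeff_evalSeries_mul ha ha, evalSeries, coeff_mk]
  refine Finset.sum_congr rfl fun k _ => ?_
  rw [coeff_mul, Finset.sum_smul]
  refine Finset.sum_congr rfl fun p hp => ?_
  rw [← pow_add, mem_antidiagonal.1 hp]

theorem evalSeries_one {a : A⟦X⟧} : evalSeries a (1 : K⟦X⟧) = 1 := by
  ext n
  rw [evalSeries, coeff_mk, Finset.sum_eq_single 0]
  · simp
  · intro k _ hk
    rw [coeff_one, if_neg hk, zero_smul]
  · simp

theorem evalSeries_pow {a : A⟦X⟧} (ha : coeff 0 a = 0) (u : K⟦X⟧) (k : ℕ) :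
    evalSeries a (u ^ k) = evalSeries a u ^ k := by
  induction k with
  | zero => rw [pow_zero, pow_zero, evalSeries_one]
  | succ k ih => rw [pow_succ, pow_succ, evalSeries_mul ha, ih]

theorem evalSeries_add (a : A⟦X⟧) (u v : K⟦X⟧) :
    evalSeries a (u + v) = evalSeries a u + evalSeries a v := by
  ext n
  simp [evalSeries, add_smul, Finset.sum_add_distrib]

theorem evalSeries_X {a : A⟦X⟧} (ha : coeff 0 a = 0) : evalSeries a (X : K⟦X⟧) = a := by
  ext n
  rw [coeff_evalSeries ha _ (show n < n + 2 by omega), Finset.sum_eq_single 1]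
  · simp
  · intro k _ hk
    rw [coeff_X, if_neg hk, zero_smul]
  · simp

theorem coeff_zero_evalSeries (a : A⟦X⟧) (u : K⟦X⟧) :
    coeff 0 (evalSeries a u) = algebraMap K A (coeff 0 u) := by
  simp [evalSeries, Algebra.algebraMap_eq_smul_one]

/-- Substitution is associative. -/
theorem evalSeries_evalSeries {a : A⟦X⟧} (ha : coeff 0 a = 0) {b : K⟦X⟧} (hb : coeff 0 b = 0)
    (u : K⟦X⟧) : evalSeries (evalSeries a b) u = evalSeries a (evalSeries b u) := by
  ext n
  have h0 : coeff 0 (evalSeries a b) = 0 := by rw [coeff_zero_evalSeries, hb, map_zero]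
  rw [coeff_evalSeries h0 u (Nat.lt_succ_self n), coeff_evalSeries ha _ (Nat.lt_succ_self n)]
  have h1 : ∀ k ∈ Finset.range n.succ, coeff k (evalSeries b u) • coeff n (a ^ k) =
      ∑ j ∈ Finset.range n.succ, coeff j u • (coeff k (b ^ j) • coeff n (a ^ k)) := by
    intro k hk
    rw [coeff_evalSeries hb u (Finset.mem_range.1 hk), Finset.sum_smul]
    simp only [smul_assoc]
  rw [Finset.sum_congr rfl h1, Finset.sum_comm]
  refine Finset.sum_congr rfl fun j _ => ?_
  rw [← Finset.smul_sum, ← evalSeries_pow ha, coeff_evalSeries ha _ (Nat.lt_succ_self n)]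

theorem map_evalSeries (f : A →ₐ[K] B) (a : A⟦X⟧) (u : K⟦X⟧) :
    PowerSeries.map (f : A →+* B) (evalSeries a u) = evalSeries (PowerSeries.map (f : A →+* B) a) u := by
  ext n
  simp only [evalSeries, coeff_map, coeff_mk, map_sum, ← map_pow]
  refine Finset.sum_congr rfl fun k _ => ?_
  simp

end Substitution

/-! ### Exponential and logarithm -/

section ExpLog

variable (K : Type*) [Field K]

/-- The scalar series `exp X - 1`. -/
def expSubOne : K⟦X⟧ := PowerSeries.mk fun k => if k = 0 then 0 else (k.factorial : K)⁻¹

/-- The scalar series `log (1 + X)`. -/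
def logOneAdd : K⟦X⟧ := PowerSeries.mk fun k => if k = 0 then 0 else (-1 : K) ^ (k - 1) / (k : K)

variable [CharZero K]

theorem derivative_expSubOne : derivative K (expSubOne K) = 1 + expSubOne K := by
  ext n
  rw [coeff_derivative, expSubOne, coeff_mk, map_add, coeff_mk, coeff_one]
  have h : ((n + 1 : ℕ) : K) ≠ 0 := Nat.cast_ne_zero.2 (Nat.succ_ne_zero n)
  rcases n with _ | n
  · simp
  · rw [if_neg (Nat.succ_ne_zero _), if_neg (Nat.succ_ne_zero _), if_neg (Nat.succ_ne_zero _),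
      zero_add, Nat.factorial_succ (n + 1), Nat.cast_mul, mul_inv]
    push_cast at h ⊢
    field_simp

theorem one_add_X_mul_derivative_logOneAdd :
    (1 + X) * derivative K (logOneAdd K) = 1 := by
  have h (n : ℕ) : coeff n (derivative K (logOneAdd K)) = (-1 : K) ^ n := by
    have h : ((n : K) + 1) ≠ 0 := by exact_mod_cast Nat.succ_ne_zero n
    rw [coeff_derivative, logOneAdd, coeff_mk, if_neg (Nat.succ_ne_zero _)]
    push_cast
    field_simp
  ext n
  rw [add_mul, one_mul, map_add, h]
  rcases n with _ | n
  · simp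
  · rw [coeff_succ_X_mul, h, coeff_one, if_neg (Nat.succ_ne_zero _), pow_succ]
    ring

omit [CharZero K] in
theorem derivative_evalSeries {a : K⟦X⟧} (ha : coeff 0 a = 0) (u : K⟦X⟧) :
    derivative K (evalSeries a u) = evalSeries a (derivative K u) * derivative K a := by
  ext n
  have h1 : ∀ p ∈ antidiagonal n, coeff p.1 (evalSeries a (derivative K u)) *
      coeff p.2 (derivative K a) = ∑ k ∈ Finset.range (n + 1),
        coeff (k + 1) u * ((k + 1) * (coeff p.1 (a ^ k) * coeff p.2 (derivative K a))) := by
    intro p hp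
    rw [mem_antidiagonal] at hp
    rw [coeff_evalSeries ha _ (show p.1 < n + 1 by omega), Finset.sum_mul]
    refine Finset.sum_congr rfl fun k _ => ?_
    rw [coeff_derivative, smul_eq_mul]
    ring
  rw [coeff_mul, Finset.sum_congr rfl h1, Finset.sum_comm, coeff_derivative,
    coeff_evalSeries ha u (Nat.lt_succ_self (n + 1)), Finset.sum_mul, Finset.sum_range_succ']
  have h2 : coeff (n + 1) (a ^ 0) = 0 := by simp [coeff_one]
  rw [h2, smul_zero, zero_mul, add_zero]
  refine Finset.sum_congr rfl fun k _ => ?_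
  rw [← Finset.mul_sum, ← Finset.mul_sum, ← coeff_mul, smul_eq_mul, mul_assoc, ← coeff_derivative,
    Derivation.leibniz_pow]
  simp only [Nat.add_sub_cancel, smul_eq_mul, nsmul_eq_mul]
  rw [← map_natCast (C (R := K)), coeff_C_mul]
  push_cast
  rfl

omit [CharZero K] in
theorem coeff_zero_expSubOne : coeff 0 (expSubOne K) = 0 := by simp [expSubOne]

omit [CharZero K] in
theorem coeff_zero_logOneAdd : coeff 0 (logOneAdd K) = 0 := by simp [logOneAdd]

theorem evalSeries_expSubOne_logOneAdd : evalSeries (expSubOne K) (logOneAdd K) = X := by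
  have h0 := coeff_zero_expSubOne K
  refine derivative.ext ?_ ?_
  · have h := congrArg (evalSeries (expSubOne K)) (one_add_X_mul_derivative_logOneAdd K)
    rw [evalSeries_mul h0, evalSeries_add, evalSeries_one, evalSeries_X h0] at h
    rw [derivative_evalSeries K h0, derivative_expSubOne, derivative_X, mul_comm, h]
  · rw [← coeff_zero_eq_constantCoeff_apply, coeff_zero_evalSeries, coeff_zero_logOneAdd]
    simp

/-- With `G = exp (log (1 + X))`, the equation `(1 + X) G' = G` determines `G = 1 + X`. -/
theorem evalSeries_logOneAdd_expSubOne : evalSeries (logOneAdd K) (expSubOne K) = X := by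
  have h0 := coeff_zero_logOneAdd K
  set G := evalSeries (logOneAdd K) (expSubOne K) with hG
  have hd : (1 + X) * derivative K G = 1 + G := by
    rw [hG, derivative_evalSeries K h0, derivative_expSubOne, evalSeries_add, evalSeries_one,
      mul_left_comm, one_add_X_mul_derivative_logOneAdd, mul_one]
  have hG0 : coeff 0 G = 0 := by rw [hG, coeff_zero_evalSeries, coeff_zero_expSubOne, map_zero]
  have hs (n : ℕ) : coeff (n + 1) G = if n = 0 then 1 else 0 := by
    induction n with
    | zero =>
      have := congrArg (coeff 0) hd
      rw [add_mul, one_mul, map_add, map_add, coeff_derivative, coeff_zero_X_mul, hG0] at this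
      simpa using this
    | succ n ih =>
      have := congrArg (coeff (n + 1)) hd
      rw [add_mul, one_mul, map_add, map_add, coeff_derivative, coeff_succ_X_mul, coeff_derivative,
        ih, coeff_one, if_neg (Nat.succ_ne_zero _)] at this
      have h1 : ((n + 1 : ℕ) : K) + 1 ≠ 0 := by exact_mod_cast Nat.succ_ne_zero (n + 1)
      have h2 : (if n = 0 then (1 : K) else 0) * (n + 1) = 0 + if n = 0 then 1 else 0 := by
        split_ifs with h <;> simp [h]
      rw [h2] at this
      rw [if_neg (Nat.succ_ne_zero n)]
      push_cast at h1
      simpa [h1] using this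
  ext n
  rcases n with _ | n
  · simp [hG0]
  · rw [hs, coeff_X]
    simp

variable {K} {A B : Type*} [Ring A] [Algebra K A] [Ring B] [Algebra K B]

omit [CharZero K]

variable (K) in
/-- The exponential `∑ a^k / k!` of a series without constant term. -/
def expSeries (a : A⟦X⟧) : A⟦X⟧ := 1 + evalSeries a (expSubOne K)

variable (K) in
/-- The logarithm `∑ (-1)^(k-1) / k (g - 1)^k` of a series with constant term `1`. -/
def logSeries (g : A⟦X⟧) : A⟦X⟧ := evalSeries (g - 1) (logOneAdd K)

theorem coeff_zero_expSeries (a : A⟦X⟧) : coeff 0 (expSeries K a) = 1 := by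
  rw [expSeries, map_add, coeff_zero_evalSeries, coeff_zero_expSubOne]
  simp

theorem coeff_zero_logSeries (g : A⟦X⟧) : coeff 0 (logSeries K g) = 0 := by
  rw [logSeries, coeff_zero_evalSeries, coeff_zero_logOneAdd, map_zero]

theorem coeff_zero_sub_one {g : A⟦X⟧} (hg : coeff 0 g = 1) : coeff 0 (g - 1) = 0 := by
  rw [map_sub, hg]; simp

theorem expSeries_logSeries [CharZero K] {g : A⟦X⟧} (hg : coeff 0 g = 1) :
    expSeries K (logSeries K g) = g := by
  have h0 := coeff_zero_sub_one hg
  rw [expSeries, logSeries, evalSeries_evalSeries h0 (coeff_zero_logOneAdd K),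
    evalSeries_logOneAdd_expSubOne, evalSeries_X h0, add_sub_cancel]

theorem logSeries_expSeries [CharZero K] {a : A⟦X⟧} (ha : coeff 0 a = 0) :
    logSeries K (expSeries K a) = a := by
  rw [expSeries, logSeries, add_sub_cancel_left,
    evalSeries_evalSeries ha (coeff_zero_expSubOne K), evalSeries_expSubOne_logOneAdd,
    evalSeries_X ha]

theorem map_expSeries (f : A →ₐ[K] B) (a : A⟦X⟧) :
    PowerSeries.map (f : A →+* B) (expSeries K a) =
      expSeries K (PowerSeries.map (f : A →+* B) a) := by
  rw [expSeries, expSeries, map_add, map_one, map_evalSeries]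

theorem map_logSeries (f : A →ₐ[K] B) (g : A⟦X⟧) :
    PowerSeries.map (f : A →+* B) (logSeries K g) =
      logSeries K (PowerSeries.map (f : A →+* B) g) := by
  rw [logSeries, logSeries, map_evalSeries, map_sub, map_one]

theorem expSeries_eq_evalSeries (a : A⟦X⟧) :
    expSeries K a = evalSeries a (PowerSeries.mk fun k => ((k.factorial : K)⁻¹)) := by
  rw [expSeries, ← evalSeries_one (K := K) (a := a), ← evalSeries_add]
  congr 1
  ext n
  rcases n with _ | n <;> simp [expSubOne, coeff_one]

theorem coeff_expSeries (a : A⟦X⟧) (n : ℕ) : coeff n (expSeries K a) =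
    ∑ k ∈ Finset.range (n + 1), ((k.factorial : K)⁻¹) • coeff n (a ^ k) := by
  rw [expSeries_eq_evalSeries, evalSeries, coeff_mk]
  simp only [coeff_mk]

theorem coeff_logSeries (g : A⟦X⟧) (n : ℕ) : coeff n (logSeries K g) =
    ∑ k ∈ Finset.Icc 1 n, ((-1 : K) ^ (k - 1) / (k : K)) • coeff n ((g - 1) ^ k) := by
  rw [logSeries, evalSeries, coeff_mk]
  symm
  refine Finset.sum_subset_zero_on_sdiff (fun k hk => ?_) (fun k hk => ?_) (fun k hk => ?_)
  · simp at hk ⊢; omega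
  · have : k = 0 := by simp at hk; omega
    subst this
    rw [coeff_zero_logOneAdd, zero_smul]
  · rw [logOneAdd, coeff_mk, if_neg (by simp at hk; omega)]

/-- The binomial formula gives `exp (a + b) = exp a exp b` for commuting series. -/
theorem expSeries_add [CharZero K] {a b : A⟦X⟧} (ha : coeff 0 a = 0) (hb : coeff 0 b = 0)
    (h : Commute a b) : expSeries K (a + b) = expSeries K a * expSeries K b := by
  ext n
  rw [expSeries_eq_evalSeries a, expSeries_eq_evalSeries b, coeff_evalSeries_mul ha hb,
    coeff_expSeries]
  refine Finset.sum_congr rfl fun k _ => ?_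
  rw [h.add_pow', map_sum, Finset.smul_sum]
  refine Finset.sum_congr rfl fun p hp => ?_
  rw [mem_antidiagonal] at hp
  rw [map_nsmul, ← Nat.cast_smul_eq_nsmul K, smul_smul, coeff_mk, coeff_mk]
  congr 1
  subst hp
  rw [Nat.choose_symm_add, Nat.add_choose, Nat.cast_div (Nat.factorial_mul_factorial_dvd_factorial_add _ _)
    (by exact_mod_cast (Nat.mul_ne_zero (Nat.factorial_ne_zero _) (Nat.factorial_ne_zero _)))]
  have h3 : ((p.1 + p.2).factorial : K) ≠ 0 := by exact_mod_cast Nat.factorial_ne_zero _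
  push_cast
  field_simp

end ExpLog

/-! ### The Euler derivation and the series `Γ` -/

section Euler

variable {K : Type*} [Field K] {A B : Type*} [Ring A] [Algebra K A] [Ring B] [Algebra K B]

/-- The Euler derivation `X d/dX`, which multiplies the component of degree `n` by `n`. -/
def eulerDer (f : A⟦X⟧) : A⟦X⟧ := PowerSeries.mk fun n => n • coeff n f

@[simp]
theorem coeff_eulerDer (f : A⟦X⟧) (n : ℕ) : coeff n (eulerDer f) = n • coeff n f := coeff_mk _ _

theorem eulerDer_mul (f g : A⟦X⟧) : eulerDer (f * g) = eulerDer f * g + f * eulerDer g := by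
  ext n
  rw [coeff_eulerDer, map_add, coeff_mul, coeff_mul, coeff_mul, ← Finset.sum_add_distrib,
    Finset.smul_sum]
  refine Finset.sum_congr rfl fun p hp => ?_
  rw [mem_antidiagonal] at hp
  rw [coeff_eulerDer, coeff_eulerDer, smul_mul_assoc, mul_smul_comm, ← add_smul, hp]

theorem map_eulerDer (f : A →+* B) (g : A⟦X⟧) :
    PowerSeries.map f (eulerDer g) = eulerDer (PowerSeries.map f g) := by
  ext n; simp

variable (K)

include K in
/-- The equation `X g' = g h` has at most one solution with a given constant term: it expresses
`n g_n` through the lower components of `g`. -/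
theorem eq_of_eulerDer_eq [CharZero K] {g g' h : A⟦X⟧} (hh : coeff 0 h = 0)
    (h0 : coeff 0 g = coeff 0 g') (hg : eulerDer g = g * h) (hg' : eulerDer g' = g' * h) :
    g = g' := by
  ext n
  induction n using Nat.strong_induction_on with
  | _ n ih =>
    rcases Nat.eq_zero_or_pos n with rfl | hn
    · exact h0
    have h1 : n • coeff n g = n • coeff n g' := by
      rw [← coeff_eulerDer, ← coeff_eulerDer, hg, hg', coeff_mul, coeff_mul]
      refine Finset.sum_congr rfl fun p hp => ?_
      rw [mem_antidiagonal] at hp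
      rcases Nat.eq_zero_or_pos p.2 with h2 | h2
      · rw [h2, hh, mul_zero, mul_zero]
      · rw [ih p.1 (by omega)]
    rw [← Nat.cast_smul_eq_nsmul K, ← Nat.cast_smul_eq_nsmul K] at h1
    exact smul_right_injective A (Nat.cast_ne_zero.2 hn.ne') h1

/-- The weight of a list `[i₁, …, i_k]` in the series `Γ(h)`. -/
def gamWeight (h : A⟦X⟧) (l : List ℕ) : A :=
  (∏ j ∈ Finset.range l.length, ((l.take (j + 1)).sum : K))⁻¹ • (l.map fun i => coeff i h).prod

theorem gamWeight_append_singleton (h : A⟦X⟧) (l : List ℕ) (b : ℕ) :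
    gamWeight K h (l ++ [b]) = ((l.sum + b : ℕ) : K)⁻¹ • (gamWeight K h l * coeff b h) := by
  have h1 : ∏ j ∈ Finset.range l.length, (((l ++ [b]).take (j + 1)).sum : K) =
      ∏ j ∈ Finset.range l.length, ((l.take (j + 1)).sum : K) := by
    refine Finset.prod_congr rfl fun j hj => ?_
    rw [List.take_append_of_le_length (by simpa using hj)]
  rw [gamWeight, gamWeight, List.length_append, List.length_singleton, Finset.prod_range_succ, h1,
    mul_inv_rev, List.map_append, List.prod_append, mul_smul, smul_mul_assoc]
  simp

/-- The series `Γ(h)`, over an arbitrary algebra. -/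
def gamSeries (h : A⟦X⟧) : A⟦X⟧ :=
  PowerSeries.mk fun n => ∑ c : Composition n, gamWeight K h c.blocks

theorem coeff_zero_gamSeries (h : A⟦X⟧) : coeff 0 (gamSeries K h) = 1 := by
  rw [gamSeries, coeff_mk, Fintype.sum_eq_single default]
  · have : (default : Composition 0).blocks = [] := (Composition.blocks_eq_nil _).2 rfl
    rw [this]
    simp [gamWeight]
  · intro c hc
    refine absurd (Composition.ext ?_) hc
    rw [(Composition.blocks_eq_nil c).2 rfl, (Composition.blocks_eq_nil _).2 rfl]

/-- Splitting off the last part of a composition shows that `g = Γ(h)` solves `X g' = g h`. -/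
theorem eulerDer_gamSeries [CharZero K] {h : A⟦X⟧} (hh : coeff 0 h = 0) :
    eulerDer (gamSeries K h) = gamSeries K h * h := by
  ext n
  rw [coeff_eulerDer, coeff_mul]
  rcases Nat.eq_zero_or_pos n with rfl | hn
  · simp [hh]
  have h1 : ∑ p ∈ antidiagonal n, coeff p.1 (gamSeries K h) * coeff p.2 h =
      ∑ p ∈ (antidiagonal n).filter (fun p => 0 < p.2),
        ∑ c : Composition p.1, gamWeight K h c.blocks * coeff p.2 h := by
    rw [Finset.sum_filter]
    refine Finset.sum_congr rfl fun p _ => ?_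
    split_ifs with h2
    · rw [gamSeries, coeff_mk, Finset.sum_mul]
    · rw [show p.2 = 0 by omega, hh, mul_zero]
  rw [h1, Finset.sum_sigma', gamSeries, coeff_mk, Finset.smul_sum]
  symm
  have hpos (x : Σ p : ℕ × ℕ, Composition p.1)
      (hx : x ∈ ((antidiagonal n).filter (fun p => 0 < p.2)).sigma fun _ => Finset.univ) :
      x.1.1 + x.1.2 = n ∧ 0 < x.1.2 := by
    simpa [mem_antidiagonal] using hx
  refine Finset.sum_bij (fun x hx => ⟨x.2.blocks ++ [x.1.2], ?_, ?_⟩) ?_ ?_ ?_ ?_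
  · intro i hi
    rcases List.mem_append.1 hi with hi | hi
    · exact x.2.blocks_pos hi
    · rw [List.mem_singleton.1 hi]; exact (hpos x hx).2
  · rw [List.sum_append, x.2.blocks_sum, List.sum_singleton, (hpos x hx).1]
  · intros; exact Finset.mem_univ _
  · rintro ⟨⟨i, j⟩, c⟩ hx ⟨⟨i', j'⟩, c'⟩ hx' he
    have he := congrArg Composition.blocks he
    obtain ⟨h2, h3⟩ := List.append_inj' he rfl
    have h4 : i = i' := c.blocks_sum.symm.trans ((congrArg List.sum h2).trans c'.blocks_sum)
    obtain rfl : j = j' := by simpa using h3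
    subst h4
    obtain rfl : c = c' := Composition.ext h2
    rfl
  · intro c _
    have hne : c.blocks ≠ [] := by rw [Ne, c.blocks_eq_nil]; exact hn.ne'
    have hd := List.dropLast_append_getLast hne
    have hs : c.blocks.dropLast.sum + c.blocks.getLast hne = n := by
      conv_rhs => rw [← c.blocks_sum, ← hd]
      simp
    refine ⟨⟨(c.blocks.dropLast.sum, c.blocks.getLast hne), ⟨c.blocks.dropLast,
      fun hi => c.blocks_pos (List.mem_of_mem_dropLast hi), rfl⟩⟩, ?_, ?_⟩
    · simp only [Finset.mem_sigma, Finset.mem_filter, mem_antidiagonal, Finset.mem_univ, and_true]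
      exact ⟨hs, c.blocks_pos (List.getLast_mem hne)⟩
    · exact Composition.ext hd
  · intro x hx
    have hn' : (n : K) ≠ 0 := Nat.cast_ne_zero.2 hn.ne'
    rw [gamWeight_append_singleton, x.2.blocks_sum, (hpos x hx).1, ← Nat.cast_smul_eq_nsmul K,
      smul_inv_smul₀ hn']

variable {K}

theorem map_gamSeries (f : A →ₐ[K] B) (h : A⟦X⟧) :
    PowerSeries.map (f : A →+* B) (gamSeries K h) =
      gamSeries K (PowerSeries.map (f : A →+* B) h) := by
  ext n
  simp only [gamSeries, gamWeight, coeff_map, coeff_mk, map_sum]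
  refine Finset.sum_congr rfl fun c _ => ?_
  simp [map_list_prod, List.map_map, Function.comp_def]

end Euler

/-! ### Inverses of series with constant term `1` -/

section Inverse

variable {A B : Type*} [Ring A] [Ring B]

/-- The inverse of a series with constant term `1`. -/
def seriesInv (g : A⟦X⟧) : A⟦X⟧ := invOfUnit g 1

theorem mul_seriesInv {g : A⟦X⟧} (hg : coeff 0 g = 1) : g * seriesInv g = 1 :=
  mul_invOfUnit g 1 (by rw [← coeff_zero_eq_constantCoeff_apply, hg]; rfl)

theorem seriesInv_mul {g : A⟦X⟧} (hg : coeff 0 g = 1) : seriesInv g * g = 1 :=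
  invOfUnit_mul g 1 (by rw [← coeff_zero_eq_constantCoeff_apply, hg]; rfl)

/-- The logarithmic derivative `g⁻¹ (X g')`. -/
def logDer (g : A⟦X⟧) : A⟦X⟧ := seriesInv g * eulerDer g

theorem mul_logDer {g : A⟦X⟧} (hg : coeff 0 g = 1) : g * logDer g = eulerDer g := by
  rw [logDer, ← mul_assoc, mul_seriesInv hg, one_mul]

theorem coeff_zero_logDer (g : A⟦X⟧) : coeff 0 (logDer g) = 0 := by
  rw [logDer, coeff_mul]; simp

theorem logDer_eq {g h : A⟦X⟧} (hg : coeff 0 g = 1) (h1 : eulerDer g = g * h) : logDer g = h := by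
  rw [logDer, h1, ← mul_assoc, seriesInv_mul hg, one_mul]

theorem map_logDer (f : A →+* B) {g : A⟦X⟧} (hg : coeff 0 g = 1) :
    PowerSeries.map f (logDer g) = logDer (PowerSeries.map f g) := by
  refine (logDer_eq ?_ ?_).symm
  · rw [coeff_map, hg, map_one]
  · rw [← map_mul, mul_logDer hg, map_eulerDer]

variable {K : Type*} [Field K] [CharZero K] [Algebra K A]

/-- Every series with constant term `1` is a value of `Γ`, namely at its logarithmic derivative. -/
theorem gamSeries_logDer {g : A⟦X⟧} (hg : coeff 0 g = 1) : gamSeries K (logDer g) = g :=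
  eq_of_eulerDer_eq K (coeff_zero_logDer g) (by rw [coeff_zero_gamSeries, hg])
    (eulerDer_gamSeries K (coeff_zero_logDer g)) (mul_logDer hg).symm

theorem logDer_gamSeries {h : A⟦X⟧} (hh : coeff 0 h = 0) : logDer (gamSeries K h) = h :=
  logDer_eq (coeff_zero_gamSeries K h) (eulerDer_gamSeries K hh)

end Inverse

/-! ### Group-like and primitive series

The coproduct enters through three algebra maps `δ, l, r : A → B`, where the images of `l` and `r`
commute. -/

section GroupLike

variable {K : Type*} [Field K] {A B : Type*} [Ring A] [Algebra K A] [Ring B] [Algebra K B]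
  (δ l r : A →ₐ[K] B)

/-- A series `g` with constant term `1` and `δ g = l g * r g`. For `δ` the coproduct of a bialgebra
and `l`, `r` the two inclusions into its tensor square, this is `Δ g = g ⊗ g`. -/
structure IsGroupLikeSeries (g : A⟦X⟧) : Prop where
  coeff_zero : coeff 0 g = 1
  map_eq : PowerSeries.map (δ : A →+* B) g =
    PowerSeries.map (l : A →+* B) g * PowerSeries.map (r : A →+* B) g

/-- A series `h` without constant term and with `δ h = l h + r h`. -/
structure IsPrimitiveSeries (h : A⟦X⟧) : Prop where
  coeff_zero : coeff 0 h = 0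
  map_eq : PowerSeries.map (δ : A →+* B) h =
    PowerSeries.map (l : A →+* B) h + PowerSeries.map (r : A →+* B) h

variable {δ l r}

theorem commute_map_map (hc : ∀ a b, Commute (l a) (r b)) (f g : A⟦X⟧) :
    Commute (PowerSeries.map (l : A →+* B) f) (PowerSeries.map (r : A →+* B) g) := by
  ext n
  rw [coeff_mul, coeff_mul, ← Finset.Nat.sum_antidiagonal_swap]
  refine Finset.sum_congr rfl fun p _ => ?_
  simpa using (hc _ _).eq

theorem coeff_zero_map_eq {a : A} {f : A⟦X⟧} (δ : A →ₐ[K] B) (h : coeff 0 f = a) :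
    coeff 0 (PowerSeries.map (δ : A →+* B) f) = δ a := by
  rw [coeff_map, h]; rfl

theorem IsPrimitiveSeries.map_coeff_eq {h : A⟦X⟧} (hh : IsPrimitiveSeries δ l r h) (n : ℕ) :
    δ (coeff n h) = l (coeff n h) + r (coeff n h) := by
  have := congrArg (coeff n) hh.map_eq
  simp only [map_add, coeff_map] at this
  exact this

variable [CharZero K] (hc : ∀ a b, Commute (l a) (r b))
include hc

theorem IsPrimitiveSeries.expSeries {h : A⟦X⟧} (hh : IsPrimitiveSeries δ l r h) :
    IsGroupLikeSeries δ l r (expSeries K h) where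
  coeff_zero := coeff_zero_expSeries h
  map_eq := by
    rw [map_expSeries, map_expSeries, map_expSeries, hh.map_eq, expSeries_add _ _
      (commute_map_map hc h h)]
    · rw [coeff_zero_map_eq l hh.coeff_zero, map_zero]
    · rw [coeff_zero_map_eq r hh.coeff_zero, map_zero]

theorem IsGroupLikeSeries.logSeries {g : A⟦X⟧} (hg : IsGroupLikeSeries δ l r g) :
    IsPrimitiveSeries δ l r (logSeries K g) where
  coeff_zero := coeff_zero_logSeries g
  map_eq := by
    have h0 := coeff_zero_logSeries (K := K) g
    have h0l := coeff_zero_map_eq l h0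
    have h0r := coeff_zero_map_eq r h0
    rw [map_zero] at h0l h0r
    rw [map_logSeries, hg.map_eq]
    conv_lhs => rw [← expSeries_logSeries (K := K) hg.coeff_zero]
    rw [map_expSeries, map_expSeries, ← expSeries_add h0l h0r (commute_map_map hc _ _),
      logSeries_expSeries]
    rw [map_add, h0l, h0r, add_zero]

/-- Both sides of `δ g = l g * r g` solve `X f' = f (l h + r h)`. -/
theorem IsPrimitiveSeries.gamSeries {h : A⟦X⟧} (hh : IsPrimitiveSeries δ l r h) :
    IsGroupLikeSeries δ l r (gamSeries K h) where
  coeff_zero := coeff_zero_gamSeries K h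
  map_eq := by
    have h0 := coeff_zero_gamSeries K h
    have he := eulerDer_gamSeries K hh.coeff_zero
    refine eq_of_eulerDer_eq K (h := PowerSeries.map (δ : A →+* B) h) ?_ ?_ ?_ ?_
    · rw [coeff_zero_map_eq δ hh.coeff_zero, map_zero]
    · rw [coeff_mul, Finset.Nat.antidiagonal_zero, Finset.sum_singleton, coeff_zero_map_eq δ h0,
        coeff_zero_map_eq l h0, coeff_zero_map_eq r h0, map_one, map_one, map_one, one_mul]
    · rw [← map_eulerDer, he, map_mul]
    · rw [eulerDer_mul, ← map_eulerDer, ← map_eulerDer, he, map_mul, map_mul, hh.map_eq,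
        mul_add, mul_assoc, (commute_map_map hc h _).eq]
      simp only [mul_assoc]

omit [CharZero K] in
theorem IsGroupLikeSeries.logDer {g : A⟦X⟧} (hg : IsGroupLikeSeries δ l r g) :
    IsPrimitiveSeries δ l r (logDer g) where
  coeff_zero := coeff_zero_logDer g
  map_eq := by
    have h0 := hg.coeff_zero
    set d := PowerSeries.map (δ : A →+* B)
    set a := PowerSeries.map (l : A →+* B)
    set b := PowerSeries.map (r : A →+* B)
    have h1 : d g * d (LieIdem.logDer g) = d g * (a (LieIdem.logDer g) + b (LieIdem.logDer g)) := by
      rw [← map_mul, mul_logDer h0, map_eulerDer]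
      change eulerDer (d g) = _
      rw [hg.map_eq, eulerDer_mul, ← map_eulerDer, ← map_eulerDer, ← mul_logDer h0, map_mul,
        map_mul, mul_add, mul_assoc, (commute_map_map hc _ g).eq]
      simp only [mul_assoc, a, b]
    have h2 : d (seriesInv g) * d g = 1 := by rw [← map_mul, seriesInv_mul h0, map_one]
    calc _ = d (seriesInv g) * d g * d (LieIdem.logDer g) := by rw [h2, one_mul]
      _ = d (seriesInv g) * d g * (a (LieIdem.logDer g) + b (LieIdem.logDer g)) := by
        rw [mul_assoc, h1, mul_assoc]
      _ = _ := by rw [h2, one_mul]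

omit [CharZero K] in
theorem IsGroupLikeSeries.mul {g g' : A⟦X⟧} (hg : IsGroupLikeSeries δ l r g)
    (hg' : IsGroupLikeSeries δ l r g') : IsGroupLikeSeries δ l r (g * g') where
  coeff_zero := by simp [coeff_mul, hg.coeff_zero, hg'.coeff_zero]
  map_eq := by
    rw [map_mul, map_mul, map_mul, hg.map_eq, hg'.map_eq, mul_assoc, mul_assoc]
    congr 1
    rw [← mul_assoc, ← mul_assoc, (commute_map_map hc g' g).eq]

omit [CharZero K] in
theorem IsGroupLikeSeries.inv {g g' : A⟦X⟧} (hg : IsGroupLikeSeries δ l r g)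
    (h1 : g * g' = 1) (h2 : g' * g = 1) : IsGroupLikeSeries δ l r g' where
  coeff_zero := by
    have := congrArg (coeff 0) h1
    simpa [coeff_mul, hg.coeff_zero] using this
  map_eq := by
    set d := PowerSeries.map (δ : A →+* B)
    set a := PowerSeries.map (l : A →+* B)
    set b := PowerSeries.map (r : A →+* B)
    have e1 : d g' * d g = 1 := by rw [← map_mul, h2, map_one]
    have e2 : a g * a g' = 1 := by rw [← map_mul, h1, map_one]
    have e3 : b g * b g' = 1 := by rw [← map_mul, h1, map_one]
    have e4 : d g * (a g' * b g') = 1 := by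
      rw [hg.map_eq, mul_assoc, ← mul_assoc (b g), ← (commute_map_map hc g' g).eq, mul_assoc, e3,
        mul_one, e2]
    exact left_inv_eq_right_inv e1 e4

end GroupLike

/-! ### Graded connected bialgebras -/

section Graded

variable {K : Type*} [Field K] {H : Type*} [Ring H] [Algebra K H]
  (𝒜 : ℕ → Submodule K H) [GradedAlgebra 𝒜]

theorem proj_mem (n : ℕ) (x : H) : GradedAlgebra.proj 𝒜 n x ∈ 𝒜 n := by
  rw [GradedAlgebra.proj_apply]; exact SetLike.coe_mem _

theorem proj_of_mem {n : ℕ} {x : H} (hx : x ∈ 𝒜 n) (m : ℕ) :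
    GradedAlgebra.proj 𝒜 m x = if m = n then x else 0 := by
  rw [GradedAlgebra.proj_apply]
  split_ifs with h
  · rw [h, DirectSum.decompose_of_mem_same 𝒜 hx]
  · rw [DirectSum.decompose_of_mem_ne 𝒜 hx (Ne.symm h)]

theorem proj_proj (m n : ℕ) (x : H) :
    GradedAlgebra.proj 𝒜 m (GradedAlgebra.proj 𝒜 n x) =
      if m = n then GradedAlgebra.proj 𝒜 n x else 0 :=
  proj_of_mem 𝒜 (proj_mem 𝒜 n x) m

/-- Linear maps that agree on all homogeneous components are equal. -/
theorem linearMap_ext_graded {M : Type*} [AddCommMonoid M] [Module K M] {f g : H →ₗ[K] M}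
    (h : ∀ n, ∀ x ∈ 𝒜 n, f x = g x) : f = g := by
  ext x
  induction x using DirectSum.Decomposition.inductionOn 𝒜 with
  | zero => simp
  | homogeneous m => exact h _ _ m.2
  | add x y hx hy => rw [map_add, map_add, hx, hy]

theorem proj_mul (n : ℕ) (x y : H) :
    GradedAlgebra.proj 𝒜 n (x * y) = ∑ p ∈ antidiagonal n,
      GradedAlgebra.proj 𝒜 p.1 x * GradedAlgebra.proj 𝒜 p.2 y := by
  have key : (LinearMap.mul K H).compr₂ (GradedAlgebra.proj 𝒜 n) = ∑ p ∈ antidiagonal n,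
      (LinearMap.mul K H).compl₁₂ (GradedAlgebra.proj 𝒜 p.1) (GradedAlgebra.proj 𝒜 p.2) := by
    refine linearMap_ext_graded 𝒜 fun i x hx => linearMap_ext_graded 𝒜 fun j y hy => ?_
    simp only [LinearMap.compr₂_apply, LinearMap.mul_apply', LinearMap.sum_apply,
      LinearMap.compl₁₂_apply, proj_of_mem 𝒜 hx, proj_of_mem 𝒜 hy,
      proj_of_mem 𝒜 (SetLike.mul_mem_graded hx hy)]
    by_cases h : n = i + j
    · rw [if_pos h, Finset.sum_eq_single (i, j)]
      · simp
      · rintro ⟨a, b⟩ hab hne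
        rw [mem_antidiagonal] at hab
        by_cases ha : a = i
        · rw [if_neg (show b ≠ j by rintro rfl; exact hne (by rw [ha])), mul_zero]
        · rw [if_neg ha, zero_mul]
      · intro hn
        exact absurd (mem_antidiagonal.2 h.symm) hn
    · rw [if_neg h, Finset.sum_eq_zero]
      rintro ⟨a, b⟩ hab
      rw [mem_antidiagonal] at hab
      by_cases ha : a = i
      · rw [if_neg (show b ≠ j by rintro rfl; exact h (by rw [← ha, ← hab])), mul_zero]
      · rw [if_neg ha, zero_mul]
  simpa using LinearMap.congr_fun₂ key x y

/-- The algebra map `x ↦ ∑ p_n(x) X^n` that separates the homogeneous components. -/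
def splitHom : H →ₐ[K] H⟦X⟧ where
  toFun x := PowerSeries.mk fun n => GradedAlgebra.proj 𝒜 n x
  map_one' := by
    ext n
    rw [coeff_mk, proj_of_mem 𝒜 SetLike.GradedOne.one_mem, coeff_one]
  map_mul' x y := by
    ext n
    rw [coeff_mul, coeff_mk, proj_mul]
    simp
  map_zero' := by ext n; simp
  map_add' x y := by ext n; simp
  commutes' c := by
    ext n
    rw [coeff_mk, proj_of_mem 𝒜 (SetLike.algebraMap_mem_graded 𝒜 c), PowerSeries.algebraMap_apply, coeff_C]

theorem splitHom_apply (x : H) :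
    splitHom 𝒜 x = PowerSeries.mk fun n => GradedAlgebra.proj 𝒜 n x := rfl

@[simp]
theorem coeff_splitHom (n : ℕ) (x : H) :
    coeff n (splitHom 𝒜 x) = GradedAlgebra.proj 𝒜 n x := by
  rw [splitHom_apply, coeff_mk]

end Graded

section GradedBialgebra

variable {K : Type*} [Field K] {H : Type*} [Ring H] [Bialgebra K H]

/-- The grading is compatible with the coproduct and the counit, and is connected; the condition
on the coproduct is expressed by the graded projections. -/
structure IsConnectedGradedBialgebra (𝒜 : ℕ → Submodule K H) [GradedAlgebra 𝒜] : Prop where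
  comul_proj : ∀ n x, Coalgebra.comul (R := K) (GradedAlgebra.proj 𝒜 n x) =
    ∑ p ∈ antidiagonal n, TensorProduct.map (GradedAlgebra.proj 𝒜 p.1) (GradedAlgebra.proj 𝒜 p.2)
      (Coalgebra.comul (R := K) x)
  counit_eq_zero : ∀ n, n ≠ 0 → ∀ x ∈ 𝒜 n, Coalgebra.counit (R := K) x = 0
  connected : 𝒜 0 = 1

variable {𝒜 : ℕ → Submodule K H} [GradedAlgebra 𝒜]

namespace IsConnectedGradedBialgebra

variable (h𝒜 : IsConnectedGradedBialgebra 𝒜)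
include h𝒜

theorem eq_algebraMap_counit {x : H} (hx : x ∈ 𝒜 0) :
    x = algebraMap K H (Coalgebra.counit (R := K) x) := by
  rw [h𝒜.connected, Submodule.mem_one] at hx
  obtain ⟨c, rfl⟩ := hx
  rw [Bialgebra.counit_algebraMap]

theorem counit_proj (n : ℕ) (x : H) : Coalgebra.counit (R := K) (GradedAlgebra.proj 𝒜 n x) =
    if n = 0 then Coalgebra.counit (R := K) x else 0 := by
  split_ifs with h
  · subst h
    have : (Coalgebra.counit (R := K)) ∘ₗ GradedAlgebra.proj 𝒜 0 =
        (Coalgebra.counit (R := K) (A := H)) := by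
      refine linearMap_ext_graded 𝒜 fun n x hx => ?_
      rw [LinearMap.comp_apply, proj_of_mem 𝒜 hx]
      split_ifs with h
      · rfl
      · rw [map_zero, h𝒜.counit_eq_zero n (Ne.symm h) x hx]
    exact LinearMap.congr_fun this x
  · exact h𝒜.counit_eq_zero n h _ (proj_mem 𝒜 n x)

/-- In a connected bialgebra the projection onto degree `0` is the unit of the convolution
product. -/
theorem gradedProj_zero : gradedProj 𝒜 0 = 1 := by
  ext x
  change GradedAlgebra.proj 𝒜 0 x = _
  rw [h𝒜.eq_algebraMap_counit (proj_mem 𝒜 0 x), h𝒜.counit_proj, if_pos rfl]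
  rfl

variable {B : Type*} [Ring B] [Algebra K B]

theorem conv_comp_proj (f g : WithConv (H →ₗ[K] B)) (n : ℕ) :
    toConv ((f * g).ofConv ∘ₗ GradedAlgebra.proj 𝒜 n) = ∑ p ∈ antidiagonal n,
      toConv (f.ofConv ∘ₗ GradedAlgebra.proj 𝒜 p.1) *
        toConv (g.ofConv ∘ₗ GradedAlgebra.proj 𝒜 p.2) := by
  ext x
  simp only [LinearMap.comp_apply, ofConv_sum, LinearMap.sum_apply]
  change LinearMap.mul' K B (TensorProduct.map f.ofConv g.ofConv (Coalgebra.comul (R := K) _)) =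
    ∑ p ∈ antidiagonal n, LinearMap.mul' K B (TensorProduct.map _ _ (Coalgebra.comul (R := K) x))
  rw [h𝒜.comul_proj, map_sum, map_sum]
  refine Finset.sum_congr rfl fun p _ => ?_
  rw [TensorProduct.map_comp]
  rfl

/-- The algebra map `f ↦ ∑ (f ∘ p_n) X^n` on a convolution algebra. -/
def degHom : WithConv (H →ₗ[K] B) →ₐ[K] (WithConv (H →ₗ[K] B))⟦X⟧ where
  toFun f := PowerSeries.mk fun n => toConv (f.ofConv ∘ₗ GradedAlgebra.proj 𝒜 n)
  map_one' := by
    ext n x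
    rw [coeff_mk, coeff_one]
    change algebraMap K B (Coalgebra.counit (R := K) (GradedAlgebra.proj 𝒜 n x)) = _
    rw [h𝒜.counit_proj]
    split_ifs with h
    · rfl
    · rw [map_zero]; rfl
  map_mul' f g := by
    ext1 n
    rw [coeff_mul, coeff_mk, h𝒜.conv_comp_proj]
    simp only [coeff_mk]
  map_zero' := by ext n x; simp
  map_add' f g := by ext n x; simp
  commutes' c := by
    ext n x
    rw [coeff_mk, PowerSeries.algebraMap_apply, coeff_C]
    rw [Algebra.algebraMap_eq_smul_one]
    change c • algebraMap K B (Coalgebra.counit (R := K) (GradedAlgebra.proj 𝒜 n x)) = _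
    rw [h𝒜.counit_proj]
    split_ifs with h
    · rfl
    · rw [map_zero, smul_zero]; rfl

theorem degHom_apply (f : WithConv (H →ₗ[K] B)) : h𝒜.degHom f =
    PowerSeries.mk fun n => toConv (f.ofConv ∘ₗ GradedAlgebra.proj 𝒜 n) := rfl

theorem coeff_degHom (f : WithConv (H →ₗ[K] B)) (n : ℕ) :
    coeff n (h𝒜.degHom f) = toConv (f.ofConv ∘ₗ GradedAlgebra.proj 𝒜 n) := by
  rw [degHom_apply, coeff_mk]

theorem degHom_injective :
    Function.Injective (h𝒜.degHom : WithConv (H →ₗ[K] B) → (WithConv (H →ₗ[K] B))⟦X⟧) := by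
  intro f g hfg
  refine WithConv.ext (linearMap_ext_graded 𝒜 fun n x hx => ?_)
  have := congrArg (fun s => (coeff n s).ofConv x) hfg
  simpa [coeff_degHom, proj_of_mem 𝒜 hx] using this

theorem degHom_gradedProj (n : ℕ) :
    h𝒜.degHom (gradedProj 𝒜 n) = monomial n (gradedProj 𝒜 n) := by
  ext m x
  rw [coeff_degHom, coeff_monomial]
  change GradedAlgebra.proj 𝒜 n (GradedAlgebra.proj 𝒜 m x) = _
  rw [proj_proj]
  split_ifs with h1 h2 h2
  · rw [h1]; rfl
  · exact absurd h1.symm h2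
  · exact absurd h2.symm h1
  · rfl

end IsConnectedGradedBialgebra

/-- `IsGroupLikeSeries` for the coproduct of a bialgebra: `Δ g = g ⊗ g`. -/
abbrev IsGroupLikeIn (g : H⟦X⟧) : Prop :=
  IsGroupLikeSeries (Bialgebra.comulAlgHom K H) Algebra.TensorProduct.includeLeft
    Algebra.TensorProduct.includeRight g

/-- `IsPrimitiveSeries` for the coproduct of a bialgebra: `Δ h = h ⊗ 1 + 1 ⊗ h`. -/
abbrev IsPrimitiveIn (h : H⟦X⟧) : Prop :=
  IsPrimitiveSeries (Bialgebra.comulAlgHom K H) Algebra.TensorProduct.includeLeft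
    Algebra.TensorProduct.includeRight h

theorem commute_includeLeft_includeRight (a b : H) :
    Commute ((Algebra.TensorProduct.includeLeft : H →ₐ[K] H ⊗[K] H) a)
      (Algebra.TensorProduct.includeRight b) := by
  simp [Commute, SemiconjBy]

theorem IsGroupLikeSeries.comul_coeff {g : H⟦X⟧} (hg : IsGroupLikeIn (K := K) g) (n : ℕ) :
    Coalgebra.comul (R := K) (coeff n g) =
      ∑ p ∈ antidiagonal n, coeff p.1 g ⊗ₜ[K] coeff p.2 g := by
  have := congrArg (coeff n) hg.map_eq
  rw [coeff_mul] at this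
  simpa using this

theorem IsPrimitiveSeries.comul_coeff {h : H⟦X⟧} (hh : IsPrimitiveIn (K := K) h) (n : ℕ) :
    Coalgebra.comul (R := K) (coeff n h) = coeff n h ⊗ₜ[K] 1 + 1 ⊗ₜ[K] coeff n h := by
  have := congrArg (coeff n) hh.map_eq
  simpa using this

theorem IsGroupLikeSeries.of_comul_coeff {g : H⟦X⟧} (h0 : coeff 0 g = 1)
    (hg : ∀ n, Coalgebra.comul (R := K) (coeff n g) =
      ∑ p ∈ antidiagonal n, coeff p.1 g ⊗ₜ[K] coeff p.2 g) : IsGroupLikeIn (K := K) g where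
  coeff_zero := h0
  map_eq := by
    ext1 n
    rw [coeff_mul]
    simpa using hg n

theorem IsPrimitiveSeries.of_comul_coeff {h : H⟦X⟧} (h0 : coeff 0 h = 0)
    (hh : ∀ n, Coalgebra.comul (R := K) (coeff n h) = coeff n h ⊗ₜ[K] 1 + 1 ⊗ₜ[K] coeff n h) :
    IsPrimitiveIn (K := K) h where
  coeff_zero := h0
  map_eq := by
    ext1 n
    simpa using hh n

variable {B : Type*} [Ring B] [Algebra K B]

variable (h𝒜 : IsConnectedGradedBialgebra 𝒜) {g : H⟦X⟧} (hg : IsGroupLikeIn (K := K) g)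
  (hgm : ∀ n, coeff n g ∈ 𝒜 n)

/-- Evaluation at a group-like series: for `Δ g = g ⊗ g` one has `(f ⋆ f')(g) = f(g) f'(g)`, so
that `f ↦ ∑ f(g_n) X^n` is an algebra map. -/
def groupLikeEval : WithConv (H →ₗ[K] B) →ₐ[K] B⟦X⟧ where
  toFun f := PowerSeries.mk fun n => f.ofConv (coeff n g)
  map_one' := by
    ext n
    rw [coeff_mk, coeff_one]
    change algebraMap K B (Coalgebra.counit (R := K) (coeff n g)) = _
    split_ifs with h
    · rw [h, hg.coeff_zero, Bialgebra.counit_one, map_one]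
    · rw [h𝒜.counit_eq_zero n h _ (hgm n), map_zero]
  map_mul' f f' := by
    ext n
    rw [coeff_mul, coeff_mk, LinearMap.convMul_apply, hg.comul_coeff]
    simp
  map_zero' := by ext n; simp
  map_add' f g := by ext n; simp
  commutes' c := by
    ext n
    rw [coeff_mk, PowerSeries.algebraMap_apply, coeff_C]
    rw [Algebra.algebraMap_eq_smul_one]
    change c • algebraMap K B (Coalgebra.counit (R := K) (coeff n g)) = _
    split_ifs with h
    · rw [h, hg.coeff_zero, Bialgebra.counit_one, map_one, Algebra.algebraMap_eq_smul_one]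
    · rw [h𝒜.counit_eq_zero n h _ (hgm n), map_zero, smul_zero]

theorem groupLikeEval_apply (f : WithConv (H →ₗ[K] B)) :
    groupLikeEval h𝒜 hg hgm f = PowerSeries.mk fun n => f.ofConv (coeff n g) := rfl

theorem coeff_groupLikeEval (f : WithConv (H →ₗ[K] B)) (n : ℕ) :
    coeff n (groupLikeEval h𝒜 hg hgm f) = f.ofConv (coeff n g) := by
  rw [groupLikeEval_apply, coeff_mk]

theorem groupLikeEval_gradedProj (n : ℕ) :
    groupLikeEval h𝒜 hg hgm (gradedProj 𝒜 n) = monomial n (coeff n g) := by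
  ext m
  rw [coeff_groupLikeEval, coeff_monomial]
  change GradedAlgebra.proj 𝒜 n (coeff m g) = _
  rw [proj_of_mem 𝒜 (hgm m)]
  split_ifs with h1 h2 h2
  · rw [h1]
  · exact absurd h1.symm h2
  · exact absurd h2.symm h1
  · rfl

end GradedBialgebra

section TensorGraded

variable (K : Type*) [Field K]

theorem tensorAlgHom_ext {A : Type*} [Ring A] [Algebra K A] {f g : T K →ₐ[K] A}
    (h : ∀ i, f (letter K i) = g (letter K i)) : f = g := by
  refine TensorAlgebra.hom_ext (Finsupp.lhom_ext' fun i => LinearMap.ext_ring ?_)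
  exact h i

theorem comul_letter (i : ℕ) : Coalgebra.comul (R := K) (letter K i) =
    letter K i ⊗ₜ[K] 1 + 1 ⊗ₜ[K] letter K i := tensor_comul_ι _ _ _

theorem counit_letter (i : ℕ) : Coalgebra.counit (R := K) (letter K i) = 0 :=
  tensor_counit_ι _ _ _

theorem letter_mem (i : ℕ) : letter K i ∈ tensorDeg K 1 := by
  rw [tensorDeg, pow_one]
  exact LinearMap.mem_range_self _ _

theorem splitHom_letter (i : ℕ) :
    splitHom (tensorDeg K) (letter K i) = monomial 1 (letter K i) := by
  ext n
  rw [coeff_splitHom, proj_of_mem _ (letter_mem K i), coeff_monomial]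

theorem commute_splitHom (x y : T K) :
    Commute (((mapAlgHom (Algebra.TensorProduct.includeLeft : T K →ₐ[K] T K ⊗[K] T K)).comp
      (splitHom (tensorDeg K))) x)
      (((mapAlgHom (Algebra.TensorProduct.includeRight : T K →ₐ[K] T K ⊗[K] T K)).comp
      (splitHom (tensorDeg K))) y) :=
  commute_map_map (K := K) commute_includeLeft_includeRight _ _

/-- The algebra map `x ⊗ y ↦ ∑ p_i(x) ⊗ p_j(y) X^(i+j)`. -/
def splitTensor : T K ⊗[K] T K →ₐ[K] (T K ⊗[K] T K)⟦X⟧ :=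
  Algebra.TensorProduct.lift
    ((mapAlgHom (Algebra.TensorProduct.includeLeft : T K →ₐ[K] T K ⊗[K] T K)).comp
      (splitHom (tensorDeg K)))
    ((mapAlgHom (Algebra.TensorProduct.includeRight : T K →ₐ[K] T K ⊗[K] T K)).comp
      (splitHom (tensorDeg K)))
    (commute_splitHom K)

theorem splitTensor_tmul (x y : T K) : splitTensor K (x ⊗ₜ[K] y) =
    mapAlgHom (Algebra.TensorProduct.includeLeft : T K →ₐ[K] T K ⊗[K] T K)
      (splitHom (tensorDeg K) x) *
    mapAlgHom (Algebra.TensorProduct.includeRight : T K →ₐ[K] T K ⊗[K] T K)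
      (splitHom (tensorDeg K) y) :=
  Algebra.TensorProduct.lift_tmul _ _ _ _ _

theorem coeff_splitTensor (n : ℕ) (z : T K ⊗[K] T K) : coeff n (splitTensor K z) =
    ∑ p ∈ antidiagonal n, TensorProduct.map (GradedAlgebra.proj (tensorDeg K) p.1)
      (GradedAlgebra.proj (tensorDeg K) p.2) z := by
  induction z with
  | zero => simp
  | add x y hx hy => rw [map_add, map_add, hx, hy, ← Finset.sum_add_distrib]; simp
  | tmul x y =>
    rw [splitTensor_tmul, coeff_mul]
    simp [mapAlgHom_apply]

/-- Both sides of `Δ p_n = ∑ (p_i ⊗ p_j) Δ` are the components of algebra maps on `T(X)`, which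
agree on letters. -/
theorem tensor_isConnectedGradedBialgebra : IsConnectedGradedBialgebra (tensorDeg K) where
  comul_proj n x := by
    have h : (mapAlgHom (Bialgebra.comulAlgHom K (T K))).comp (splitHom (tensorDeg K)) =
        (splitTensor K).comp (Bialgebra.comulAlgHom K (T K)) := by
      refine tensorAlgHom_ext K fun i => ?_
      simp only [AlgHom.comp_apply, Bialgebra.comulAlgHom_apply, comul_letter, map_add,
        splitTensor_tmul, splitHom_letter, map_one, mul_one, one_mul, mapAlgHom_apply]
      ext m
      simp only [coeff_map, coeff_monomial, map_add]
      split_ifs <;> simp [comul_letter]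
    rw [← coeff_splitTensor]
    have h1 := congrArg (coeff n) (DFunLike.congr_fun h x)
    simp only [AlgHom.comp_apply, Bialgebra.comulAlgHom_apply, mapAlgHom_apply, coeff_map,
      coeff_splitHom] at h1
    exact h1
  counit_eq_zero n hn x hx := by
    obtain ⟨m, rfl⟩ := Nat.exists_eq_succ_of_ne_zero hn
    rw [tensorDeg, pow_succ] at hx
    refine Submodule.mul_induction_on hx ?_ ?_
    · rintro a _ b ⟨y, rfl⟩
      rw [Bialgebra.counit_mul, tensor_counit_ι, mul_zero]
    · intro a b ha hb
      rw [map_add, ha, hb, add_zero]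
  connected := pow_zero _

end TensorGraded

/-! ### Algebra maps out of the tensor algebra, and an injective substitution of Lie elements -/

section LetterLift

variable {K : Type*} [Field K] {A : Type*} [Ring A] [Algebra K A]

/-- The algebra map on `T(X)` with prescribed values on the letters. -/
def letterLift (f : ℕ → A) : T K →ₐ[K] A := TensorAlgebra.lift K (Finsupp.linearCombination K f)

@[simp]
theorem letterLift_letter (f : ℕ → A) (i : ℕ) : letterLift f (letter K i) = f i := by
  rw [letterLift, letter, TensorAlgebra.lift_ι_apply, Finsupp.linearCombination_single, one_smul]

variable {H : Type*} [Ring H] [Bialgebra K H]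

variable (K H) in
/-- The Lie algebra of primitive elements of a bialgebra. -/
def primitiveLie : LieSubalgebra K H where
  carrier := {x | Coalgebra.comul (R := K) x = x ⊗ₜ[K] 1 + 1 ⊗ₜ[K] x}
  add_mem' {x y} hx hy := by
    simp only [Set.mem_ofPred_eq] at *
    rw [map_add, hx, hy, TensorProduct.add_tmul, TensorProduct.tmul_add]
    abel
  zero_mem' := by simp
  smul_mem' c x hx := by
    simp only [Set.mem_ofPred_eq] at *
    rw [map_smul, hx, smul_add, TensorProduct.smul_tmul', TensorProduct.tmul_smul]
  lie_mem' {x y} hx hy := by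
    simp only [Set.mem_ofPred_eq, LieRing.of_associative_ring_bracket] at *
    rw [map_sub, Bialgebra.comul_mul, Bialgebra.comul_mul, hx, hy]
    simp only [mul_add, add_mul, Algebra.TensorProduct.tmul_mul_tmul, one_mul, mul_one,
      TensorProduct.sub_tmul, TensorProduct.tmul_sub]
    abel

theorem mem_primitiveLie {x : H} : x ∈ primitiveLie K H ↔
    Coalgebra.comul (R := K) x = x ⊗ₜ[K] 1 + 1 ⊗ₜ[K] x := Iff.rfl

theorem letter_mem_primitiveLie (i : ℕ) : letter K i ∈ primitiveLie K (T K) := comul_letter K i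

theorem freeLie_le_primitiveLie : freeLie K ≤ primitiveLie K (T K) := by
  rw [freeLie, LieSubalgebra.lieSpan_le]
  rintro _ ⟨i, rfl⟩
  exact letter_mem_primitiveLie i

/-- Substituting primitive elements for the letters is compatible with the coproduct. -/
theorem comul_letterLift {f : ℕ → H} (hf : ∀ i, f i ∈ primitiveLie K H) (x : T K) :
    Coalgebra.comul (R := K) (letterLift f x) =
      Algebra.TensorProduct.map (letterLift f) (letterLift f) (Coalgebra.comul (R := K) x) := by
  have h : (Bialgebra.comulAlgHom K H).comp (letterLift f) =
      (Algebra.TensorProduct.map (letterLift f) (letterLift f)).comp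
        (Bialgebra.comulAlgHom K (T K)) := by
    refine tensorAlgHom_ext K fun i => ?_
    simp only [AlgHom.comp_apply, letterLift_letter, Bialgebra.comulAlgHom_apply, comul_letter,
      map_add, Algebra.TensorProduct.map_tmul, map_one]
    exact hf i
  exact DFunLike.congr_fun h x

theorem letterLift_mem_primitiveLie {f : ℕ → H} (hf : ∀ i, f i ∈ primitiveLie K H) {x : T K}
    (hx : x ∈ primitiveLie K (T K)) : letterLift f x ∈ primitiveLie K H := by
  rw [mem_primitiveLie, comul_letterLift hf, mem_primitiveLie.1 hx]
  simp

/-- An injective substitution of primitive elements reflects primitivity. -/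
theorem mem_primitiveLie_of_letterLift {f : ℕ → H} (hf : ∀ i, f i ∈ primitiveLie K H)
    (hinj : Function.Injective (letterLift f : T K →ₐ[K] H)) {x : T K}
    (hx : letterLift f x ∈ primitiveLie K H) : x ∈ primitiveLie K (T K) := by
  rw [mem_primitiveLie, comul_letterLift hf] at hx
  have h : Function.Injective (TensorProduct.map (letterLift f : T K →ₐ[K] H).toLinearMap
      (letterLift f : T K →ₐ[K] H).toLinearMap) :=
    TensorProduct.map_injective_of_flat_flat _ _ hinj hinj
  have e (z : T K ⊗[K] T K) : TensorProduct.map (letterLift f : T K →ₐ[K] H).toLinearMap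
      (letterLift f : T K →ₐ[K] H).toLinearMap z =
      Algebra.TensorProduct.map (letterLift (K := K) f) (letterLift (K := K) f) z := by
    induction z with
    | zero => rw [map_zero, map_zero]
    | add x y hx hy => rw [map_add, map_add, hx, hy]
    | tmul x y => simp
  refine mem_primitiveLie.2 (h ?_)
  rw [e, e, hx]
  simp

end LetterLift

section Substitution

variable (K : Type*) [Field K]

/-- The algebra map to the dual numbers over `T(X)` that encodes the derivation `shiftDer`. -/
def shiftHom : T K →ₐ[K] DualNumber (T K) :=
  letterLift fun i => TrivSqZeroExt.inl (letter K i) + TrivSqZeroExt.inr (letter K (i + 1))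

theorem fst_shiftHom (x : T K) : (shiftHom K x).fst = x := by
  have h : (TrivSqZeroExt.fstHom K (T K) (T K)).comp (shiftHom K) = AlgHom.id K (T K) := by
    refine tensorAlgHom_ext K fun i => ?_
    simp [shiftHom]
  exact DFunLike.congr_fun h x

/-- The derivation of `T(X)` that sends the letter `i` to the letter `i + 1`. -/
def shiftDer : T K →ₗ[K] T K := (TrivSqZeroExt.sndHom (T K) (T K)).restrictScalars K ∘ₗ
  (shiftHom K).toLinearMap

theorem shiftDer_apply (x : T K) : shiftDer K x = (shiftHom K x).snd := rfl

theorem shiftDer_letter (i : ℕ) : shiftDer K (letter K i) = letter K (i + 1) := by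
  simp [shiftDer_apply, shiftHom]

theorem shiftDer_mul (x y : T K) : shiftDer K (x * y) = x * shiftDer K y + shiftDer K x * y := by
  rw [shiftDer_apply, map_mul, TrivSqZeroExt.snd_mul, fst_shiftHom, fst_shiftHom]
  rfl

/-- The Lie elements `[x₀, [x₀, …, [x₀, x₁]]]`, with `i` letters `x₀`. -/
def adLetter : ℕ → T K
  | 0 => letter K 1
  | i + 1 => letter K 0 * adLetter i - adLetter i * letter K 0

theorem adLetter_mem_freeLie (i : ℕ) : adLetter K i ∈ freeLie K := by
  have h (j : ℕ) : letter K j ∈ freeLie K := LieSubalgebra.subset_lieSpan ⟨j, rfl⟩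
  induction i with
  | zero => exact h 1
  | succ i ih => exact (freeLie K).lie_mem (h 0) ih

theorem adLetter_mem_tensorDeg (i : ℕ) : adLetter K i ∈ tensorDeg K (i + 1) := by
  induction i with
  | zero => exact letter_mem K 1
  | succ i ih =>
    refine Submodule.sub_mem _ ?_ (SetLike.mul_mem_graded ih (letter_mem K 0))
    rw [add_comm]
    exact SetLike.mul_mem_graded (letter_mem K 0) ih

theorem adLetter_mem_primitiveLie (i : ℕ) : adLetter K i ∈ primitiveLie K (T K) :=
  freeLie_le_primitiveLie (adLetter_mem_freeLie K i)

/-- The representation of `T(X)` on itself in which `x₀` acts by the derivation `shiftDer` and `x₁`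
by left multiplication by the first letter. The commutator of the derivation with left
multiplication by a letter is left multiplication by the next letter, so that `adLetter i` acts as
left multiplication by the letter `i`. -/
def shiftRep : T K →ₐ[K] Module.End K (T K) :=
  letterLift fun i => if i = 0 then shiftDer K else if i = 1 then LinearMap.mulLeft K (letter K 0)
    else 0

theorem shiftRep_adLetter (i : ℕ) :
    shiftRep K (adLetter K i) = Algebra.lmul K (T K) (letter K i) := by
  induction i with
  | zero => rw [adLetter, shiftRep, letterLift_letter]; rfl
  | succ i ih =>
    rw [adLetter, map_sub, map_mul, map_mul, ih, shiftRep, letterLift_letter, if_pos rfl]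
    ext x
    change shiftDer K (letter K i * x) - letter K i * shiftDer K x = letter K (i + 1) * x
    rw [shiftDer_mul, shiftDer_letter, add_sub_cancel_left]

/-- The elements `adLetter i` generate a free algebra. -/
theorem letterLift_adLetter_injective :
    Function.Injective (letterLift (adLetter K) : T K →ₐ[K] T K) := by
  have h : (shiftRep K).comp (letterLift (adLetter K)) = Algebra.lmul K (T K) := by
    refine tensorAlgHom_ext K fun i => ?_
    rw [AlgHom.comp_apply, letterLift_letter, shiftRep_adLetter]
  refine Function.LeftInverse.injective (g := fun x => shiftRep K x 1) fun x => ?_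
  have := LinearMap.congr_fun (DFunLike.congr_fun h x) 1
  simpa using this

end Substitution

/-! ### The generic group-like series and the action of the descent algebra -/

section Generic

variable {K : Type*} [Field K] {A : Type*} [Ring A] [Algebra K A]

variable (K) in
/-- The generic series without constant term, with the letters as components. -/
def genericSeries : (T K)⟦X⟧ := PowerSeries.mk fun n => if n = 0 then 0 else letter K (n - 1)

variable (K) in
/-- The generic group-like series `Γ(∑ x_i X^(i+1))`. -/
def genericGroupLike : (T K)⟦X⟧ := gamSeries K (genericSeries K)

variable (K) in
/-- The specialization at the generic group-like series of noncommutative polynomials in its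
homogeneous components. -/
def genericEval : FreeAlgebra K ℕ →ₐ[K] (T K)⟦X⟧ :=
  FreeAlgebra.lift K fun n => monomial n (coeff n (genericGroupLike K))

/-- The algebra map that specializes the generic group-like series to `g`. -/
def specialize (g : A⟦X⟧) : T K →ₐ[K] A := letterLift fun i => coeff (i + 1) (logDer g)

theorem map_letterLift_genericSeries (f : ℕ → A) {h : A⟦X⟧} (h0 : coeff 0 h = 0)
    (hf : ∀ i, f i = coeff (i + 1) h) :
    PowerSeries.map ((letterLift f : T K →ₐ[K] A) : T K →+* A) (genericSeries K) = h := by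
  ext n
  rw [coeff_map, genericSeries, coeff_mk]
  rcases n with _ | n
  · simp [h0]
  · rw [if_neg (Nat.succ_ne_zero n), ← hf]
    exact letterLift_letter _ _

/-- Every series with constant term `1`, over any algebra, is a specialization of the generic
group-like series. -/
theorem map_specialize [CharZero K] {g : A⟦X⟧} (hg : coeff 0 g = 1) :
    PowerSeries.map ((specialize g : T K →ₐ[K] A) : T K →+* A) (genericGroupLike K) = g := by
  rw [genericGroupLike, map_gamSeries, specialize,
    map_letterLift_genericSeries _ (coeff_zero_logDer g) fun _ => rfl, gamSeries_logDer hg]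

theorem map_genericEval_eq_lift (f : T K →ₐ[K] A) {g : A⟦X⟧}
    (h : PowerSeries.map (f : T K →+* A) (genericGroupLike K) = g) (P : FreeAlgebra K ℕ) :
    PowerSeries.map (f : T K →+* A) (genericEval K P) =
      FreeAlgebra.lift K (fun n => monomial n (coeff n g)) P := by
  have h1 : (mapAlgHom f).comp (genericEval K) =
      FreeAlgebra.lift K (fun n => monomial n (coeff n g)) := by
    refine FreeAlgebra.hom_ext (funext fun n => ?_)
    ext m
    simp only [Function.comp_apply, AlgHom.comp_apply, genericEval, FreeAlgebra.lift_ι_apply,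
      mapAlgHom_apply, coeff_map, coeff_monomial, ← h]
    split_ifs <;> simp
  exact DFunLike.congr_fun h1 P

theorem gamSeries_mem {𝒜 : ℕ → Submodule K A} [SetLike.GradedMonoid 𝒜] {h : A⟦X⟧}
    (hh : ∀ n, coeff n h ∈ 𝒜 n) (n : ℕ) : coeff n (gamSeries K h) ∈ 𝒜 n := by
  rw [gamSeries, coeff_mk]
  refine Submodule.sum_mem _ fun c _ => Submodule.smul_mem _ _ ?_
  have := SetLike.list_prod_map_mem_graded (A := 𝒜) c.blocks id (fun i => coeff i h)
    fun i _ => hh i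
  rwa [List.map_id, c.blocks_sum] at this

end Generic

section Action

variable {K : Type*} [Field K] {H : Type*} [Ring H] [Bialgebra K H]
  {𝒜 : ℕ → Submodule K H} [GradedAlgebra 𝒜]

variable (𝒜) in
/-- Evaluation of noncommutative polynomials at the graded projections, for the convolution
product. -/
def projEval : FreeAlgebra K ℕ →ₐ[K] WithConv (H →ₗ[K] H) := FreeAlgebra.lift K (gradedProj 𝒜)

theorem groupLikeEval_projEval (h𝒜 : IsConnectedGradedBialgebra 𝒜) {g : H⟦X⟧}
    (hg : IsGroupLikeIn (K := K) g) (hgm : ∀ n, coeff n g ∈ 𝒜 n) (P : FreeAlgebra K ℕ) :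
    groupLikeEval h𝒜 hg hgm (projEval 𝒜 P) =
      FreeAlgebra.lift K (fun n => monomial n (coeff n g)) P := by
  have h1 : (groupLikeEval h𝒜 hg hgm).comp (projEval 𝒜) =
      FreeAlgebra.lift K (fun n => monomial n (coeff n g)) := by
    refine FreeAlgebra.hom_ext (funext fun n => ?_)
    simp only [Function.comp_apply, AlgHom.comp_apply, projEval, FreeAlgebra.lift_ι_apply,
      groupLikeEval_gradedProj]
  exact DFunLike.congr_fun h1 P

variable (𝒜) in
/-- The series `∑ p_n X^n` over the convolution algebra. -/
def projSeries : (WithConv (H →ₗ[K] H))⟦X⟧ := PowerSeries.mk (gradedProj 𝒜)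

theorem coeff_zero_projSeries (h𝒜 : IsConnectedGradedBialgebra 𝒜) :
    coeff 0 (projSeries 𝒜) = 1 := by
  rw [projSeries, coeff_mk, h𝒜.gradedProj_zero]

theorem degHom_projEval (h𝒜 : IsConnectedGradedBialgebra 𝒜) (P : FreeAlgebra K ℕ) :
    h𝒜.degHom (projEval 𝒜 P) =
      FreeAlgebra.lift K (fun n => monomial n (coeff n (projSeries 𝒜))) P := by
  have h1 : h𝒜.degHom.comp (projEval 𝒜) =
      FreeAlgebra.lift K (fun n => monomial n (coeff n (projSeries 𝒜))) := by
    refine FreeAlgebra.hom_ext (funext fun n => ?_)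
    simp only [Function.comp_apply, AlgHom.comp_apply, projEval, FreeAlgebra.lift_ι_apply,
      h𝒜.degHom_gradedProj, projSeries, coeff_mk]
  exact DFunLike.congr_fun h1 P

variable [CharZero K]

variable (K) in
/-- The image of the generic group-like series under the substitution of the Lie elements
`adLetter i`. Its component of degree `n` is homogeneous of degree `n`. -/
def adGroupLike : (T K)⟦X⟧ := PowerSeries.map
  ((letterLift (adLetter K) : T K →ₐ[K] T K) : T K →+* T K) (genericGroupLike K)

omit [CharZero K] in
theorem adGroupLike_eq : adGroupLike K =
    gamSeries K (PowerSeries.mk fun n => if n = 0 then 0 else adLetter K (n - 1)) := by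
  rw [adGroupLike, genericGroupLike, map_gamSeries]
  congr 1
  exact map_letterLift_genericSeries _ (by simp) (by simp)

theorem isGroupLikeIn_adGroupLike : IsGroupLikeIn (K := K) (adGroupLike K) := by
  rw [adGroupLike_eq]
  refine IsPrimitiveSeries.gamSeries commute_includeLeft_includeRight
    (IsPrimitiveSeries.of_comul_coeff (by simp) fun n => ?_)
  rw [coeff_mk]
  split_ifs with h
  · simp
  · exact adLetter_mem_primitiveLie K _

omit [CharZero K] in
theorem adGroupLike_mem (n : ℕ) : coeff n (adGroupLike K) ∈ tensorDeg K n := by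
  rw [adGroupLike_eq]
  refine gamSeries_mem (fun n => ?_) n
  rw [coeff_mk]
  split_ifs with h
  · exact Submodule.zero_mem _
  · have := adLetter_mem_tensorDeg K (n - 1)
    rwa [Nat.sub_add_cancel (Nat.one_le_iff_ne_zero.2 h)] at this

/-- The values of elements of the descent algebra on `adGroupLike` come from the generic
group-like series. -/
theorem groupLikeEval_adGroupLike (P : FreeAlgebra K ℕ) :
    groupLikeEval (tensor_isConnectedGradedBialgebra K) isGroupLikeIn_adGroupLike adGroupLike_mem
      (projEval (tensorDeg K) P) =
    PowerSeries.map ((letterLift (adLetter K) : T K →ₐ[K] T K) : T K →+* T K)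
      (genericEval K P) := by
  rw [groupLikeEval_projEval, map_genericEval_eq_lift _ rfl]
  rfl

/-- The relations between the graded projections of `T(X)` hold in every graded connected
bialgebra: evaluation at `adGroupLike` shows that such a relation holds between the components of
the generic group-like series, which specializes to `∑ p_n X^n`. -/
theorem projEval_eq_zero (h𝒜 : IsConnectedGradedBialgebra 𝒜) {P : FreeAlgebra K ℕ}
    (hP : projEval (tensorDeg K) P = 0) : projEval 𝒜 P = 0 := by
  have h1 : genericEval K P = 0 := by
    refine PowerSeries.map_injective _ (letterLift_adLetter_injective K) ?_
    rw [map_zero]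
    refine (groupLikeEval_adGroupLike P).symm.trans ?_
    rw [hP, map_zero]
  refine h𝒜.degHom_injective ?_
  have h2 := map_genericEval_eq_lift (specialize (projSeries 𝒜))
    (map_specialize (coeff_zero_projSeries h𝒜)) P
  rw [h1, map_zero] at h2
  exact (degHom_projEval h𝒜 P).trans (h2.symm.trans (map_zero _).symm)

variable (K) in
/-- The presentation of the descent algebra by its generators. -/
def descentPresentation : FreeAlgebra K ℕ →ₐ[K] descentAlgebra K :=
  FreeAlgebra.lift K (descentGen K)

omit [CharZero K] in
theorem coe_descentPresentation (P : FreeAlgebra K ℕ) :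
    (descentPresentation K P : WithConv (T K →ₗ[K] T K)) = projEval (tensorDeg K) P := by
  have h1 : (descentAlgebra K).val.comp (descentPresentation K) = projEval (tensorDeg K) := by
    refine FreeAlgebra.hom_ext (funext fun n => ?_)
    simp only [Function.comp_apply, AlgHom.comp_apply, descentPresentation, projEval,
      FreeAlgebra.lift_ι_apply]
    rfl
  exact DFunLike.congr_fun h1 P

omit [CharZero K] in
theorem descentPresentation_surjective : Function.Surjective (descentPresentation K) := by
  rintro ⟨x, hx⟩
  have hx' := hx
  rw [descentAlgebra, Algebra.adjoin_range_eq_range_freeAlgebra_lift] at hx'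
  obtain ⟨P, hP⟩ := hx'
  exact ⟨P, Subtype.ext ((coe_descentPresentation P).trans hP)⟩

omit [CharZero K] in
theorem exists_algHom_of_surjective {A B C : Type*} [Semiring A] [Semiring B] [Semiring C]
    [Algebra K A] [Algebra K B] [Algebra K C] (π : A →ₐ[K] B) (q : A →ₐ[K] C)
    (hπ : Function.Surjective π) (hq : ∀ a b, π a = π b → q a = q b) :
    ∃ ρ : B →ₐ[K] C, ∀ a, ρ (π a) = q a := by
  have hs := Function.surjInv_eq hπ
  have h (a : A) : q (Function.surjInv hπ (π a)) = q a := hq _ _ (hs _)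
  refine ⟨⟨⟨⟨⟨fun b => q (Function.surjInv hπ b), ?_⟩, fun x y => ?_⟩, ?_, fun x y => ?_⟩,
    fun c => ?_⟩, h⟩
  · rw [← map_one π, h, map_one]
  · change q _ = q _ * q _
    rw [← map_mul, ← h (_ * _), map_mul, hs, hs]
  · change q _ = 0
    rw [← map_zero π, h, map_zero]
  · change q _ = q _ + q _
    rw [← map_add, ← h (_ + _), map_add, hs, hs]
  · change q _ = _
    rw [← AlgHom.commutes π, h, AlgHom.commutes]

/-- The descent algebra acts on every graded connected bialgebra: by `projEval_eq_zero` the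
evaluation at the graded projections factors through the presentation. -/
theorem exists_descentAction (h𝒜 : IsConnectedGradedBialgebra 𝒜) :
    ∃ ρ : descentAlgebra K →ₐ[K] WithConv (H →ₗ[K] H),
      ∀ P, ρ (descentPresentation K P) = projEval 𝒜 P := by
  refine exists_algHom_of_surjective _ _ descentPresentation_surjective fun P Q h => ?_
  rw [← sub_eq_zero, ← map_sub]
  refine projEval_eq_zero h𝒜 ?_
  rw [map_sub, ← coe_descentPresentation, ← coe_descentPresentation, h, sub_self]

omit [CharZero K] in
theorem descentAction_ext {A : Type*} [Ring A] [Algebra K A] {ρ ρ' : descentAlgebra K →ₐ[K] A}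
    (h : ∀ n, ρ (descentGen K n) = ρ' (descentGen K n)) : ρ = ρ' := by
  have h1 : ρ.comp (descentPresentation K) = ρ'.comp (descentPresentation K) := by
    refine FreeAlgebra.hom_ext (funext fun n => ?_)
    simpa [descentPresentation] using h n
  ext x
  obtain ⟨P, rfl⟩ := descentPresentation_surjective x
  exact DFunLike.congr_fun h1 P

omit [CharZero K] in
theorem apply_descentPresentation {ρ : descentAlgebra K →ₐ[K] WithConv (H →ₗ[K] H)}
    (hρ : ∀ n, ρ (descentGen K n) = gradedProj 𝒜 n) (P : FreeAlgebra K ℕ) :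
    ρ (descentPresentation K P) = projEval 𝒜 P := by
  have h1 : ρ.comp (descentPresentation K) = projEval 𝒜 := by
    refine FreeAlgebra.hom_ext (funext fun n => ?_)
    simpa [descentPresentation, projEval] using hρ n
  exact DFunLike.congr_fun h1 P

end Action

/-! ### Values of the descent algebra on primitive elements and on homogeneous components -/

section Values

variable {K : Type*} [Field K] {H : Type*} [Ring H] [Bialgebra K H]
  {𝒜 : ℕ → Submodule K H} [GradedAlgebra 𝒜]

theorem counit_eq_zero_of_mem_primitiveLie {x : H} (hx : x ∈ primitiveLie K H) :
    Coalgebra.counit (R := K) x = 0 := by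
  have h := Coalgebra.rTensor_counit_comul (R := K) x
  rw [mem_primitiveLie.1 hx, map_add, LinearMap.rTensor_tmul, LinearMap.rTensor_tmul,
    Bialgebra.counit_one] at h
  have h1 := congrArg (TensorProduct.lid K K) (congrArg
    (LinearMap.lTensor K (Coalgebra.counit (R := K) (A := H))) (add_eq_right.1 h))
  simpa using h1

theorem conv_apply_of_mem_primitiveLie {B : Type*} [Ring B] [Algebra K B]
    (f f' : WithConv (H →ₗ[K] B)) {x : H} (hx : x ∈ primitiveLie K H) :
    (f * f').ofConv x = f.ofConv x * f'.ofConv 1 + f.ofConv 1 * f'.ofConv x := by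
  rw [LinearMap.convMul_apply, mem_primitiveLie.1 hx]
  simp

theorem conv_apply_one {B : Type*} [Ring B] [Algebra K B] (f f' : WithConv (H →ₗ[K] B)) :
    (f * f').ofConv 1 = f.ofConv 1 * f'.ofConv 1 := by
  rw [LinearMap.convMul_apply, Bialgebra.comul_one, Algebra.TensorProduct.one_def]
  simp

theorem IsConnectedGradedBialgebra.eq_zero_of_mem (h𝒜 : IsConnectedGradedBialgebra 𝒜) {x : H}
    (hx : x ∈ primitiveLie K H) (h0 : x ∈ 𝒜 0) : x = 0 := by
  rw [h𝒜.eq_algebraMap_counit h0, counit_eq_zero_of_mem_primitiveLie hx, map_zero]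

variable (K) in
/-- The character of the free algebra, with values in the dual numbers, that describes the action
of the polynomials in the graded projections on `1` and on primitive elements of degree `n`. -/
def primitiveCharacter (n : ℕ) : FreeAlgebra K ℕ →ₐ[K] DualNumber K :=
  FreeAlgebra.lift K fun a => TrivSqZeroExt.inl (if a = 0 then 1 else 0) +
    TrivSqZeroExt.inr (if a = n then 1 else 0)

/-- On the primitive elements of degree `n` a polynomial in the graded projections acts by a scalar,
which does not depend on the bialgebra. -/
theorem projEval_apply_primitive {n : ℕ} {x : H}
    (hx : x ∈ primitiveLie K H) (hxn : x ∈ 𝒜 n) (P : FreeAlgebra K ℕ) :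
    (projEval 𝒜 P).ofConv 1 = (primitiveCharacter K n P).fst • (1 : H) ∧
      (projEval 𝒜 P).ofConv x = (primitiveCharacter K n P).snd • x := by
  induction P using FreeAlgebra.induction with
  | grade0 c =>
    rw [AlgHom.commutes, AlgHom.commutes, Algebra.algebraMap_eq_smul_one]
    constructor
    · change c • algebraMap K H (Coalgebra.counit (R := K) (1 : H)) = _
      rw [Bialgebra.counit_one, map_one]
      simp [TrivSqZeroExt.algebraMap_eq_inl]
    · change c • algebraMap K H (Coalgebra.counit (R := K) x) = _
      rw [counit_eq_zero_of_mem_primitiveLie hx, map_zero]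
      simp [TrivSqZeroExt.algebraMap_eq_inl]
  | grade1 a =>
    rw [projEval, primitiveCharacter, FreeAlgebra.lift_ι_apply, FreeAlgebra.lift_ι_apply]
    constructor
    · change GradedAlgebra.proj 𝒜 a 1 = _
      rw [proj_of_mem 𝒜 SetLike.GradedOne.one_mem, TrivSqZeroExt.fst_add, TrivSqZeroExt.fst_inl,
        TrivSqZeroExt.fst_inr, add_zero]
      split_ifs <;> simp
    · change GradedAlgebra.proj 𝒜 a x = _
      rw [proj_of_mem 𝒜 hxn, TrivSqZeroExt.snd_add, TrivSqZeroExt.snd_inl, TrivSqZeroExt.snd_inr,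
        zero_add]
      split_ifs <;> simp
  | mul P Q hP hQ =>
    rw [map_mul, map_mul, conv_apply_one, conv_apply_of_mem_primitiveLie _ _ hx, hP.1, hP.2, hQ.1,
      hQ.2]
    constructor
    · rw [smul_mul_smul_comm, mul_one, TrivSqZeroExt.fst_mul]
    · rw [smul_mul_smul_comm, smul_mul_smul_comm, mul_one, one_mul, TrivSqZeroExt.snd_mul,
        smul_eq_mul, op_smul_eq_mul, add_smul, add_comm]
  | add P Q hP hQ =>
    rw [map_add, map_add, WithConv.ofConv_add, LinearMap.add_apply, LinearMap.add_apply, hP.1, hP.2,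
      hQ.1, hQ.2]
    constructor <;> simp [add_smul]

variable {ρ : descentAlgebra K →ₐ[K] WithConv (H →ₗ[K] H)}
  (hρ : ∀ n, ρ (descentGen K n) = gradedProj 𝒜 n)
include hρ

theorem degHom_apply_of_mem_descentDeg (h𝒜 : IsConnectedGradedBialgebra 𝒜) {n : ℕ}
    {f : descentAlgebra K} (hf : f ∈ descentDeg K n) : h𝒜.degHom (ρ f) = monomial n (ρ f) := by
  induction hf using Submodule.span_induction with
  | mem f hf =>
    obtain ⟨l, rfl, rfl⟩ := hf
    induction l with
    | nil => rw [List.map_nil, List.prod_nil, map_one, map_one, List.sum_nil,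
      monomial_zero_eq_C_apply, map_one]
    | cons a l ih =>
      rw [List.map_cons, List.prod_cons, map_mul, map_mul, ih, hρ, h𝒜.degHom_gradedProj,
        monomial_mul_monomial, List.sum_cons]
  | zero => rw [map_zero, map_zero, map_zero]
  | add f g _ _ hf hg => rw [map_add, map_add, hf, hg, map_add]
  | smul c f _ hf =>
    rw [map_smul, map_smul, hf]
    ext1 m
    rw [coeff_monomial]
    change c • coeff m (monomial n (ρ f)) = _
    rw [coeff_monomial]
    split_ifs <;> simp

/-- Elements of `𝒟_n` vanish on the components of degree `m ≠ n`. -/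
theorem apply_eq_zero_of_mem_descentDeg (h𝒜 : IsConnectedGradedBialgebra 𝒜) {n m : ℕ}
    {f : descentAlgebra K} (hf : f ∈ descentDeg K n) (hmn : m ≠ n) {x : H} (hx : x ∈ 𝒜 m) :
    (ρ f).ofConv x = 0 := by
  have h := congrArg (fun s => (coeff m s).ofConv x) (degHom_apply_of_mem_descentDeg hρ h𝒜 hf)
  simpa [h𝒜.coeff_degHom, coeff_monomial, hmn, proj_of_mem 𝒜 hx] using h

/-- Elements of `𝒟_n` take values in degree `n`. -/
theorem apply_mem_of_mem_descentDeg {n : ℕ} {f : descentAlgebra K} (hf : f ∈ descentDeg K n)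
    (x : H) : (ρ f).ofConv x ∈ 𝒜 n := by
  induction hf using Submodule.span_induction with
  | mem f hf =>
    obtain ⟨l, rfl, rfl⟩ := hf
    induction l generalizing x with
    | nil =>
      rw [List.map_nil, List.prod_nil, map_one]
      exact SetLike.algebraMap_mem_graded 𝒜 _
    | cons a l ih =>
      rw [List.map_cons, List.prod_cons, map_mul, List.sum_cons, LinearMap.convMul_apply]
      induction Coalgebra.comul (R := K) x with
      | zero => simp
      | add y z hy hz => rw [map_add, map_add]; exact Submodule.add_mem _ hy hz
      | tmul y z =>
        rw [TensorProduct.map_tmul, LinearMap.mul'_apply, hρ]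
        exact SetLike.mul_mem_graded (proj_mem 𝒜 a y) (ih z)
  | zero => rw [map_zero]; exact Submodule.zero_mem _
  | add f g _ _ hf hg => rw [map_add]; exact Submodule.add_mem _ hf hg
  | smul c f _ hf => rw [map_smul]; exact Submodule.smul_mem _ _ hf

end Values

/-! ### Lie idempotents on group-like series and on primitive elements -/

section LieIdempotents

variable {K : Type*} [Field K] [CharZero K] {H : Type*} [Ring H] [Bialgebra K H]
  {𝒜 : ℕ → Submodule K H} [GradedAlgebra 𝒜] (h𝒜 : IsConnectedGradedBialgebra 𝒜)
  {ρ : descentAlgebra K →ₐ[K] WithConv (H →ₗ[K] H)}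
  (hρ : ∀ n, ρ (descentGen K n) = gradedProj 𝒜 n)
  {γ : ℕ → descentAlgebra K} (hγ : IsLieIdempotentSeries γ)

omit [CharZero K] in
theorem adLetter_ne_zero (i : ℕ) : adLetter K i ≠ 0 := by
  intro h
  have h1 : letter K i = 0 := by
    refine letterLift_adLetter_injective K ?_
    rw [letterLift_letter, h, map_zero]
  rw [letter, TensorAlgebra.ι_eq_zero_iff, Finsupp.single_eq_zero] at h1
  exact one_ne_zero h1

include hρ hγ

omit [CharZero K] in
/-- A Lie idempotent series acts as the identity on primitive elements, since the scalar by which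
it acts is determined on the nonzero element `adLetter (n - 1)` of `Lie_n(X)`. -/
theorem IsLieIdempotentSeries.apply_primitive {n : ℕ} (hn : n ≠ 0) {x : H}
    (hx : x ∈ primitiveLie K H) (hxn : x ∈ 𝒜 n) : (ρ (γ n)).ofConv x = x := by
  obtain ⟨P, hP⟩ := descentPresentation_surjective (γ n)
  obtain ⟨m, rfl⟩ := Nat.exists_eq_succ_of_ne_zero hn
  have h1 := (projEval_apply_primitive (𝒜 := tensorDeg K) (adLetter_mem_primitiveLie K m)
    (adLetter_mem_tensorDeg K m) P).2
  rw [← coe_descentPresentation, hP, hγ.map_eq _ _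
    ⟨adLetter_mem_freeLie K m, adLetter_mem_tensorDeg K m⟩] at h1
  have h2 : (primitiveCharacter K (m + 1) P).snd = 1 := by
    refine smul_left_injective K (adLetter_ne_zero (K := K) m) ?_
    simpa using h1.symm
  rw [← hP, apply_descentPresentation hρ, (projEval_apply_primitive hx hxn P).2]
  exact (congrArg (· • x) h2).trans (one_smul K x)

include h𝒜 in
/-- A Lie idempotent series maps the components of a group-like series to primitive elements: this
holds for the image of the generic group-like series in `T(X)`, hence for the generic group-like
series, which specializes to all others. -/
theorem IsLieIdempotentSeries.apply_groupLike {g : H⟦X⟧} (hg : IsGroupLikeIn (K := K) g)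
    (hgm : ∀ n, coeff n g ∈ 𝒜 n) (n : ℕ) : (ρ (γ n)).ofConv (coeff n g) ∈ primitiveLie K H := by
  obtain ⟨P, hP⟩ := descentPresentation_surjective (γ n)
  have h1 := congrArg (coeff n) (groupLikeEval_adGroupLike P)
  rw [coeff_groupLikeEval, ← coe_descentPresentation, hP, coeff_map] at h1
  have h2 : coeff n (genericEval K P) ∈ primitiveLie K (T K) := by
    refine mem_primitiveLie_of_letterLift (adLetter_mem_primitiveLie K)
      (letterLift_adLetter_injective K) ?_
    have h3 := (hγ.map_mem n _ (adGroupLike_mem n)).1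
    rw [h1] at h3
    exact freeLie_le_primitiveLie h3
  have h4 := groupLikeEval_projEval h𝒜 hg hgm P
  rw [← map_genericEval_eq_lift _ (map_specialize hg.coeff_zero)] at h4
  have h5 := congrArg (coeff n) h4
  rw [coeff_groupLikeEval, ← apply_descentPresentation hρ, hP, coeff_map] at h5
  rw [h5]
  have hl : IsPrimitiveIn (K := K) (logDer g) :=
    IsGroupLikeSeries.logDer commute_includeLeft_includeRight hg
  exact letterLift_mem_primitiveLie (fun i => hl.comul_coeff (i + 1)) h2

end LieIdempotents

/-! ### Group-like and primitive elements of the completion -/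

section Completion

variable {K : Type*} [Field K] {H : Type*} [Ring H] [HopfAlgebra K H]
  {𝒜 : ℕ → Submodule K H} [GradedAlgebra 𝒜]

theorem IsConnectedGradedHopf.isConnectedGradedBialgebra (h𝒜 : IsConnectedGradedHopf 𝒜) :
    IsConnectedGradedBialgebra 𝒜 where
  counit_eq_zero := h𝒜.counit_eq_zero
  connected := h𝒜.connected
  comul_proj n x := by
    have key : Coalgebra.comul (R := K) ∘ₗ GradedAlgebra.proj 𝒜 n = (∑ p ∈ antidiagonal n,
        TensorProduct.map (GradedAlgebra.proj 𝒜 p.1) (GradedAlgebra.proj 𝒜 p.2)) ∘ₗ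
        Coalgebra.comul (R := K) := by
      refine linearMap_ext_graded 𝒜 fun m x hx => ?_
      rw [LinearMap.comp_apply, LinearMap.comp_apply, proj_of_mem 𝒜 hx]
      have h (z : H ⊗[K] H) (hz : z ∈ ⨆ p : {p : ℕ × ℕ // p.1 + p.2 = m},
          LinearMap.range (TensorProduct.map (𝒜 p.1.1).subtype (𝒜 p.1.2).subtype)) :
          (if n = m then z else 0) = (∑ p ∈ antidiagonal n,
            TensorProduct.map (GradedAlgebra.proj 𝒜 p.1) (GradedAlgebra.proj 𝒜 p.2)) z := by
        induction hz using Submodule.iSup_induction' with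
        | mem p z hz =>
          obtain ⟨⟨i, j⟩, hij⟩ := p
          obtain ⟨z, rfl⟩ := hz
          induction z with
          | zero => simp
          | add y z hy hz => rw [map_add, map_add, ← hy, ← hz]; split_ifs <;> simp
          | tmul y z =>
            rw [TensorProduct.map_tmul, LinearMap.sum_apply]
            simp only [TensorProduct.map_tmul, Submodule.subtype_apply, proj_of_mem 𝒜 y.2,
              proj_of_mem 𝒜 z.2]
            by_cases hnm : n = m
            · rw [if_pos hnm, Finset.sum_eq_single (i, j)]
              · simp
              · rintro ⟨a, b⟩ hab hne
                rw [mem_antidiagonal] at hab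
                by_cases ha : a = i
                · have hb : b ≠ j := by rintro rfl; exact hne (by rw [ha])
                  rw [if_neg hb, TensorProduct.tmul_zero]
                · rw [if_neg ha, TensorProduct.zero_tmul]
              · intro hn
                exact absurd (mem_antidiagonal.2 (hij.trans hnm.symm)) hn
            · rw [if_neg hnm, Finset.sum_eq_zero]
              rintro ⟨a, b⟩ hab
              rw [mem_antidiagonal] at hab
              by_cases ha : a = i
              · have hb : b ≠ j := by
                  rintro rfl
                  exact hnm (hab.symm.trans ((congrArg (· + b) ha).trans hij))
                rw [if_neg hb, TensorProduct.tmul_zero]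
              · rw [if_neg ha, TensorProduct.zero_tmul]
        | zero => simp
        | add y z _ _ hy hz => rw [map_add, ← hy, ← hz]; split_ifs <;> simp
      rw [← h _ (h𝒜.comul_mem m x hx)]
      split_ifs
      · rfl
      · rw [map_zero]
    simpa using LinearMap.congr_fun key x

variable (h𝒜 : IsConnectedGradedBialgebra 𝒜)
include h𝒜

theorem comul_coeff_eq_sum_completedComul {f : H⟦X⟧} (hf : f ∈ completion 𝒜) (n : ℕ) :
    Coalgebra.comul (R := K) (coeff n f) = ∑ p ∈ antidiagonal n, completedComul 𝒜 f p.1 p.2 := by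
  have h := h𝒜.comul_proj n (coeff n f)
  rw [proj_of_mem 𝒜 (hf n), if_pos rfl] at h
  rw [h]
  refine Finset.sum_congr rfl fun p hp => ?_
  rw [completedComul, mem_antidiagonal.1 hp]

theorem mem_groupLike_iff {g : H⟦X⟧} :
    g ∈ groupLike 𝒜 ↔ IsGroupLikeIn (K := K) g ∧ ∀ n, coeff n g ∈ 𝒜 n := by
  constructor
  · rintro ⟨hm, h0, hc⟩
    refine ⟨IsGroupLikeSeries.of_comul_coeff ?_ fun n => ?_, hm⟩
    · rw [h𝒜.eq_algebraMap_counit (hm 0), h0, map_one]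
    · rw [comul_coeff_eq_sum_completedComul h𝒜 hm]
      exact Finset.sum_congr rfl fun p _ => hc p.1 p.2
  · rintro ⟨hg, hm⟩
    refine ⟨hm, by rw [hg.coeff_zero, Bialgebra.counit_one], fun i j => ?_⟩
    rw [completedComul, hg.comul_coeff, map_sum, Finset.sum_eq_single (i, j)]
    · rw [TensorProduct.map_tmul, proj_of_mem 𝒜 (hm i), proj_of_mem 𝒜 (hm j), if_pos rfl,
        if_pos rfl]
    · rintro ⟨a, b⟩ hab hne
      rw [mem_antidiagonal] at hab
      rw [TensorProduct.map_tmul, proj_of_mem 𝒜 (hm a), proj_of_mem 𝒜 (hm b)]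
      by_cases ha : i = a
      · have hb : j ≠ b := by rintro rfl; exact hne (by rw [ha])
        rw [if_neg hb, TensorProduct.tmul_zero]
      · rw [if_neg ha, TensorProduct.zero_tmul]
    · intro hn
      exact (hn (mem_antidiagonal.2 rfl)).elim

theorem mem_primitive_iff {h : H⟦X⟧} :
    h ∈ primitive 𝒜 ↔ IsPrimitiveIn (K := K) h ∧ ∀ n, coeff n h ∈ 𝒜 n := by
  constructor
  · rintro ⟨hm, hc⟩
    have h1 (n : ℕ) : coeff n h ∈ primitiveLie K H := by
      rw [mem_primitiveLie, comul_coeff_eq_sum_completedComul h𝒜 hm]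
      simp only [hc, Finset.sum_add_distrib, coeff_one]
      congr 1
      · rw [Finset.sum_eq_single (n, 0)]
        · simp
        · rintro ⟨a, b⟩ hab hne
          rw [mem_antidiagonal] at hab
          have hb : b ≠ 0 := by rintro rfl; exact hne (Prod.ext hab rfl)
          rw [if_neg hb, TensorProduct.tmul_zero]
        · intro hn
          exact absurd (mem_antidiagonal.2 (add_zero n)) hn
      · rw [Finset.sum_eq_single (0, n)]
        · simp
        · rintro ⟨a, b⟩ hab hne
          rw [mem_antidiagonal] at hab
          have ha : a ≠ 0 := by
            rintro rfl
            exact hne (Prod.ext rfl ((zero_add b).symm.trans hab))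
          rw [if_neg ha, TensorProduct.zero_tmul]
        · intro hn
          exact absurd (mem_antidiagonal.2 (zero_add n)) hn
    exact ⟨IsPrimitiveSeries.of_comul_coeff (h𝒜.eq_zero_of_mem (h1 0) (hm 0)) h1, hm⟩
  · rintro ⟨hh, hm⟩
    refine ⟨hm, fun i j => ?_⟩
    have h1 (k : ℕ) := proj_of_mem 𝒜 (SetLike.GradedOne.one_mem : (1 : H) ∈ 𝒜 0) k
    rw [completedComul, hh.comul_coeff, map_add, TensorProduct.map_tmul, TensorProduct.map_tmul, h1,
      h1, proj_of_mem 𝒜 (hm _), proj_of_mem 𝒜 (hm _), coeff_one, coeff_one]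
    congr 1
    · rcases Nat.eq_zero_or_pos j with rfl | hj
      · simp
      · rw [if_neg hj.ne', TensorProduct.tmul_zero, TensorProduct.tmul_zero]
    · rcases Nat.eq_zero_or_pos i with rfl | hi
      · simp
      · rw [if_neg hi.ne', TensorProduct.zero_tmul, TensorProduct.zero_tmul]

omit h𝒜 in
/-- `G(H)` is the inverse limit of its truncations. -/
theorem mem_groupLike_of_truncEq {f : H⟦X⟧} (h : ∀ N, ∃ g ∈ groupLike 𝒜, TruncEq N f g) :
    f ∈ groupLike 𝒜 := by
  refine ⟨fun n => ?_, ?_, fun i j => ?_⟩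
  · obtain ⟨g, hg, hfg⟩ := h n
    rw [hfg n le_rfl]
    exact hg.1 n
  · obtain ⟨g, hg, hfg⟩ := h 0
    rw [hfg 0 le_rfl]
    exact hg.2.1
  · obtain ⟨g, hg, hfg⟩ := h (i + j)
    rw [completedComul, hfg _ le_rfl, hfg _ (Nat.le_add_right i j), hfg _ (Nat.le_add_left j i)]
    exact hg.2.2 i j

omit h𝒜 in
/-- `Prim(H)` is the inverse limit of its truncations. -/
theorem mem_primitive_of_truncEq {f : H⟦X⟧} (h : ∀ N, ∃ g ∈ primitive 𝒜, TruncEq N f g) :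
    f ∈ primitive 𝒜 := by
  refine ⟨fun n => ?_, fun i j => ?_⟩
  · obtain ⟨g, hg, hfg⟩ := h n
    rw [hfg n le_rfl]
    exact hg.1 n
  · obtain ⟨g, hg, hfg⟩ := h (i + j)
    rw [completedComul, hfg _ le_rfl, hfg _ (Nat.le_add_right i j), hfg _ (Nat.le_add_left j i)]
    exact hg.2 i j

end Completion

/-! ### Closure of the completion under products, exponentials and logarithms -/

section GradedSeries

variable {K : Type*} [Field K] {A : Type*} [Ring A] [Algebra K A]
  {𝒜 : ℕ → Submodule K A} [SetLike.GradedMonoid 𝒜]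

theorem one_coeff_mem (n : ℕ) : coeff n (1 : A⟦X⟧) ∈ 𝒜 n := by
  rw [coeff_one]
  split_ifs with h
  · rw [h]; exact SetLike.GradedOne.one_mem
  · exact Submodule.zero_mem _

theorem mul_coeff_mem {f g : A⟦X⟧} (hf : ∀ n, coeff n f ∈ 𝒜 n) (hg : ∀ n, coeff n g ∈ 𝒜 n)
    (n : ℕ) : coeff n (f * g) ∈ 𝒜 n := by
  rw [coeff_mul]
  refine Submodule.sum_mem _ fun p hp => ?_
  rw [← mem_antidiagonal.1 hp]
  exact SetLike.mul_mem_graded (hf _) (hg _)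

theorem pow_coeff_mem {f : A⟦X⟧} (hf : ∀ n, coeff n f ∈ 𝒜 n) (k n : ℕ) :
    coeff n (f ^ k) ∈ 𝒜 n := by
  induction k generalizing n with
  | zero => rw [pow_zero]; exact one_coeff_mem n
  | succ k ih => rw [pow_succ]; exact mul_coeff_mem ih hf n

theorem evalSeries_coeff_mem {f : A⟦X⟧} (hf : ∀ n, coeff n f ∈ 𝒜 n) (u : K⟦X⟧) (n : ℕ) :
    coeff n (evalSeries f u) ∈ 𝒜 n := by
  rw [evalSeries, coeff_mk]
  exact Submodule.sum_mem _ fun k _ => Submodule.smul_mem _ _ (pow_coeff_mem hf k n)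

theorem expSeries_coeff_mem {f : A⟦X⟧} (hf : ∀ n, coeff n f ∈ 𝒜 n) (n : ℕ) :
    coeff n (expSeries K f) ∈ 𝒜 n := by
  rw [expSeries, map_add]
  exact Submodule.add_mem _ (one_coeff_mem n) (evalSeries_coeff_mem hf _ n)

theorem logSeries_coeff_mem {f : A⟦X⟧} (hf : ∀ n, coeff n f ∈ 𝒜 n) (n : ℕ) :
    coeff n (logSeries K f) ∈ 𝒜 n := by
  refine evalSeries_coeff_mem (fun n => ?_) _ n
  rw [map_sub]
  exact Submodule.sub_mem _ (hf n) (one_coeff_mem n)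

theorem coeff_mem_of_mul_eq_one {f g : A⟦X⟧} (hf : ∀ n, coeff n f ∈ 𝒜 n) (h0 : coeff 0 f = 1)
    (h : f * g = 1) (n : ℕ) : coeff n g ∈ 𝒜 n := by
  induction n using Nat.strong_induction_on with
  | _ n ih =>
    have h1 := congrArg (coeff n) h
    rw [coeff_mul, ← Finset.add_sum_erase _ _ (show (0, n) ∈ antidiagonal n from
      mem_antidiagonal.2 (zero_add n)), h0, one_mul] at h1
    rw [eq_sub_of_add_eq h1]
    refine Submodule.sub_mem _ (one_coeff_mem n) (Submodule.sum_mem _ fun p hp => ?_)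
    obtain ⟨hne, hp⟩ := Finset.mem_erase.1 hp
    have hp := mem_antidiagonal.1 hp
    have h2 : p.2 < n := by
      rcases Nat.eq_zero_or_pos p.1 with h2 | h2
      · exact absurd (Prod.ext h2 (by omega)) hne
      · omega
    have h3 := SetLike.mul_mem_graded (hf p.1) (ih p.2 h2)
    rwa [hp] at h3

theorem logDer_coeff_mem {g : A⟦X⟧} (hg : ∀ n, coeff n g ∈ 𝒜 n) (h0 : coeff 0 g = 1) (n : ℕ) :
    coeff n (logDer g) ∈ 𝒜 n := by
  refine mul_coeff_mem (coeff_mem_of_mul_eq_one hg h0 (mul_seriesInv h0)) (fun n => ?_) n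
  rw [coeff_eulerDer]
  exact Submodule.smul_of_tower_mem _ n (hg n)

/-- Up to the degree that follows the vanishing components of `a`, the exponential of `a` is
`1 + a`. -/
theorem coeff_expSeries_of_vanishing {a : A⟦X⟧} {N : ℕ} (ha : ∀ n ≤ N, coeff n a = 0)
    {n : ℕ} (hn : n ≤ N + 1) : coeff n (expSeries K a) = coeff n (1 + a) := by
  rw [expSeries, map_add, map_add, coeff_evalSeries (ha 0 (Nat.zero_le N)) _
    (show n < n + 2 by omega), Finset.sum_eq_single 1]
  · simp [expSubOne]
  · intro k _ hk
    rcases k with _ | _ | k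
    · rw [coeff_zero_expSubOne, zero_smul]
    · exact absurd rfl hk
    · rw [pow_succ', coeff_mul, Finset.sum_eq_zero, smul_zero]
      intro p hp
      rw [mem_antidiagonal] at hp
      rcases Nat.lt_or_ge N p.1 with h | h
      · rw [show p.2 = 0 by omega, coeff_pow_eq_zero (ha 0 (Nat.zero_le N)) (Nat.succ_pos k),
          mul_zero]
      · rw [ha _ h, zero_mul]
  · simp

end GradedSeries

/-! ### The bijection induced by a Lie idempotent series -/

section Bijection

variable {K : Type*} [Field K] [CharZero K] {H : Type*} [Ring H] [HopfAlgebra K H]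
  {𝒜 : ℕ → Submodule K H} [GradedAlgebra 𝒜] (h𝒜 : IsConnectedGradedBialgebra 𝒜)
  {ρ : descentAlgebra K →ₐ[K] WithConv (H →ₗ[K] H)}
  (hρ : ∀ n, ρ (descentGen K n) = gradedProj 𝒜 n)
  {γ : ℕ → descentAlgebra K} (hγ : IsLieIdempotentSeries γ)

omit [CharZero K] in
@[simp]
theorem coeff_seriesMap (f : H⟦X⟧) (n : ℕ) :
    coeff n (seriesMap ρ γ f) = (ρ (γ n)).ofConv (coeff n f) := coeff_mk _ _

include h𝒜 in
theorem expSeries_mem_groupLike {h : H⟦X⟧} (hh : h ∈ primitive 𝒜) :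
    expSeries K h ∈ groupLike 𝒜 := by
  rw [mem_primitive_iff h𝒜] at hh
  rw [mem_groupLike_iff h𝒜]
  exact ⟨hh.1.expSeries commute_includeLeft_includeRight, expSeries_coeff_mem hh.2⟩

include h𝒜 in
omit [CharZero K] in
theorem mul_mem_groupLike {g g' : H⟦X⟧} (hg : g ∈ groupLike 𝒜) (hg' : g' ∈ groupLike 𝒜) :
    g * g' ∈ groupLike 𝒜 := by
  rw [mem_groupLike_iff h𝒜] at *
  exact ⟨hg.1.mul commute_includeLeft_includeRight hg'.1, mul_coeff_mem hg.2 hg'.2⟩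

include h𝒜 in
omit [CharZero K] in
/-- If two group-like series agree in degrees `< n`, their difference in degree `n` is primitive. -/
theorem sub_mem_primitiveLie {g g' : H⟦X⟧} (hg : g ∈ groupLike 𝒜) (hg' : g' ∈ groupLike 𝒜)
    {n : ℕ} (hn : n ≠ 0) (h : ∀ m < n, coeff m g = coeff m g') :
    coeff n g - coeff n g' ∈ primitiveLie K H := by
  have h1 := ((mem_groupLike_iff h𝒜).1 hg).1
  have h2 := ((mem_groupLike_iff h𝒜).1 hg').1
  rw [mem_primitiveLie, map_sub, h1.comul_coeff, h2.comul_coeff, ← Finset.sum_sub_distrib,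
    Finset.sum_eq_add (n, 0) (0, n)]
  · simp only [h1.coeff_zero, h2.coeff_zero, TensorProduct.sub_tmul, TensorProduct.tmul_sub]
  · simp [hn]
  · rintro ⟨a, b⟩ hab ⟨ha, hb⟩
    rw [mem_antidiagonal] at hab
    have ha' : a < n := by
      refine lt_of_le_of_ne (by omega) ?_
      rintro rfl
      exact ha (Prod.ext rfl (by omega))
    have hb' : b < n := by
      refine lt_of_le_of_ne (by omega) ?_
      rintro rfl
      exact hb (Prod.ext (by omega) rfl)
    rw [h a ha', h b hb', sub_self]
  · intro hn
    exact absurd (mem_antidiagonal.2 (add_zero n)) hn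
  · intro hn
    exact absurd (mem_antidiagonal.2 (zero_add n)) hn

include h𝒜 hρ hγ

theorem IsLieIdempotentSeries.mapsTo :
    Set.MapsTo (seriesMap ρ γ) (groupLike 𝒜) (primitive 𝒜) := by
  intro g hg
  rw [mem_groupLike_iff h𝒜] at hg
  rw [mem_primitive_iff h𝒜]
  have h1 (n : ℕ) := hγ.apply_groupLike h𝒜 hρ hg.1 hg.2 n
  have h2 (n : ℕ) : coeff n (seriesMap ρ γ g) ∈ 𝒜 n := by
    rw [coeff_seriesMap]
    exact apply_mem_of_mem_descentDeg hρ (hγ.mem_descentDeg n) _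
  refine ⟨IsPrimitiveSeries.of_comul_coeff ?_ fun n => ?_, h2⟩
  · refine h𝒜.eq_zero_of_mem ?_ (h2 0)
    rw [coeff_seriesMap]
    exact h1 0
  · rw [coeff_seriesMap]
    exact h1 n

omit [CharZero K] in
/-- A Lie idempotent series induces an isomorphism of inverse systems. The components of two
group-like series that agree in lower degrees differ by a primitive element, which is fixed by the
Lie idempotent. -/
theorem IsLieIdempotentSeries.truncEq_iff (N : ℕ) {g g' : H⟦X⟧} (hg : g ∈ groupLike 𝒜)
    (hg' : g' ∈ groupLike 𝒜) :
    TruncEq N (seriesMap ρ γ g) (seriesMap ρ γ g') ↔ TruncEq N g g' := by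
  constructor
  · intro h n
    induction n using Nat.strong_induction_on with
    | _ n ih =>
      intro hn
      rcases Nat.eq_zero_or_pos n with rfl | hpos
      · rw [((mem_groupLike_iff h𝒜).1 hg).1.coeff_zero, ((mem_groupLike_iff h𝒜).1 hg').1.coeff_zero]
      · have h1 := sub_mem_primitiveLie h𝒜 hg hg' hpos.ne' fun m hm => ih m hm (by omega)
        have h2 := hγ.apply_primitive hρ hpos.ne' h1 (Submodule.sub_mem _ (hg.1 n) (hg'.1 n))
        have h3 := h n hn
        rw [coeff_seriesMap, coeff_seriesMap] at h3
        rw [map_sub, h3, sub_self] at h2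
        exact sub_eq_zero.1 h2.symm
  · intro h n hn
    rw [coeff_seriesMap, coeff_seriesMap, h n hn]

/-- The truncated surjectivity: a group-like series with the right image in degrees `≤ N` is
corrected in degree `N + 1` by the exponential of a primitive element. -/
theorem IsLieIdempotentSeries.exists_truncEq {f : H⟦X⟧} (hf : f ∈ primitive 𝒜) (N : ℕ) :
    ∃ g ∈ groupLike 𝒜, TruncEq N (seriesMap ρ γ g) f := by
  have hf' := (mem_primitive_iff h𝒜).1 hf
  induction N with
  | zero =>
    have h1 : (1 : H⟦X⟧) ∈ groupLike 𝒜 := by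
      rw [mem_groupLike_iff h𝒜]
      exact ⟨⟨by simp, by simp⟩, one_coeff_mem⟩
    refine ⟨1, h1, fun n hn => ?_⟩
    obtain rfl : n = 0 := by omega
    rw [hf'.1.coeff_zero, ((mem_primitive_iff h𝒜).1 (hγ.mapsTo h𝒜 hρ h1)).1.coeff_zero]
  | succ N ih =>
    obtain ⟨g, hg, hgf⟩ := ih
    have hγg := (mem_primitive_iff h𝒜).1 (hγ.mapsTo h𝒜 hρ hg)
    set u := coeff (N + 1) f - coeff (N + 1) (seriesMap ρ γ g) with hu
    have hup : u ∈ primitiveLie K H :=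
      (primitiveLie K H).sub_mem (hf'.1.comul_coeff _) (hγg.1.comul_coeff _)
    have hum : u ∈ 𝒜 (N + 1) := Submodule.sub_mem _ (hf'.2 _) (hγg.2 _)
    have ha : monomial (N + 1) u ∈ primitive 𝒜 := by
      rw [mem_primitive_iff h𝒜]
      refine ⟨IsPrimitiveSeries.of_comul_coeff ?_ fun n => ?_, fun n => ?_⟩
      · rw [coeff_monomial, if_neg (Nat.succ_ne_zero N).symm]
      · rw [coeff_monomial]
        split_ifs
        · exact hup
        · simp
      · rw [coeff_monomial]
        split_ifs with h
        · rwa [h]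
        · exact Submodule.zero_mem _
    have hv (n : ℕ) (hn : n ≤ N) : coeff n (monomial (N + 1) u) = 0 := by
      rw [coeff_monomial, if_neg (by omega)]
    have hg0 := ((mem_groupLike_iff h𝒜).1 hg).1.coeff_zero
    have hco (n : ℕ) (hn : n ≤ N + 1) : coeff n (g * expSeries K (monomial (N + 1) u)) =
        coeff n g + coeff n (monomial (N + 1) u) := by
      have h1 : coeff n (g * expSeries K (monomial (N + 1) u)) =
          coeff n (g * (1 + monomial (N + 1) u)) := by
        rw [coeff_mul, coeff_mul]
        refine Finset.sum_congr rfl fun p hp => ?_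
        rw [mem_antidiagonal] at hp
        rw [coeff_expSeries_of_vanishing hv (by omega)]
      rw [h1, mul_add, mul_one, map_add]
      congr 1
      rw [coeff_mul, Finset.sum_eq_single (0, n)]
      · rw [hg0, one_mul]
      · rintro ⟨a, b⟩ hab hne
        rw [mem_antidiagonal] at hab
        have hb : b ≤ N := by
          by_contra hb
          have h2 : a = 0 := by omega
          exact hne (Prod.ext h2 (by omega))
        rw [hv b hb, mul_zero]
      · intro hn
        exact absurd (mem_antidiagonal.2 (zero_add n)) hn
    refine ⟨_, mul_mem_groupLike h𝒜 hg (expSeries_mem_groupLike h𝒜 ha), fun n hn => ?_⟩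
    rw [coeff_seriesMap, hco n hn, map_add]
    rcases Nat.lt_or_ge N n with h | h
    · obtain rfl : n = N + 1 := by omega
      rw [coeff_monomial, if_pos rfl, hγ.apply_primitive hρ (Nat.succ_ne_zero N) hup hum, hu,
        coeff_seriesMap, add_sub_cancel]
    · rw [hv n h, map_zero, add_zero, ← coeff_seriesMap, hgf n h]

theorem IsLieIdempotentSeries.bijOn :
    Set.BijOn (seriesMap ρ γ) (groupLike 𝒜) (primitive 𝒜) := by
  refine ⟨hγ.mapsTo h𝒜 hρ, fun g hg g' hg' h => ?_, fun f hf => ?_⟩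
  · ext n
    exact (hγ.truncEq_iff h𝒜 hρ n hg hg').1 (fun m _ => by rw [h]) n le_rfl
  · choose g hg hgf using fun N => hγ.exists_truncEq h𝒜 hρ hf N
    -- by injectivity in each degree, the approximate preimages form a coherent system
    have hlim (N : ℕ) : TruncEq N (PowerSeries.mk fun n => coeff n (g n)) (g N) := by
      intro n hn
      rw [coeff_mk]
      refine (hγ.truncEq_iff h𝒜 hρ n (hg n) (hg N)).1 (fun m hm => ?_) n le_rfl
      rw [hgf n m hm, hgf N m (hm.trans hn)]
    refine ⟨PowerSeries.mk fun n => coeff n (g n),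
      mem_groupLike_of_truncEq fun N => ⟨g N, hg N, hlim N⟩, ?_⟩
    ext n
    rw [coeff_seriesMap, coeff_mk, ← coeff_seriesMap, hgf n n le_rfl]

end Bijection

/-! ### The Eulerian and Dynkin series in the descent algebra -/

section DescentSeries

variable (K : Type*) [Field K]

instance descentDeg_gradedMonoid : SetLike.GradedMonoid (descentDeg K) where
  one_mem := Submodule.subset_span ⟨[], rfl, by simp⟩
  mul_mem i j a b ha hb := by
    have h := Submodule.mul_mem_mul ha hb
    rw [descentDeg, descentDeg, Submodule.span_mul_span] at h
    refine Submodule.span_mono ?_ h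
    rintro _ ⟨_, ⟨l, rfl, rfl⟩, _, ⟨l', rfl, rfl⟩, rfl⟩
    exact ⟨l ++ l', by simp, by simp⟩

/-- The elements of the free algebra that represent elements of `𝒟_n`. -/
def presentationDeg (n : ℕ) : Submodule K (FreeAlgebra K ℕ) :=
  (descentDeg K n).comap (descentPresentation K).toLinearMap

theorem mem_presentationDeg {n : ℕ} {P : FreeAlgebra K ℕ} :
    P ∈ presentationDeg K n ↔ descentPresentation K P ∈ descentDeg K n := Iff.rfl

instance presentationDeg_gradedMonoid : SetLike.GradedMonoid (presentationDeg K) where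
  one_mem := by
    rw [mem_presentationDeg, map_one]
    exact SetLike.GradedOne.one_mem
  mul_mem i j a b ha hb := by
    rw [mem_presentationDeg] at *
    rw [map_mul]
    exact SetLike.mul_mem_graded ha hb

/-- The series `1 + ∑_{n ≥ 1} p_n X^n`, over the free algebra on the symbols `p_n`. The logarithm
and the logarithmic derivative are taken here, and then mapped to the descent algebra. -/
def symbolSeries : (FreeAlgebra K ℕ)⟦X⟧ :=
  PowerSeries.mk fun n => if n = 0 then 1 else FreeAlgebra.ι K n

theorem coeff_zero_symbolSeries : coeff 0 (symbolSeries K) = 1 := by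
  rw [symbolSeries, coeff_mk, if_pos rfl]

theorem symbolSeries_coeff_mem (n : ℕ) : coeff n (symbolSeries K) ∈ presentationDeg K n := by
  rw [symbolSeries, coeff_mk]
  split_ifs with h
  · rw [h]
    exact SetLike.GradedOne.one_mem
  · rw [mem_presentationDeg, descentPresentation, FreeAlgebra.lift_ι_apply]
    exact Submodule.subset_span ⟨[n], by simp, by simp⟩

/-- The Eulerian idempotents, as elements of the descent algebra. -/
def eulerianElement (n : ℕ) : descentAlgebra K :=
  descentPresentation K (coeff n (logSeries K (symbolSeries K)))

/-- The components of the Dynkin operator, as elements of the descent algebra. -/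
def dynkinElement (n : ℕ) : descentAlgebra K :=
  descentPresentation K (coeff n (logDer (symbolSeries K)))

theorem eulerianElement_mem (n : ℕ) : eulerianElement K n ∈ descentDeg K n :=
  (mem_presentationDeg K).1 (logSeries_coeff_mem (symbolSeries_coeff_mem K) n)

theorem dynkinElement_mem (n : ℕ) : dynkinElement K n ∈ descentDeg K n :=
  (mem_presentationDeg K).1
    (logDer_coeff_mem (symbolSeries_coeff_mem K) (coeff_zero_symbolSeries K) n)

variable {K} {H : Type*} [Ring H] [Bialgebra K H] {𝒜 : ℕ → Submodule K H} [GradedAlgebra 𝒜]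

theorem map_symbolSeries (h𝒜 : IsConnectedGradedBialgebra 𝒜) :
    PowerSeries.map (projEval 𝒜 : FreeAlgebra K ℕ →+* WithConv (H →ₗ[K] H)) (symbolSeries K) =
      projSeries 𝒜 := by
  ext1 n
  rw [coeff_map, symbolSeries, coeff_mk, projSeries, coeff_mk]
  split_ifs with h
  · rw [h, h𝒜.gradedProj_zero]
    exact map_one (projEval 𝒜)
  · exact FreeAlgebra.lift_ι_apply _ _

theorem coeff_map_eq {A B : Type*} [Ring A] [Ring B] [Algebra K A] [Algebra K B] (f : A →ₐ[K] B)
    {g : A⟦X⟧} {h : B⟦X⟧} (hgh : PowerSeries.map (f : A →+* B) g = h) (n : ℕ) :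
    f (coeff n g) = coeff n h := by
  rw [← hgh, coeff_map]
  rfl

theorem projEval_coeff_logSeries (h𝒜 : IsConnectedGradedBialgebra 𝒜) (n : ℕ) :
    projEval 𝒜 (coeff n (logSeries K (symbolSeries K))) =
      coeff n (logSeries K (projSeries 𝒜)) :=
  coeff_map_eq (projEval 𝒜)
    ((map_logSeries _ _).trans (congrArg (logSeries K) (map_symbolSeries h𝒜))) n

theorem projEval_coeff_logDer (h𝒜 : IsConnectedGradedBialgebra 𝒜) (n : ℕ) :
    projEval 𝒜 (coeff n (logDer (symbolSeries K))) = coeff n (logDer (projSeries 𝒜)) :=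
  coeff_map_eq (projEval 𝒜)
    ((map_logDer _ (coeff_zero_symbolSeries K)).trans (congrArg logDer (map_symbolSeries h𝒜))) n

theorem coe_eulerianElement (n : ℕ) : (eulerianElement K n : WithConv (T K →ₗ[K] T K)) =
    coeff n (logSeries K (projSeries (tensorDeg K))) :=
  (coe_descentPresentation _).trans
    (projEval_coeff_logSeries (tensor_isConnectedGradedBialgebra K) n)

theorem coe_dynkinElement (n : ℕ) : (dynkinElement K n : WithConv (T K →ₗ[K] T K)) =
    coeff n (logDer (projSeries (tensorDeg K))) :=
  (coe_descentPresentation _).trans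
    (projEval_coeff_logDer (tensor_isConnectedGradedBialgebra K) n)

variable {ρ : descentAlgebra K →ₐ[K] WithConv (H →ₗ[K] H)}
  (hρ : ∀ n, ρ (descentGen K n) = gradedProj 𝒜 n)
include hρ

theorem apply_eulerianElement (h𝒜 : IsConnectedGradedBialgebra 𝒜) (n : ℕ) :
    ρ (eulerianElement K n) = coeff n (logSeries K (projSeries 𝒜)) :=
  (apply_descentPresentation hρ _).trans (projEval_coeff_logSeries h𝒜 n)

theorem apply_dynkinElement (h𝒜 : IsConnectedGradedBialgebra 𝒜) (n : ℕ) :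
    ρ (dynkinElement K n) = coeff n (logDer (projSeries 𝒜)) :=
  (apply_descentPresentation hρ _).trans (projEval_coeff_logDer h𝒜 n)

omit hρ

theorem IsConnectedGradedBialgebra.degHom_id (h𝒜 : IsConnectedGradedBialgebra 𝒜) :
    h𝒜.degHom (toConv (LinearMap.id : H →ₗ[K] H)) = projSeries 𝒜 := by
  ext1 n
  rw [h𝒜.coeff_degHom, projSeries, coeff_mk]
  rfl

/-- The components of the convolution logarithm of the identity. -/
theorem coeff_logSeries_projSeries (h𝒜 : IsConnectedGradedBialgebra 𝒜) (n : ℕ) :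
    coeff n (logSeries K (projSeries 𝒜)) = ∑ k ∈ Finset.Icc 1 n,
      ((-1 : K) ^ (k - 1) / (k : K)) • toConv
        (((toConv (LinearMap.id : H →ₗ[K] H) - 1) ^ k).ofConv ∘ₗ GradedAlgebra.proj 𝒜 n) := by
  rw [coeff_logSeries]
  refine Finset.sum_congr rfl fun k _ => ?_
  rw [← h𝒜.degHom_id, ← map_one h𝒜.degHom, ← map_sub, ← map_pow, h𝒜.coeff_degHom]

end DescentSeries

/-! ### The Eulerian idempotents -/

section Eulerian

variable {K : Type*} [Field K]

instance tensor_isCocomm : Coalgebra.IsCocomm K (T K) where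
  comm_comp_comul := by
    have h : (Algebra.TensorProduct.comm K (T K) (T K)).toAlgHom.comp
        (Bialgebra.comulAlgHom K (T K)) = Bialgebra.comulAlgHom K (T K) := by
      refine tensorAlgHom_ext K fun i => ?_
      simp [comul_letter, add_comm]
    ext1 x
    exact DFunLike.congr_fun h x

section Postcomposition

variable {C A B : Type*} [Ring C] [Bialgebra K C] [Ring A] [Algebra K A] [Ring B] [Algebra K B]

/-- Composition with an algebra map, as an algebra map of convolution algebras. -/
def postcompHom (h : A →ₐ[K] B) : WithConv (C →ₗ[K] A) →ₐ[K] WithConv (C →ₗ[K] B) where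
  toFun f := toConv (h.toLinearMap ∘ₗ f.ofConv)
  map_one' := by
    ext x
    exact h.commutes _
  map_mul' f g := congrArg toConv (LinearMap.algHom_comp_convMul_distrib h f g)
  map_zero' := by ext x; exact map_zero h
  map_add' f g := by ext x; exact map_add h _ _
  commutes' c := by
    ext x
    rw [Algebra.algebraMap_eq_smul_one, Algebra.algebraMap_eq_smul_one]
    change h (c • algebraMap K A _) = c • algebraMap K B _
    rw [map_smul, h.commutes]

theorem postcompHom_apply (h : A →ₐ[K] B) (f : WithConv (C →ₗ[K] A)) (x : C) :
    (postcompHom h f).ofConv x = h (f.ofConv x) := rfl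

theorem postcomp_mul_postcomp_apply (f g : WithConv (C →ₗ[K] A)) (x : C) :
    (postcompHom (Algebra.TensorProduct.includeLeft : A →ₐ[K] A ⊗[K] A) f *
      postcompHom (Algebra.TensorProduct.includeRight : A →ₐ[K] A ⊗[K] A) g).ofConv x =
    TensorProduct.map f.ofConv g.ofConv (Coalgebra.comul (R := K) x) := by
  rw [LinearMap.convMul_apply]
  induction Coalgebra.comul (R := K) x with
  | zero => simp
  | add y z hy hz => rw [map_add, map_add, map_add, hy, hz]
  | tmul y z =>
    rw [TensorProduct.map_tmul, TensorProduct.map_tmul, LinearMap.mul'_apply, postcompHom_apply,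
      postcompHom_apply]
    simp

/-- The commutation of the two inclusions for the convolution product is the cocommutativity of
the coalgebra. -/
theorem commute_postcompHom [Coalgebra.IsCocomm K C] (f g : WithConv (C →ₗ[K] A)) :
    Commute (postcompHom (Algebra.TensorProduct.includeLeft : A →ₐ[K] A ⊗[K] A) f)
      (postcompHom (Algebra.TensorProduct.includeRight : A →ₐ[K] A ⊗[K] A) g) := by
  refine WithConv.ext (LinearMap.ext fun x => ?_)
  rw [postcomp_mul_postcomp_apply, LinearMap.convMul_apply]
  conv_lhs => rw [← Coalgebra.comm_comul K x]
  induction Coalgebra.comul (R := K) x with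
  | zero => simp
  | add y z hy hz => simp only [map_add, hy, hz]
  | tmul y z =>
    rw [TensorProduct.comm_tmul, TensorProduct.map_tmul, TensorProduct.map_tmul,
      LinearMap.mul'_apply, postcompHom_apply, postcompHom_apply]
    simp

end Postcomposition

variable {H : Type*} [Ring H] [Bialgebra K H] {𝒜 : ℕ → Submodule K H} [GradedAlgebra 𝒜]

/-- The series `∑ p_n X^n` is group-like, for the coproducts of the values: this is the
compatibility of the coproduct with the grading. -/
theorem isGroupLikeSeries_projSeries (h𝒜 : IsConnectedGradedBialgebra 𝒜) :
    IsGroupLikeSeries (postcompHom (C := H) (Bialgebra.comulAlgHom K H))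
      (postcompHom Algebra.TensorProduct.includeLeft)
      (postcompHom Algebra.TensorProduct.includeRight) (projSeries 𝒜) where
  coeff_zero := coeff_zero_projSeries h𝒜
  map_eq := by
    ext n x
    rw [coeff_mul, coeff_map]
    simp only [coeff_map, projSeries, coeff_mk, WithConv.ofConv_sum, LinearMap.sum_apply]
    refine (h𝒜.comul_proj n x).trans (Finset.sum_congr rfl fun p _ => ?_)
    exact (postcomp_mul_postcomp_apply _ _ _).symm

/-- The convolution logarithm of the identity of a cocommutative bialgebra has primitive values. -/
theorem logSeries_projSeries_apply_mem [CharZero K] [Coalgebra.IsCocomm K H]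
    (h𝒜 : IsConnectedGradedBialgebra 𝒜) (n : ℕ) (x : H) :
    (coeff n (logSeries K (projSeries 𝒜))).ofConv x ∈ primitiveLie K H := by
  have hc (a b : WithConv (H →ₗ[K] H)) := commute_postcompHom (K := K) a b
  have h : IsPrimitiveSeries (postcompHom (C := H) (Bialgebra.comulAlgHom K H))
      (postcompHom Algebra.TensorProduct.includeLeft)
      (postcompHom Algebra.TensorProduct.includeRight) (logSeries K (projSeries 𝒜)) :=
    IsGroupLikeSeries.logSeries hc (isGroupLikeSeries_projSeries h𝒜)
  have h1 := h.map_coeff_eq n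
  generalize coeff n (logSeries K (projSeries 𝒜)) = f at h1 ⊢
  exact congrArg (fun f => f.ofConv x) h1

theorem id_sub_one_pow_apply_one (k : ℕ) :
    ((toConv (LinearMap.id : H →ₗ[K] H) - 1) ^ (k + 1)).ofConv 1 = 0 := by
  have h : (toConv (LinearMap.id : H →ₗ[K] H) - 1).ofConv 1 = 0 := by
    change (1 : H) - algebraMap K H (Coalgebra.counit (R := K) (1 : H)) = 0
    rw [Bialgebra.counit_one, map_one, sub_self]
  rw [pow_succ, conv_apply_one, h, mul_zero]

theorem id_sub_one_apply_primitive {x : H} (hx : x ∈ primitiveLie K H) :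
    (toConv (LinearMap.id : H →ₗ[K] H) - 1).ofConv x = x := by
  rw [WithConv.ofConv_sub, LinearMap.sub_apply, LinearMap.convOne_apply,
    counit_eq_zero_of_mem_primitiveLie hx, map_zero]
  exact sub_zero _

theorem logSeries_projSeries_apply_primitive (h𝒜 : IsConnectedGradedBialgebra 𝒜) {n : ℕ}
    (hn : n ≠ 0) {x : H} (hx : x ∈ primitiveLie K H) (hxn : x ∈ 𝒜 n) :
    (coeff n (logSeries K (projSeries 𝒜))).ofConv x = x := by
  rw [coeff_logSeries_projSeries h𝒜, WithConv.ofConv_sum, LinearMap.sum_apply,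
    Finset.sum_eq_single 1]
  · rw [WithConv.ofConv_smul, LinearMap.smul_apply, LinearMap.comp_apply, proj_of_mem 𝒜 hxn,
      if_pos rfl, pow_one, id_sub_one_apply_primitive hx]
    simp
  · intro k hk hk1
    obtain ⟨j, rfl⟩ : ∃ j, k = j + 2 := ⟨k - 2, by rw [Finset.mem_Icc] at hk; omega⟩
    have h1 : (toConv (LinearMap.id : H →ₗ[K] H) - 1).ofConv 1 = 0 := by
      have := id_sub_one_pow_apply_one (K := K) (H := H) 0
      rwa [zero_add, pow_one] at this
    rw [WithConv.ofConv_smul, LinearMap.smul_apply, LinearMap.comp_apply, proj_of_mem 𝒜 hxn,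
      if_pos rfl, pow_succ', conv_apply_of_mem_primitiveLie _ _ hx, id_sub_one_pow_apply_one, h1,
      mul_zero, zero_mul, add_zero, smul_zero]
  · intro h
    exact absurd (Finset.mem_Icc.2 ⟨le_rfl, Nat.one_le_iff_ne_zero.2 hn⟩) h

end Eulerian

/-! ### The Dynkin operator -/

section Dynkin

variable {K : Type*} [Field K]

variable (K) in
theorem iteratedBracket_append_singleton (y i : ℕ) (l : List ℕ) :
    iteratedBracket K (y :: l ++ [i]) =
      iteratedBracket K (y :: l) * letter K i - letter K i * iteratedBracket K (y :: l) := by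
  rw [List.cons_append, iteratedBracket, iteratedBracket, List.foldl_append]
  rfl

theorem iteratedBracket_mem_freeLie (l : List ℕ) : iteratedBracket K l ∈ freeLie K := by
  have h (j : ℕ) : letter K j ∈ freeLie K := LieSubalgebra.subset_lieSpan ⟨j, rfl⟩
  induction l using List.reverseRecOn with
  | nil => exact (freeLie K).zero_mem
  | append_singleton l i ih =>
    cases l with
    | nil => exact h i
    | cons y l =>
      rw [iteratedBracket_append_singleton]
      exact (freeLie K).lie_mem ih (h i)

/-- The basis of words allows to check linear statements on words. -/
theorem word_induction {p : T K → Prop} (h0 : p 0) (hadd : ∀ x y, p x → p y → p (x + y))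
    (hsmul : ∀ (c : K) x, p x → p (c • x)) (hw : ∀ l : List ℕ, p (l.map (letter K)).prod)
    (x : T K) : p x := by
  have hx := (Finsupp.basisSingleOne (R := K) (ι := ℕ)).tensorAlgebra.mem_span x
  induction hx using Submodule.span_induction with
  | mem x hx =>
    obtain ⟨w, rfl⟩ := hx
    have h := basis_word K w.toList
    rw [FreeMonoid.ofList_toList] at h
    rw [h]
    exact hw _
  | zero => exact h0
  | add x y _ _ hx hy => exact hadd _ _ hx hy
  | smul c x _ hx => exact hsmul _ _ hx

theorem dynkin_mem_freeLie (x : T K) : dynkin K x ∈ freeLie K := by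
  induction x using word_induction with
  | h0 => rw [map_zero]; exact (freeLie K).zero_mem
  | hadd x y hx hy => rw [map_add]; exact (freeLie K).add_mem hx hy
  | hsmul c x hx => rw [map_smul]; exact (freeLie K).smul_mem c hx
  | hw l => rw [dynkin_word]; exact iteratedBracket_mem_freeLie l

variable (K) in
theorem dynkin_one : dynkin K 1 = 0 := dynkin_word K []

theorem dynkin_mul_letter (a : T K) (i : ℕ) : dynkin K (a * letter K i) =
    dynkin K a * letter K i - letter K i * dynkin K a +
      Coalgebra.counit (R := K) a • letter K i := by
  induction a using word_induction with
  | h0 => simp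
  | hadd x y hx hy =>
    rw [add_mul, map_add, hx, hy, map_add, map_add, add_mul, mul_add, add_smul]
    abel
  | hsmul c x hx =>
    rw [smul_mul_assoc, map_smul, hx, map_smul, map_smul, smul_mul_assoc, mul_smul_comm, smul_add,
      smul_sub, smul_assoc]
  | hw l =>
    have h : (l.map (letter K)).prod * letter K i = ((l ++ [i]).map (letter K)).prod := by simp
    rw [h, dynkin_word, dynkin_word]
    cases l with
    | nil => simp [iteratedBracket]
    | cons y l =>
      rw [iteratedBracket_append_singleton, List.map_cons, List.prod_cons, Bialgebra.counit_mul,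
        counit_letter, zero_mul, zero_smul, add_zero]

theorem id_conv_dynkin_mul_letter (a : T K) (i : ℕ) :
    (toConv LinearMap.id * toConv (dynkin K)).ofConv (a * letter K i) =
      (toConv LinearMap.id * toConv (dynkin K)).ofConv a * letter K i + a * letter K i := by
  have h1 : (toConv (LinearMap.id : T K →ₗ[K] T K) * 1).ofConv a = a := by rw [mul_one]; rfl
  conv_rhs => rw [← h1]
  rw [h1]
  conv_rhs => arg 2; rw [← h1]
  rw [LinearMap.convMul_apply, LinearMap.convMul_apply, LinearMap.convMul_apply,
    Bialgebra.comul_mul, comul_letter]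
  induction Coalgebra.comul (R := K) a with
  | zero => simp
  | add y z hy hz =>
    simp only [add_mul, map_add, hy, hz]
    abel
  | tmul y z =>
    rw [mul_add, Algebra.TensorProduct.tmul_mul_tmul, Algebra.TensorProduct.tmul_mul_tmul, mul_one,
      mul_one, map_add, map_add]
    simp only [TensorProduct.map_tmul, LinearMap.mul'_apply, LinearMap.id_apply]
    rw [dynkin_mul_letter, LinearMap.convOne_apply, Algebra.algebraMap_eq_smul_one]
    simp only [mul_add, mul_sub, mul_assoc, smul_mul_assoc, one_mul]
    abel

theorem id_conv_dynkin_mul_ι (a : T K) (v : ℕ →₀ K) :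
    (toConv LinearMap.id * toConv (dynkin K)).ofConv (a * TensorAlgebra.ι K v) =
      (toConv LinearMap.id * toConv (dynkin K)).ofConv a * TensorAlgebra.ι K v +
        a * TensorAlgebra.ι K v := by
  induction v using Finsupp.induction_linear with
  | zero => simp
  | add v w hv hw =>
    rw [map_add, mul_add, map_add, hv, hw, mul_add]
    abel
  | single i c =>
    have h : TensorAlgebra.ι K (Finsupp.single i c) = c • letter K i := by
      rw [letter, ← map_smul, Finsupp.smul_single, smul_eq_mul, mul_one]
    rw [h, mul_smul_comm, map_smul, id_conv_dynkin_mul_letter, mul_smul_comm, smul_add]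

/-- The identity `Id ⋆ D = Y`, where `Y` multiplies the elements of degree `n` by `n`. -/
theorem id_conv_dynkin_apply {n : ℕ} {x : T K} (hx : x ∈ tensorDeg K n) :
    (toConv LinearMap.id * toConv (dynkin K)).ofConv x = n • x := by
  induction n generalizing x with
  | zero =>
    rw [tensorDeg, pow_zero, Submodule.mem_one] at hx
    obtain ⟨c, rfl⟩ := hx
    rw [Algebra.algebraMap_eq_smul_one, map_smul, conv_apply_one]
    change c • ((1 : T K) * dynkin K 1) = _
    rw [dynkin_one, mul_zero, smul_zero, zero_smul]
  | succ n ih =>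
    rw [tensorDeg, pow_succ] at hx
    refine Submodule.mul_induction_on hx (fun a ha b hb => ?_) fun x y hx hy => ?_
    · obtain ⟨v, rfl⟩ := hb
      rw [id_conv_dynkin_mul_ι, ih ha, succ_nsmul, smul_mul_assoc]
    · rw [map_add, hx, hy, smul_add]

variable (K) in
/-- The components of the Dynkin operator are the coefficients of the logarithmic derivative of
`∑ p_n X^n` for the convolution product. -/
theorem degHom_dynkin : (tensor_isConnectedGradedBialgebra K).degHom (toConv (dynkin K)) =
    logDer (projSeries (tensorDeg K)) := by
  have h𝒜 := tensor_isConnectedGradedBialgebra K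
  have h0 := coeff_zero_projSeries h𝒜
  have h1 := map_mul h𝒜.degHom (toConv LinearMap.id) (toConv (dynkin K))
  rw [h𝒜.degHom_id] at h1
  have h2 : eulerDer (projSeries (tensorDeg K)) =
      h𝒜.degHom (toConv LinearMap.id * toConv (dynkin K)) := by
    ext n x
    rw [coeff_eulerDer, h𝒜.coeff_degHom, projSeries, coeff_mk]
    exact (id_conv_dynkin_apply (proj_mem (tensorDeg K) n x)).symm
  exact (logDer_eq h0 (h2.trans h1)).symm

theorem ofConv_dynkinElement (n : ℕ) : (dynkinElement K n).1.ofConv = dynkinDeg K n := by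
  rw [coe_dynkinElement, ← degHom_dynkin, IsConnectedGradedBialgebra.coeff_degHom]
  rfl

theorem ofConv_eulerianElement (n : ℕ) : (eulerianElement K n).1.ofConv = eulerian K n := by
  rw [coe_eulerianElement, coeff_logSeries_projSeries (tensor_isConnectedGradedBialgebra K)]
  ext x
  simp [eulerian]

/-- This is `Id ⋆ D = Y` on primitive elements, where `(Id ⋆ D) x = x D(1) + D(x)`. -/
theorem dynkin_apply_primitive {n : ℕ} {x : T K} (hx : x ∈ primitiveLie K (T K))
    (hxn : x ∈ tensorDeg K n) : dynkin K x = n • x := by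
  rw [← id_conv_dynkin_apply hxn, conv_apply_of_mem_primitiveLie _ _ hx]
  change _ = x * dynkin K 1 + 1 * dynkin K x
  rw [dynkin_one, mul_zero, zero_add, one_mul]

variable [CharZero K]

/-- Homogeneous primitive elements of `T(X)` are Lie polynomials: the Dynkin operator, whose values
are Lie polynomials, multiplies them by their degree. -/
theorem mem_freeLieDeg_of_primitive {n : ℕ} {x : T K} (hx : x ∈ primitiveLie K (T K))
    (hxn : x ∈ tensorDeg K n) : x ∈ freeLieDeg K n := by
  refine ⟨?_, hxn⟩
  rcases Nat.eq_zero_or_pos n with rfl | hn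
  · rw [(tensor_isConnectedGradedBialgebra K).eq_zero_of_mem hx hxn]
    exact Submodule.zero_mem _
  · have h : x = (n : K)⁻¹ • dynkin K x := by
      rw [dynkin_apply_primitive hx hxn, ← Nat.cast_smul_eq_nsmul K,
        inv_smul_smul₀ (Nat.cast_ne_zero.2 hn.ne')]
    rw [h]
    exact (freeLie K).smul_mem _ (dynkin_mem_freeLie x)

theorem isLieIdempotentSeries_eulerianElement :
    IsLieIdempotentSeries (eulerianElement K) where
  mem_descentDeg := eulerianElement_mem K
  map_mem n x hx := by
    have h := apply_mem_of_mem_descentDeg (ρ := (descentAlgebra K).val) (fun _ => rfl)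
      (eulerianElement_mem K n) x
    refine mem_freeLieDeg_of_primitive ?_ h
    rw [coe_eulerianElement]
    exact logSeries_projSeries_apply_mem (tensor_isConnectedGradedBialgebra K) n x
  map_eq n x hx := by
    have hp := freeLie_le_primitiveLie hx.1
    rcases Nat.eq_zero_or_pos n with rfl | hn
    · rw [(tensor_isConnectedGradedBialgebra K).eq_zero_of_mem hp hx.2, map_zero]
    · rw [coe_eulerianElement]
      exact logSeries_projSeries_apply_primitive (tensor_isConnectedGradedBialgebra K) hn.ne' hp
        hx.2

theorem isLieIdempotentSeries_dynkinElement :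
    IsLieIdempotentSeries fun n => (n : K)⁻¹ • dynkinElement K n := by
  have hv (n : ℕ) {x : T K} (hx : x ∈ tensorDeg K n) :
      ((n : K)⁻¹ • dynkinElement K n).1.ofConv x = (n : K)⁻¹ • dynkin K x := by
    change (n : K)⁻¹ • (dynkinElement K n).1.ofConv x = _
    rw [ofConv_dynkinElement, dynkinDeg, LinearMap.comp_apply, proj_of_mem _ hx, if_pos rfl]
  have hm (n : ℕ) : (n : K)⁻¹ • dynkinElement K n ∈ descentDeg K n :=
    Submodule.smul_mem _ _ (dynkinElement_mem K n)
  refine ⟨hm, fun n x hx => ⟨?_, ?_⟩, fun n x hx => ?_⟩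
  · rw [hv n hx]
    exact (freeLie K).smul_mem _ (dynkin_mem_freeLie x)
  · exact apply_mem_of_mem_descentDeg (ρ := (descentAlgebra K).val) (fun _ => rfl) (hm n) x
  · have hp := freeLie_le_primitiveLie hx.1
    rw [hv n hx.2]
    -- in degree `0`, where `(0 : K)⁻¹ = 0`, the only primitive element is `0`
    rcases Nat.eq_zero_or_pos n with rfl | hn
    · rw [(tensor_isConnectedGradedBialgebra K).eq_zero_of_mem hp hx.2, map_zero, smul_zero]
    · rw [dynkin_apply_primitive hp hx.2, ← Nat.cast_smul_eq_nsmul K,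
        inv_smul_smul₀ (Nat.cast_ne_zero.2 hn.ne')]

end Dynkin

/-! ### The Eulerian and Dynkin series on group-like series -/

section SeriesOperations

variable {K : Type*} [Field K] {H : Type*} [Ring H] [HopfAlgebra K H]

theorem seriesLog_eq_logSeries (g : H⟦X⟧) : seriesLog (K := K) g = logSeries K g := by
  ext n
  rw [coeff_logSeries, seriesLog, coeff_mk]

theorem seriesExp_eq_expSeries (h : H⟦X⟧) : seriesExp (K := K) h = expSeries K h := by
  ext n
  rw [coeff_expSeries, seriesExp, coeff_mk]

theorem Gam_eq_gamSeries (h : H⟦X⟧) : Gam (K := K) h = gamSeries K h := rfl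

variable {𝒜 : ℕ → Submodule K H} [GradedAlgebra 𝒜] (h𝒜 : IsConnectedGradedBialgebra 𝒜)
  {ρ : descentAlgebra K →ₐ[K] WithConv (H →ₗ[K] H)}
  (hρ : ∀ n, ρ (descentGen K n) = gradedProj 𝒜 n)
include h𝒜 hρ

theorem seriesMap_eulerianElement {g : H⟦X⟧} (hg : g ∈ groupLike 𝒜) :
    seriesMap ρ (eulerianElement K) g = logSeries K g := by
  obtain ⟨hg, hgm⟩ := (mem_groupLike_iff h𝒜).1 hg
  have hid : groupLikeEval h𝒜 hg hgm (toConv (LinearMap.id : H →ₗ[K] H)) = g := by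
    ext n
    rw [coeff_groupLikeEval]
    rfl
  ext n
  rw [coeff_seriesMap, apply_eulerianElement hρ h𝒜, coeff_logSeries_projSeries h𝒜, coeff_logSeries,
    WithConv.ofConv_sum, LinearMap.sum_apply]
  refine Finset.sum_congr rfl fun k _ => ?_
  rw [WithConv.ofConv_smul, LinearMap.smul_apply, LinearMap.comp_apply, proj_of_mem 𝒜 (hgm n),
    if_pos rfl, ← coeff_groupLikeEval h𝒜 hg hgm, map_pow, map_sub, hid, map_one]

/-- Evaluation of the identity `(∑ p_i X^i) * (∑ D_j X^j) = ∑ n p_n X^n` at a group-like series `g`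
shows that `g * D g` is the image of `g` under the grading operation. -/
theorem seriesMap_dynkinElement {g : H⟦X⟧} (hg : g ∈ groupLike 𝒜) :
    seriesMap ρ (dynkinElement K) g = logDer g := by
  obtain ⟨hg, hgm⟩ := (mem_groupLike_iff h𝒜).1 hg
  refine (logDer_eq hg.coeff_zero ?_).symm
  have h0 := coeff_zero_projSeries h𝒜
  have h1 := mul_logDer h0
  ext n
  have h2 := congrArg (fun s => (coeff n s).ofConv (coeff n g)) h1
  simp only [coeff_mul, coeff_eulerDer, ← apply_dynkinElement hρ h𝒜, WithConv.ofConv_sum,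
    LinearMap.sum_apply] at h2
  simp only [projSeries, coeff_mk] at h2
  rw [coeff_mul, coeff_eulerDer]
  have h3 : (n • gradedProj 𝒜 n).ofConv (coeff n g) = n • coeff n g := by
    change n • GradedAlgebra.proj 𝒜 n (coeff n g) = _
    rw [proj_of_mem 𝒜 (hgm n), if_pos rfl]
  refine (h2.trans h3).symm.trans (Finset.sum_congr rfl fun p hp => ?_)
  have h4 : groupLikeEval h𝒜 hg hgm (ρ (dynkinElement K p.2)) =
      monomial p.2 ((ρ (dynkinElement K p.2)).ofConv (coeff p.2 g)) := by
    ext m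
    rw [coeff_groupLikeEval, coeff_monomial]
    split_ifs with hm
    · rw [hm]
    · exact apply_eq_zero_of_mem_descentDeg hρ h𝒜 (dynkinElement_mem K _) hm (hgm m)
  rw [← coeff_groupLikeEval h𝒜 hg hgm, map_mul, groupLikeEval_gradedProj, h4,
    monomial_mul_monomial, coeff_monomial, if_pos (mem_antidiagonal.1 hp).symm, coeff_seriesMap]

variable [CharZero K]

/-- The bijection induced by the Eulerian series is the logarithm. -/
theorem invOn_seriesExp : Set.InvOn (seriesExp (K := K)) (seriesMap ρ (eulerianElement K))
    (groupLike 𝒜) (primitive 𝒜) := by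
  refine ⟨fun g hg => ?_, fun h hh => ?_⟩
  · rw [seriesMap_eulerianElement h𝒜 hρ hg, seriesExp_eq_expSeries,
      expSeries_logSeries ((mem_groupLike_iff h𝒜).1 hg).1.coeff_zero]
  · rw [seriesExp_eq_expSeries, seriesMap_eulerianElement h𝒜 hρ (expSeries_mem_groupLike h𝒜 hh),
      logSeries_expSeries ((mem_primitive_iff h𝒜).1 hh).1.coeff_zero]

omit hρ in
theorem gamSeries_mem_groupLike {h : H⟦X⟧} (hh : h ∈ primitive 𝒜) :
    gamSeries K h ∈ groupLike 𝒜 := by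
  rw [mem_primitive_iff h𝒜] at hh
  rw [mem_groupLike_iff h𝒜]
  exact ⟨IsPrimitiveSeries.gamSeries commute_includeLeft_includeRight hh.1, gamSeries_mem hh.2⟩

omit hρ [CharZero K] in
theorem logDer_mem_primitive {g : H⟦X⟧} (hg : g ∈ groupLike 𝒜) : logDer g ∈ primitive 𝒜 := by
  rw [mem_groupLike_iff h𝒜] at hg
  rw [mem_primitive_iff h𝒜]
  exact ⟨IsGroupLikeSeries.logDer commute_includeLeft_includeRight hg.1,
    logDer_coeff_mem hg.2 hg.1.coeff_zero⟩

/-- The bijection induced by the Dynkin series is the logarithmic derivative. -/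
theorem invOn_Gam : Set.InvOn (Gam (K := K)) (seriesMap ρ (dynkinElement K))
    (groupLike 𝒜) (primitive 𝒜) := by
  refine ⟨fun g hg => ?_, fun h hh => ?_⟩
  · rw [seriesMap_dynkinElement h𝒜 hρ hg]
    exact gamSeries_logDer ((mem_groupLike_iff h𝒜).1 hg).1.coeff_zero
  · rw [Gam_eq_gamSeries, seriesMap_dynkinElement h𝒜 hρ (gamSeries_mem_groupLike h𝒜 hh)]
    exact logDer_gamSeries ((mem_primitive_iff h𝒜).1 hh).1.coeff_zero

theorem bijOn_dynkinElement :
    Set.BijOn (seriesMap ρ (dynkinElement K)) (groupLike 𝒜) (primitive 𝒜) := by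
  refine (invOn_Gam h𝒜 hρ).bijOn (fun g hg => ?_) fun h hh => gamSeries_mem_groupLike h𝒜 hh
  rw [seriesMap_dynkinElement h𝒜 hρ hg]
  exact logDer_mem_primitive h𝒜 hg

omit h𝒜 hρ [CharZero K] in
theorem coeff_seriesMap_inv_smul (d : ℕ → descentAlgebra K) (f : H⟦X⟧) (n : ℕ) :
    coeff n (seriesMap ρ (fun n => (n : K)⁻¹ • d n) f) =
      (n : K)⁻¹ • coeff n (seriesMap ρ d f) := by
  rw [coeff_seriesMap, coeff_seriesMap, map_smul]
  rfl

omit h𝒜 hρ in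
theorem cast_inv_smul_nsmul {n : ℕ} {x : H} (h : n = 0 → x = 0) : (n : K)⁻¹ • n • x = x := by
  rcases Nat.eq_zero_or_pos n with rfl | hn
  · rw [h rfl, smul_zero, smul_zero]
  · rw [← Nat.cast_smul_eq_nsmul K, inv_smul_smul₀ (Nat.cast_ne_zero.2 hn.ne')]

omit h𝒜 hρ in
theorem nsmul_cast_inv_smul {n : ℕ} {x : H} (h : n = 0 → x = 0) : n • (n : K)⁻¹ • x = x := by
  rw [smul_comm, cast_inv_smul_nsmul h]

theorem invOn_Gam_gradingMap : Set.InvOn (fun h => Gam (K := K) (gradingMap h))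
    (seriesMap ρ fun n => (n : K)⁻¹ • dynkinElement K n) (groupLike 𝒜) (primitive 𝒜) := by
  have hI := invOn_Gam h𝒜 hρ
  refine ⟨fun g hg => ?_, fun h hh => ?_⟩
  · have h0 : gradingMap (seriesMap ρ (fun n => (n : K)⁻¹ • dynkinElement K n) g) =
        seriesMap ρ (dynkinElement K) g := by
      ext n
      rw [gradingMap, coeff_mk, coeff_seriesMap_inv_smul]
      refine nsmul_cast_inv_smul ?_
      rintro rfl
      rw [seriesMap_dynkinElement h𝒜 hρ hg, coeff_zero_logDer]
    change Gam (gradingMap _) = g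
    rw [h0]
    exact hI.1 hg
  · have hh' := (mem_primitive_iff h𝒜).1 hh
    have hY : gradingMap h ∈ primitive 𝒜 := by
      rw [mem_primitive_iff h𝒜]
      refine ⟨IsPrimitiveSeries.of_comul_coeff (by simp [gradingMap]) fun n => ?_, fun n => ?_⟩
      · rw [gradingMap, coeff_mk]
        exact (primitiveLie K H).toSubmodule.smul_of_tower_mem n (hh'.1.comul_coeff n)
      · rw [gradingMap, coeff_mk]
        exact Submodule.smul_of_tower_mem _ n (hh'.2 n)
    ext n
    rw [coeff_seriesMap_inv_smul, hI.2 hY, gradingMap, coeff_mk]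
    refine cast_inv_smul_nsmul ?_
    rintro rfl
    exact hh'.1.coeff_zero

end SeriesOperations

/-! ### The pro-unipotent group and the pro-nilpotent Lie algebra -/

section Filtration

variable {A : Type*} [Ring A]

/-- The filtration of a power series ring by the additive subgroups of the series without component
of degree `< n`. -/
def seriesFiltration (A : Type*) [Ring A] (n : ℕ) : AddSubgroup A⟦X⟧ where
  carrier := {f | ∀ m < n, coeff m f = 0}
  zero_mem' _ _ := map_zero _
  add_mem' hf hg m hm := by rw [map_add, hf m hm, hg m hm, add_zero]
  neg_mem' hf m hm := by rw [map_neg, hf m hm, neg_zero]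

theorem mem_seriesFiltration {n : ℕ} {f : A⟦X⟧} :
    f ∈ seriesFiltration A n ↔ ∀ m < n, coeff m f = 0 := Iff.rfl

theorem mem_seriesFiltration_one {f : A⟦X⟧} : f ∈ seriesFiltration A 1 ↔ coeff 0 f = 0 := by
  rw [mem_seriesFiltration]
  exact ⟨fun h => h 0 Nat.one_pos, fun h m hm => by rwa [Nat.lt_one_iff.1 hm]⟩

theorem truncEq_iff_sub_mem {N : ℕ} {f g : A⟦X⟧} :
    TruncEq N f g ↔ f - g ∈ seriesFiltration A (N + 1) := by
  simp only [TruncEq, mem_seriesFiltration, map_sub, sub_eq_zero, Nat.lt_succ_iff]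

theorem mul_mem_seriesFiltration {m n : ℕ} {f g : A⟦X⟧} (hf : f ∈ seriesFiltration A m)
    (hg : g ∈ seriesFiltration A n) : f * g ∈ seriesFiltration A (m + n) := by
  intro k hk
  rw [coeff_mul]
  refine Finset.sum_eq_zero fun p hp => ?_
  rw [mem_antidiagonal] at hp
  rcases Nat.lt_or_ge p.1 m with h | h
  · rw [hf _ h, zero_mul]
  · rw [hg _ (by omega), mul_zero]

theorem mul_mem_seriesFiltration_left {n : ℕ} {f : A⟦X⟧} (g : A⟦X⟧)
    (hf : f ∈ seriesFiltration A n) : f * g ∈ seriesFiltration A n :=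
  mul_mem_seriesFiltration (n := 0) hf fun _ h => absurd h (Nat.not_lt_zero _)

theorem mul_mem_seriesFiltration_right {n : ℕ} {f : A⟦X⟧} (g : A⟦X⟧)
    (hf : f ∈ seriesFiltration A n) : g * f ∈ seriesFiltration A n := by
  have h := mul_mem_seriesFiltration (m := 0) (f := g) (fun _ h => absurd h (Nat.not_lt_zero _)) hf
  rwa [zero_add] at h

/-- The subgroup of the invertible series that are congruent to `1` in degrees `< n`. -/
def congruenceSubgroup (A : Type*) [Ring A] (n : ℕ) : Subgroup A⟦X⟧ˣ where
  carrier := {u | (u : A⟦X⟧) - 1 ∈ seriesFiltration A n}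
  one_mem' := by
    change ((1 : A⟦X⟧ˣ) : A⟦X⟧) - 1 ∈ seriesFiltration A n
    rw [Units.val_one, sub_self]
    exact zero_mem _
  mul_mem' {u v} hu hv := by
    have h : ((u * v : A⟦X⟧ˣ) : A⟦X⟧) - 1 = ((u : A⟦X⟧) - 1) * v + ((v : A⟦X⟧) - 1) := by
      rw [Units.val_mul]
      noncomm_ring
    change ((u * v : A⟦X⟧ˣ) : A⟦X⟧) - 1 ∈ seriesFiltration A n
    rw [h]
    exact add_mem (mul_mem_seriesFiltration_left _ hu) hv
  inv_mem' {u} hu := by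
    have h : ((u⁻¹ : A⟦X⟧ˣ) : A⟦X⟧) - 1 = -(((u⁻¹ : A⟦X⟧ˣ) : A⟦X⟧) * ((u : A⟦X⟧) - 1)) := by
      rw [mul_sub, Units.inv_mul, mul_one, neg_sub]
    change ((u⁻¹ : A⟦X⟧ˣ) : A⟦X⟧) - 1 ∈ seriesFiltration A n
    rw [h]
    exact neg_mem (mul_mem_seriesFiltration_right _ hu)

theorem mem_congruenceSubgroup {n : ℕ} {u : A⟦X⟧ˣ} :
    u ∈ congruenceSubgroup A n ↔ (u : A⟦X⟧) - 1 ∈ seriesFiltration A n := Iff.rfl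

open scoped commutatorElement in
/-- The identity behind this is `u v - v u = (u - 1) (v - 1) - (v - 1) (u - 1)`. -/
theorem commutatorElement_mem_congruenceSubgroup {m n : ℕ} {u v : A⟦X⟧ˣ}
    (hu : u ∈ congruenceSubgroup A m) (hv : v ∈ congruenceSubgroup A n) :
    ⁅u, v⁆ ∈ congruenceSubgroup A (m + n) := by
  rw [mem_congruenceSubgroup] at *
  set a : A⟦X⟧ := (u : A⟦X⟧) - 1 with ha
  set b : A⟦X⟧ := (v : A⟦X⟧) - 1 with hb
  have h1 : ((u : A⟦X⟧) * v - v * u) = a * b - b * a := by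
    rw [ha, hb]
    noncomm_ring
  have h2 : ((⁅u, v⁆ : A⟦X⟧ˣ) : A⟦X⟧) - 1 = (a * b - b * a) * ↑(u⁻¹ * v⁻¹) := by
    rw [← h1, sub_mul, commutatorElement_def, ← Units.val_mul, ← Units.val_mul, ← Units.val_mul,
      ← Units.val_mul, mul_assoc (u * v)]
    congr 1
    rw [show v * u * (u⁻¹ * v⁻¹) = 1 by group, Units.val_one]
  rw [h2]
  refine mul_mem_seriesFiltration_left _ (sub_mem (mul_mem_seriesFiltration hu hv) ?_)
  rw [add_comm]
  exact mul_mem_seriesFiltration hv hu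

theorem lowerCentralSeries_le_congruenceSubgroup {G : Subgroup A⟦X⟧ˣ}
    (hG : G ≤ congruenceSubgroup A 1) (N : ℕ) :
    G.lowerCentralSeries N ≤ congruenceSubgroup A (N + 1) := by
  induction N with
  | zero => exact hG
  | succ N ih =>
    rw [Subgroup.lowerCentralSeries_succ, Subgroup.commutator_le]
    exact fun u hu v hv => commutatorElement_mem_congruenceSubgroup (ih hu) (hG hv)

variable {K : Type*} [Field K] [Algebra K A]

theorem lowerCentralSeries_le_seriesFiltration {L : LieSubalgebra K A⟦X⟧}
    (hL : ∀ x ∈ L, x ∈ seriesFiltration A 1) (N : ℕ) {x : L}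
    (hx : x ∈ LieModule.lowerCentralSeries K L L N) : (x : A⟦X⟧) ∈ seriesFiltration A (N + 1) := by
  induction N generalizing x with
  | zero => exact hL x x.2
  | succ N ih =>
    rw [LieModule.lowerCentralSeries_succ, ← LieSubmodule.mem_toSubmodule,
      LieSubmodule.lieIdeal_oper_eq_linear_span'] at hx
    induction hx using Submodule.span_induction with
    | mem x hx =>
      obtain ⟨y, -, z, hz, rfl⟩ := hx
      rw [LieSubalgebra.coe_bracket, LieRing.of_associative_ring_bracket]
      refine sub_mem ?_ (mul_mem_seriesFiltration (ih hz) (hL y y.2))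
      rw [add_comm]
      exact mul_mem_seriesFiltration (hL y y.2) (ih hz)
    | zero => exact zero_mem _
    | add x y _ _ hx hy => exact add_mem hx hy
    | smul c x _ hx =>
      intro m hm
      change coeff m (c • (x : A⟦X⟧)) = 0
      rw [PowerSeries.coeff_smul, hx m hm, smul_zero]

end Filtration

section Pro

variable {K : Type*} [Field K] {H : Type*} [Ring H] [HopfAlgebra K H]
  {𝒜 : ℕ → Submodule K H} [GradedAlgebra 𝒜] (h𝒜 : IsConnectedGradedBialgebra 𝒜)
include h𝒜

/-- `G(H)`, as a group of invertible series. -/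
def groupLikeSubgroup : Subgroup H⟦X⟧ˣ where
  carrier := {u | (u : H⟦X⟧) ∈ groupLike 𝒜}
  one_mem' := by
    change (1 : H⟦X⟧) ∈ groupLike 𝒜
    rw [mem_groupLike_iff h𝒜]
    exact ⟨⟨by simp, by simp⟩, one_coeff_mem⟩
  mul_mem' hu hv := mul_mem_groupLike h𝒜 hu hv
  inv_mem' {u} hu := by
    have h := (mem_groupLike_iff h𝒜).1 hu
    change ((u⁻¹ : H⟦X⟧ˣ) : H⟦X⟧) ∈ groupLike 𝒜
    rw [mem_groupLike_iff h𝒜]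
    exact ⟨h.1.inv commute_includeLeft_includeRight u.mul_inv u.inv_mul,
      coeff_mem_of_mul_eq_one h.2 h.1.coeff_zero u.mul_inv⟩

theorem exists_mem_groupLikeSubgroup {g : H⟦X⟧} (hg : g ∈ groupLike 𝒜) :
    ∃ u ∈ groupLikeSubgroup h𝒜, (u : H⟦X⟧) = g := by
  have h0 := ((mem_groupLike_iff h𝒜).1 hg).1.coeff_zero
  exact ⟨⟨g, seriesInv g, mul_seriesInv h0, seriesInv_mul h0⟩, hg, rfl⟩

theorem image_groupLikeSubgroup :
    (fun u : H⟦X⟧ˣ => (u : H⟦X⟧)) '' (groupLikeSubgroup h𝒜 : Set H⟦X⟧ˣ) = groupLike 𝒜 := by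
  ext g
  refine ⟨?_, fun hg => exists_mem_groupLikeSubgroup h𝒜 hg⟩
  rintro ⟨u, hu, rfl⟩
  exact hu

theorem isProUnipotent_groupLikeSubgroup : IsProUnipotent (groupLikeSubgroup h𝒜) := by
  have h0 (u : H⟦X⟧ˣ) (hu : u ∈ groupLikeSubgroup h𝒜) : coeff 0 ((u : H⟦X⟧) - 1) = 0 :=
    coeff_zero_sub_one ((mem_groupLike_iff h𝒜).1 hu).1.coeff_zero
  refine ⟨fun N u hu n hn => ?_, fun N u hu => ?_, fun f hf => ?_⟩
  · rw [coeff_pow_eq_zero (h0 u hu) (Nat.lt_succ_of_le hn), map_zero]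
  · rw [truncEq_iff_sub_mem]
    exact lowerCentralSeries_le_congruenceSubgroup
      (fun v hv => mem_seriesFiltration_one.2 (h0 v hv)) N hu
  · refine exists_mem_groupLikeSubgroup h𝒜 (mem_groupLike_of_truncEq fun N => ?_)
    obtain ⟨u, hu, huf⟩ := hf N
    exact ⟨u, hu, huf⟩

/-- `Prim(H)`, as a Lie algebra of series. -/
def primitiveSubalgebra : LieSubalgebra K H⟦X⟧ where
  carrier := primitive 𝒜
  zero_mem' := by
    rw [mem_primitive_iff h𝒜]
    exact ⟨⟨map_zero _, by simp⟩, fun n => by rw [map_zero]; exact Submodule.zero_mem _⟩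
  add_mem' {x y} hx hy := by
    rw [mem_primitive_iff h𝒜] at *
    refine ⟨IsPrimitiveSeries.of_comul_coeff ?_ fun n => ?_, fun n => ?_⟩
    · rw [map_add, hx.1.coeff_zero, hy.1.coeff_zero, add_zero]
    · rw [map_add]
      exact (primitiveLie K H).add_mem (hx.1.comul_coeff n) (hy.1.comul_coeff n)
    · rw [map_add]
      exact Submodule.add_mem _ (hx.2 n) (hy.2 n)
  smul_mem' c x hx := by
    change x ∈ primitive 𝒜 at hx
    change c • x ∈ primitive 𝒜
    rw [mem_primitive_iff h𝒜] at *
    refine ⟨IsPrimitiveSeries.of_comul_coeff ?_ fun n => ?_, fun n => ?_⟩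
    · rw [PowerSeries.coeff_smul, hx.1.coeff_zero, smul_zero]
    · rw [PowerSeries.coeff_smul]
      exact (primitiveLie K H).smul_mem c (hx.1.comul_coeff n)
    · rw [PowerSeries.coeff_smul]
      exact Submodule.smul_mem _ _ (hx.2 n)
  lie_mem' {x y} hx hy := by
    change x ∈ primitive 𝒜 at hx
    change y ∈ primitive 𝒜 at hy
    rw [mem_primitive_iff h𝒜] at *
    rw [LieRing.of_associative_ring_bracket]
    refine ⟨⟨?_, ?_⟩, fun n => ?_⟩
    · rw [map_sub, coeff_mul, coeff_mul, Finset.Nat.antidiagonal_zero, Finset.sum_singleton,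
        Finset.sum_singleton, hx.1.coeff_zero, hy.1.coeff_zero, sub_self]
    · have h1 := commute_map_map (K := K) (commute_includeLeft_includeRight (K := K) (H := H)) x y
      have h2 := commute_map_map (K := K) (commute_includeLeft_includeRight (K := K) (H := H)) y x
      rw [map_sub, map_mul, map_mul, hx.1.map_eq, hy.1.map_eq, map_sub, map_sub, map_mul, map_mul,
        map_mul, map_mul, add_mul, add_mul, mul_add, mul_add, mul_add, mul_add, h1.eq, h2.eq]
      abel
    · rw [map_sub]
      exact Submodule.sub_mem _ (mul_coeff_mem hx.2 hy.2 n) (mul_coeff_mem hy.2 hx.2 n)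

theorem isProNilpotent_primitiveSubalgebra : IsProNilpotent (primitiveSubalgebra h𝒜) := by
  refine ⟨fun N x hx => ?_, fun f hf => mem_primitive_of_truncEq hf⟩
  rw [truncEq_iff_sub_mem, sub_zero]
  exact lowerCentralSeries_le_seriesFiltration (fun y hy =>
    mem_seriesFiltration_one.2 ((mem_primitive_iff h𝒜).1 hy).1.coeff_zero) N hx

end Pro

end LieIdem

end

open LieIdem in
theorem mainTheorem4 {K : Type*} [Field K] [CharZero K] {H : Type*} [Ring H] [HopfAlgebra K H]
    [Coalgebra.IsCocomm K H] (𝒜 : ℕ → Submodule K H) [GradedAlgebra 𝒜]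
    (h𝒜 : IsConnectedGradedHopf 𝒜) :
    -- `G(H)` is a pro-unipotent group and `Prim(H)` is a pro-nilpotent Lie algebra
    (∃ G : Subgroup H⟦X⟧ˣ, (fun u : H⟦X⟧ˣ => (u : H⟦X⟧)) '' (G : Set H⟦X⟧ˣ) = groupLike 𝒜 ∧
      IsProUnipotent G) ∧
    (∃ L : LieSubalgebra K H⟦X⟧, (L : Set H⟦X⟧) = primitive 𝒜 ∧ IsProNilpotent L) ∧
    -- the descent algebra acts on `H`, in exactly one way
    ∃ ρ : descentAlgebra K →ₐ[K] WithConv (H →ₗ[K] H),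
      (∀ n, ρ (descentGen K n) = gradedProj 𝒜 n) ∧
      (∀ ρ' : descentAlgebra K →ₐ[K] WithConv (H →ₗ[K] H),
        (∀ n, ρ' (descentGen K n) = gradedProj 𝒜 n) → ρ' = ρ) ∧
      -- any Lie idempotent series induces an isomorphism, compatible with truncations
      (∀ γ : ℕ → descentAlgebra K, IsLieIdempotentSeries γ →
        Set.BijOn (seriesMap ρ γ) (groupLike 𝒜) (primitive 𝒜) ∧
        ∀ N, ∀ g ∈ groupLike 𝒜, ∀ g' ∈ groupLike 𝒜,
          TruncEq N (seriesMap ρ γ g) (seriesMap ρ γ g') ↔ TruncEq N g g') ∧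
      -- the Eulerian series
      (∃ e : ℕ → descentAlgebra K, (∀ n, (e n).1.ofConv = eulerian K n) ∧
        IsLieIdempotentSeries e ∧
        Set.EqOn (seriesMap ρ e) (seriesLog (K := K)) (groupLike 𝒜) ∧
        Set.MapsTo (seriesExp (K := K)) (primitive 𝒜) (groupLike 𝒜) ∧
        Set.InvOn (seriesExp (K := K)) (seriesMap ρ e) (groupLike 𝒜) (primitive 𝒜)) ∧
      -- the Dynkin series `D = (D_n)` and the Dynkin idempotent series `(D_n / n)`
      ∃ d : ℕ → descentAlgebra K, (∀ n, (d n).1.ofConv = dynkinDeg K n) ∧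
        IsLieIdempotentSeries (fun n => (n : K)⁻¹ • d n) ∧
        Set.BijOn (seriesMap ρ d) (groupLike 𝒜) (primitive 𝒜) ∧
        Set.MapsTo (Gam (K := K)) (primitive 𝒜) (groupLike 𝒜) ∧
        Set.InvOn (Gam (K := K)) (seriesMap ρ d) (groupLike 𝒜) (primitive 𝒜) ∧
        Set.InvOn (fun h => Gam (K := K) (gradingMap h))
          (seriesMap ρ fun n => (n : K)⁻¹ • d n) (groupLike 𝒜) (primitive 𝒜) := by
  have hB := h𝒜.isConnectedGradedBialgebra
  obtain ⟨ρ, hρP⟩ := exists_descentAction hB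
  have hρ (n : ℕ) : ρ (descentGen K n) = gradedProj 𝒜 n := by
    have h := hρP (FreeAlgebra.ι K n)
    rwa [descentPresentation, projEval, FreeAlgebra.lift_ι_apply, FreeAlgebra.lift_ι_apply] at h
  refine ⟨⟨groupLikeSubgroup hB, image_groupLikeSubgroup hB, isProUnipotent_groupLikeSubgroup hB⟩,
    ⟨primitiveSubalgebra hB, rfl, isProNilpotent_primitiveSubalgebra hB⟩, ρ, hρ,
    fun ρ' hρ' => descentAction_ext fun n => (hρ' n).trans (hρ n).symm,
    fun γ hγ => ⟨hγ.bijOn hB hρ, fun N g hg g' hg' => hγ.truncEq_iff hB hρ N hg hg'⟩,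
    ⟨eulerianElement K, ofConv_eulerianElement, isLieIdempotentSeries_eulerianElement,
      fun g hg => ?_, fun h hh => ?_, invOn_seriesExp hB hρ⟩,
    dynkinElement K, ofConv_dynkinElement, isLieIdempotentSeries_dynkinElement,
    bijOn_dynkinElement hB hρ, fun h hh => gamSeries_mem_groupLike hB hh, invOn_Gam hB hρ,
    invOn_Gam_gradingMap hB hρ⟩
  · rw [seriesLog_eq_logSeries, seriesMap_eulerianElement hB hρ hg]
  · rw [seriesExp_eq_expSeries]
    exact expSeries_mem_groupLike hB hh
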